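/- An instance $(G,H)$ consists of a finite undirected supply graph $G$ (loops and parallel edges allowed) that is given with an embedding in the plane, described by the clockwise cyclic order of the edge ends about each vertex, and a finite demand graph $H$ on the same vertex set (parallel edges allowed, no loops, not necessarily planar). All capacities and demands are $1$. An integral uncrossed trail flow for $(G,H)$ is a choice, for every demand edge $st$ of $H$, of an $s$–$t$ trail in $G$ (a walk that may repeat vertices but not edges), such that different demands use edge-disjoint trails, and such that there is no vertex about which four distinct edge ends occur in the clockwise order $e,g,e',g'$ with $e,e'$ consecutive in one of the trails and $g,g'$ consecutive in one of the trails (possibly the same one). Totally node-disjoint paths for $(G,H)$ are a choice, for every demand edge $st$ of $H$, of an $s$–$t$ path in $G$ (no repeated vertex), such that the paths of different demands have no vertex in common, end vertices included. **Theorem.** There are a constant $c$ and an algorithm, running in time polynomial in $|V(G)|+|E(G)|+|E(H)|$, that computes from each such instance $(G,H)$ an instance $(\hat G,\hat H)$, again with a plane graph $\hat G$, such that 1. $(G,H)$ has an integral uncrossed trail flow if and only if $(\hat G,\hat H)$ has totally node-disjoint paths; and 2. $|V(\hat G)|\le c\,\max(1,\Delta)^3\,|V(G)|$, where $\Delta$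 is the maximum degree of $G$ (loops count twice). -/

import Mathlib

/-- A finite undirected graph (loops and parallel edges allowed) with vertices `V` and edges `E`,
cellularly embedded component by component, given as a rotation system. Each edge `e` has two darts
(half-edges) `(e, false)` and `(e, true)`; `vert d` is the vertex at which the dart `d` is attached.
The permutation `rot` sends a dart to the next one clockwise about its vertex, so that its cycles
are exactly the sets of darts attached to a common vertex. -/
structure EmbeddedGraph (V E : Type*) where
  vert : E × Bool → V
  rot : Equiv.Perm (E × Bool)
  sameCycle_iff : ∀ d d' : E × Bool, rot.SameCycle d d' ↔ vert d = vert d'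

namespace EmbeddedGraph

variable {V E K : Type*}

/-- The involution that exchanges the two darts of every edge. -/
def flip : Equiv.Perm (E × Bool) where
  toFun d := (d.1, !d.2)
  invFun d := (d.1, !d.2)
  left_inv d := by simp
  right_inv d := by simp

/-- The face permutation: traverse a dart, then take the next dart clockwise at the far end. Its
cycles are the boundary walks of the faces. -/
def face (G : EmbeddedGraph V E) : Equiv.Perm (E × Bool) := G.rot * flip

/-- The number of orbits of a permutation group. -/
noncomputable def numOrbits {D : Type*} (S : Subgroup (Equiv.Perm D)) : ℕ :=
  Nat.card (MulAction.orbitRel.Quotient S D)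

/-- The embedding is planar: every component has genus zero. By Euler's formula this says that
`#vertices - #edges + #faces = 2 * #components`, where vertices, faces and components are counted as
orbits on darts (so that isolated vertices, which are harmless, do not enter on either side). Every
component has nonnegative genus, so the sum over the components forces each genus to vanish. -/
def Planar (G : EmbeddedGraph V E) : Prop :=
  numOrbits (Subgroup.zpowers G.rot) + numOrbits (Subgroup.zpowers G.face) =
    Nat.card E + 2 * numOrbits (Subgroup.closure {G.rot, flip})

/-- The degree of a vertex (a loop counts twice). -/
noncomputable def degree (G : EmbeddedGraph V E) (v : V) : ℕ := {d | G.vert d = v}.ncard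

/-- The maximum degree (`0` for the graph without vertices). -/
noncomputable def maxDegree [Fintype V] (G : EmbeddedGraph V E) : ℕ := Finset.univ.sup G.degree

/-- The vertex reached by traversing the dart `d`, starting from `G.vert d`. -/
def head (G : EmbeddedGraph V E) (d : E × Bool) : V := G.vert (flip d)

/-- `p` is the sequence of darts traversed by a walk from `s` to `t`. -/
def IsWalk (G : EmbeddedGraph V E) : V → V → List (E × Bool) → Prop
  | s, t, [] => s = t
  | s, t, d :: p => G.vert d = s ∧ G.IsWalk (G.head d) t p

/-- The sequence of edges of a walk. -/
def edges (p : List (E × Bool)) : List E := p.map Prod.fst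

/-- The sequence of vertices of a walk that starts at `s`. -/
def vertices (G : EmbeddedGraph V E) (s : V) (p : List (E × Bool)) : List V := s :: p.map G.head

/-- A trail is a walk that repeats no edge (it may repeat vertices). -/
def IsTrail (G : EmbeddedGraph V E) (s t : V) (p : List (E × Bool)) : Prop :=
  G.IsWalk s t p ∧ (edges p).Nodup

/-- A path is a walk that repeats no vertex. -/
def IsPath (G : EmbeddedGraph V E) (s t : V) (p : List (E × Bool)) : Prop :=
  G.IsWalk s t p ∧ (G.vertices s p).Nodup

/-- The walk `p` passes through a vertex by means of the two darts `a`, `b` attached to it (in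
either direction): the edges of `a` and `b` are consecutive in `p` there. -/
def PassesVia (p : List (E × Bool)) (a b : E × Bool) : Prop :=
  [flip a, b] <:+: p ∨ [flip b, a] <:+: p

/-- The darts `a, b, c, d` are distinct and occur in this clockwise order about a vertex. -/
def Clockwise (G : EmbeddedGraph V E) (a b c d : E × Bool) : Prop :=
  ∃ i j k : ℕ, 0 < i ∧ i < j ∧ j < k ∧ k < Function.minimalPeriod G.rot a ∧
    b = (G.rot ^ i) a ∧ c = (G.rot ^ j) a ∧ d = (G.rot ^ k) a

/-- An integral uncrossed trail flow for unit capacities and unit demands `dem`: one trail for each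
demand, no edge in two of the trails, such that about no vertex there are, in clockwise order, four
distinct darts `a, b, a', b'` where `a, a'` are consecutive in a trail and `b, b'` are consecutive in
a trail (possibly the same one). -/
def HasUncrossedTrailFlow (G : EmbeddedGraph V E) (dem : K → V × V) : Prop :=
  ∃ P : K → List (E × Bool),
    (∀ h, G.IsTrail (dem h).1 (dem h).2 (P h)) ∧
    (∀ h h', h ≠ h' → (edges (P h)).Disjoint (edges (P h'))) ∧
    (∀ h h' a a' b b', PassesVia (P h) a a' → PassesVia (P h') b b' → ¬ G.Clockwise a b a' b')

/-- Totally node-disjoint paths for the demands `dem`: one path for each demand, such that the paths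
of two demands have no vertex in common, not even an end vertex. -/
def HasNodeDisjointPaths (G : EmbeddedGraph V E) (dem : K → V × V) : Prop :=
  ∃ P : K → List (E × Bool),
    (∀ h, G.IsPath (dem h).1 (dem h).2 (P h)) ∧
    (∀ h h', h ≠ h' → (G.vertices (dem h).1 (P h)).Disjoint (G.vertices (dem h').1 (P h')))

end EmbeddedGraph

/-- A planar disjoint-paths instance: a plane supply graph `G` on the vertices `0, …, n - 1` with
edges `0, …, m - 1`, and a demand graph `H` on the same vertices, with edges `0, …, k - 1` (parallel
demands are allowed, and `H` need not be planar), each of which joins two distinct vertices. -/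
structure PlanarInstance where
  n : ℕ
  m : ℕ
  k : ℕ
  G : EmbeddedGraph (Fin n) (Fin m)
  planar : G.Planar
  H : Fin k → Fin n × Fin n
  H_ne : ∀ h, (H h).1 ≠ (H h).2

namespace PlanarInstance

/-- The input size `|V| + |E(G)| + |E(H)|`. -/
def size (I : PlanarInstance) : ℕ := I.n + I.m + I.k

end PlanarInstance

/-! A random access machine with addition and truncated subtraction, programmed by structured
programs. Every assignment and every evaluation of a test costs one step; there is no
multiplication, so that `t` steps produce only numbers of `O(t)` bits beyond the input. -/

namespace RAM

/-- Finitely many of the registers and arrays are used by a program. -/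
structure State where
  reg : ℕ → ℕ
  arr : ℕ → ℕ → ℕ

def State.setReg (s : State) (x v : ℕ) : State :=
  { s with reg := Function.update s.reg x v }

def State.setArr (s : State) (a i v : ℕ) : State :=
  { s with arr := Function.update s.arr a (Function.update (s.arr a) i v) }

inductive Expr where
  | const (v : ℕ)
  | reg (x : ℕ)
  | get (a : ℕ) (i : Expr)
  | add (e f : Expr)
  | sub (e f : Expr)

def Expr.eval (s : State) : Expr → ℕ
  | const v => v
  | reg x => s.reg x
  | get a i => s.arr a (i.eval s)
  | add e f => e.eval s + f.eval s
  | sub e f => e.eval s - f.eval s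

inductive Program where
  | assign (x : ℕ) (e : Expr)
  | store (a : ℕ) (i e : Expr)
  | seq (p q : Program)
  | ite (e : Expr) (p q : Program)
  | loop (e : Expr) (p : Program)

/-- `Runs p s s' t`: started in `s`, the program `p` halts in `s'` after `t` steps. A test `e`
succeeds when the value of `e` is nonzero; `loop e p` is the loop "while `e` do `p`". -/
inductive Runs : Program → State → State → ℕ → Prop where
  | assign (x : ℕ) (e : Expr) (s : State) :
      Runs (.assign x e) s (s.setReg x (e.eval s)) 1
  | store (a : ℕ) (i e : Expr) (s : State) :
      Runs (.store a i e) s (s.setArr a (i.eval s) (e.eval s)) 1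
  | seq {p q : Program} {s s' s'' : State} {t u : ℕ} :
      Runs p s s' t → Runs q s' s'' u → Runs (.seq p q) s s'' (t + u)
  | ite_true {e : Expr} {p q : Program} {s s' : State} {t : ℕ} :
      e.eval s ≠ 0 → Runs p s s' t → Runs (.ite e p q) s s' (t + 1)
  | ite_false {e : Expr} {p q : Program} {s s' : State} {t : ℕ} :
      e.eval s = 0 → Runs q s s' t → Runs (.ite e p q) s s' (t + 1)
  | loop_stop {e : Expr} {p : Program} {s : State} :
      e.eval s = 0 → Runs (.loop e p) s s 1
  | loop_step {e : Expr} {p : Program} {s s' s'' : State} {t u : ℕ} :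
      e.eval s ≠ 0 → Runs p s s' t → Runs (.loop e p) s' s'' u →
        Runs (.loop e p) s s'' (t + u + 1)

/-- The number of a dart: the darts of edge `e` have the numbers `2 * e` and `2 * e + 1`. -/
def dartIndex {m : ℕ} (d : Fin m × Bool) : ℕ := 2 * d.1 + d.2.toNat

/-- The state `s` holds the instance `I`: `n, m, k` are in the registers `0, 1, 2`, the vertices
and the clockwise successors of the darts in the arrays `0, 1`, and the two ends of the demands in
the arrays `2, 3`. -/
def State.Holds (s : State) (I : PlanarInstance) : Prop :=
  s.reg 0 = I.n ∧ s.reg 1 = I.m ∧ s.reg 2 = I.k ∧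
  (∀ d, s.arr 0 (dartIndex d) = I.G.vert d) ∧
  (∀ d, s.arr 1 (dartIndex d) = dartIndex (I.G.rot d)) ∧
  (∀ h : Fin I.k, s.arr 2 h = (I.H h).1) ∧
  (∀ h : Fin I.k, s.arr 3 h = (I.H h).2)

/-- `s` is an initial state for the input `I`: it holds `I` and is zero everywhere else. -/
def State.IsInitial (s : State) (I : PlanarInstance) : Prop :=
  s.Holds I ∧
  (∀ x, 3 ≤ x → s.reg x = 0) ∧
  (∀ a i, (a < 2 → 2 * I.m ≤ i) → (a = 2 ∨ a = 3 → I.k ≤ i) → s.arr a i = 0)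

/-- Every input has an initial state. -/
theorem exists_isInitial (I : PlanarInstance) : ∃ s : State, s.IsInitial I := by
  classical
  refine ⟨⟨fun x => if x = 0 then I.n else if x = 1 then I.m else if x = 2 then I.k else 0,
    fun a i =>
      if a = 0 then (if h : i / 2 < I.m then I.G.vert (⟨i / 2, h⟩, decide (i % 2 = 1)) else 0)
      else if a = 1 then
        (if h : i / 2 < I.m then dartIndex (I.G.rot (⟨i / 2, h⟩, decide (i % 2 = 1))) else 0)
      else if a = 2 then (if h : i < I.k then (I.H ⟨i, h⟩).1 else 0)
      else if a = 3 then (if h : i < I.k then (I.H ⟨i, h⟩).2 else 0) else 0⟩, ?_, ?_, ?_⟩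
  · refine ⟨by simp, by simp, by simp, ?_, ?_, ?_, ?_⟩
    · rintro ⟨⟨e, he⟩, b⟩
      cases b <;> simp [dartIndex, he, Nat.mul_add_div]
    · rintro ⟨⟨e, he⟩, b⟩
      cases b <;> simp [dartIndex, he, Nat.mul_add_div]
    · intro h; simp
    · intro h; simp
  · intro x hx
    have : x ≠ 0 ∧ x ≠ 1 ∧ x ≠ 2 := by omega
    simp [this]
  · intro a i h1 h2
    dsimp only
    split_ifs <;> first | rfl | (exfalso; omega)

/-- `f` is computable in time polynomial in the input size. -/
def PolyTimeComputable (f : PlanarInstance → PlanarInstance) : Prop :=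
  ∃ (p : Program) (T : Polynomial ℕ), ∀ (I : PlanarInstance) (s : State), s.IsInitial I →
    ∃ (s' : State) (t : ℕ), Runs p s s' t ∧ t ≤ T.eval I.size ∧ s'.Holds (f I)

end RAM

/-! Put q = max(1, Δ). Every vertex v of G is replaced by a cylinder with T + 2 = (q + 1)² layers
and one column for each dart at v. The node (l, c) is joined to (l + 1, c) and, diagonally, to (l +
1, `rot c`); the old edges are attached to layer 0. While descending, a path may stay in its column
or shift clockwise by one. There are at most q³n darts-times-squares to pay for: (q + 1)² · 2m ≤
4q³n nodes. Planarity is Euler's formula again (`Planar.hat`): the faces of the expansion are those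
of G, T quadrilaterals for each dart, and one innermost face in each cylinder.

Paths give trails (`hasUncrossedTrailFlow_of_hat`): keep only the old edges of each path. Two
crossing passages at v would come from disjoint walks in one cylinder that join interleaved pairs of
nodes of its outer layer. Since the innermost face closes the cylinder to a disc, this is
impossible. The proof is combinatorial: `side` counts modulo 2 how often a walk crosses a ray from a
node to the innermost face. It is constant along a walk disjoint from the first one, but around
layer 0 it changes exactly at the ends of the first walk.

Trails give paths (`Passages.hasNodeDisjointPaths`): all darts at v that are used send strands down
the cylinder, rotated simultaneously, so that strands never meet. The reduction cannot know by which
dart a trail starts or ends at v. It therefore puts all terminals at v in one fixed column, in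
different layers, one for each of q rounds of q layers; within a round the strands are rotated until
the right one reaches that column, where it stops. After q² layers only passing strands are left. A
pair at distance x in the clockwise order descends 2x further layers and is joined there by a zigzag
line. Nothing crosses, because in an uncrossed flow the pairs are nested or apart and an inner pair,
being closer, has been joined in a higher layer. Only disjointness between different demands
matters: a path is extracted from each connected set of used nodes.

Different demand ends at v use different darts in a flow. So if some end lies at a vertex without
darts, or needs a slot that is not less than q, there is no flow and a fixed unsolvable instance is
produced (`no_flow`). The remainder verifies a program that writes the expansion: each loop is
described by a `table`, the array after a number of assignments, and products are formed by repeated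
addition. -/

namespace EmbeddedGraph

/-! ### Counting orbits of permutation groups. -/

section Orbits

variable {D L : Type*}

/-- Two elements lie in one orbit of the permutation group `S`. -/
def SameOrbit (S : Subgroup (Equiv.Perm D)) (d d' : D) : Prop := ∃ g ∈ S, g d = d'

theorem SameOrbit.refl (S : Subgroup (Equiv.Perm D)) (d : D) : SameOrbit S d d :=
  ⟨1, S.one_mem, rfl⟩

theorem SameOrbit.symm {S : Subgroup (Equiv.Perm D)} {d d' : D} (h : SameOrbit S d d') :
    SameOrbit S d' d := by
  obtain ⟨g, hg, rfl⟩ := h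
  exact ⟨g⁻¹, S.inv_mem hg, by simp⟩

theorem SameOrbit.trans {S : Subgroup (Equiv.Perm D)} {a b c : D} (h : SameOrbit S a b)
    (h' : SameOrbit S b c) : SameOrbit S a c := by
  obtain ⟨g, hg, rfl⟩ := h
  obtain ⟨g', hg', rfl⟩ := h'
  exact ⟨g' * g, S.mul_mem hg' hg, rfl⟩

theorem sameOrbit_apply {S : Subgroup (Equiv.Perm D)} {g : Equiv.Perm D} (hg : g ∈ S) (d : D) :
    SameOrbit S d (g d) := ⟨g, hg, rfl⟩

theorem orbitRel_iff (S : Subgroup (Equiv.Perm D)) (d d' : D) :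
    (MulAction.orbitRel S D) d d' ↔ SameOrbit S d d' := by
  rw [MulAction.orbitRel_apply, MulAction.mem_orbit_iff]
  constructor
  · rintro ⟨⟨g, hg⟩, h⟩
    exact SameOrbit.symm ⟨g, hg, h⟩
  · intro h
    obtain ⟨g, hg, h⟩ := h.symm
    exact ⟨⟨g, hg⟩, h⟩

/-- The number of orbits is the number of values of a function that tells the orbits apart. -/
theorem numOrbits_eq_card (S : Subgroup (Equiv.Perm D)) (f : D → L) (hf : Function.Surjective f)
    (h : ∀ d d', f d = f d' ↔ SameOrbit S d d') : numOrbits S = Nat.card L := by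
  refine Nat.card_congr (Equiv.ofBijective
    (Quotient.lift f fun a b hab => (h a b).2 ((orbitRel_iff S a b).1 hab)) ⟨?_, ?_⟩)
  · rintro ⟨a⟩ ⟨b⟩ hab
    exact Quotient.sound ((orbitRel_iff S a b).2 ((h a b).1 hab))
  · intro l
    obtain ⟨d, rfl⟩ := hf l
    exact ⟨Quotient.mk _ d, rfl⟩

theorem mk_eq_mk_iff (S : Subgroup (Equiv.Perm D)) (d d' : D) :
    (Quotient.mk (MulAction.orbitRel S D) d = Quotient.mk (MulAction.orbitRel S D) d') ↔
      SameOrbit S d d' := by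
  rw [← orbitRel_iff]
  exact Quotient.eq

/-- A function that is invariant under the generators is constant on orbits. -/
theorem eq_of_sameOrbit_closure {s : Set (Equiv.Perm D)} (f : D → L)
    (hf : ∀ g ∈ s, ∀ d, f (g d) = f d) {d d' : D}
    (h : SameOrbit (Subgroup.closure s) d d') : f d = f d' := by
  obtain ⟨g, hg, rfl⟩ := h
  have : ∀ d, f (g d) = f d := by
    induction hg using Subgroup.closure_induction with
    | mem g hg => exact hf g hg
    | one => intro d; rfl
    | mul g g' _ _ h h' => intro d; rw [Equiv.Perm.mul_apply, h, h']
    | inv g _ h => intro d; rw [← h (g⁻¹ d)]; simp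
  exact (this d).symm

theorem eq_of_sameOrbit_zpowers {g : Equiv.Perm D} (f : D → L) (hf : ∀ d, f (g d) = f d)
    {d d' : D} (h : SameOrbit (Subgroup.zpowers g) d d') : f d = f d' := by
  rw [Subgroup.zpowers_eq_closure] at h
  exact eq_of_sameOrbit_closure f (by rintro _ rfl; exact hf) h

theorem sameOrbit_zpowers_iff {g : Equiv.Perm D} {d d' : D} :
    SameOrbit (Subgroup.zpowers g) d d' ↔ g.SameCycle d d' := by
  constructor
  · rintro ⟨_, ⟨i, rfl⟩, h⟩
    exact ⟨i, h⟩
  · rintro ⟨i, h⟩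
    exact ⟨g ^ i, ⟨i, rfl⟩, h⟩

/-- A relation between orbits transported along a map that intertwines the generators up to orbits. -/
theorem SameOrbit.map_closure {D' : Type*} {s : Set (Equiv.Perm D)} {S' : Subgroup (Equiv.Perm D')}
    (φ : D → D') (h : ∀ g ∈ s, ∀ d, SameOrbit S' (φ d) (φ (g d))) {d d' : D}
    (hd : SameOrbit (Subgroup.closure s) d d') : SameOrbit S' (φ d) (φ d') := by
  obtain ⟨g, hg, rfl⟩ := hd
  have : ∀ d, SameOrbit S' (φ d) (φ (g d)) := by
    induction hg using Subgroup.closure_induction with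
    | mem g hg => exact h g hg
    | one => intro d; exact SameOrbit.refl _ _
    | mul g g' _ _ h h' => intro d; exact (h' d).trans (h (g' d))
    | inv g _ h =>
      intro d
      have := h (g⁻¹ d)
      simpa using this.symm
  exact this d

theorem SameOrbit.map_zpowers {D' : Type*} {g : Equiv.Perm D} {S' : Subgroup (Equiv.Perm D')}
    (φ : D → D') (h : ∀ d, SameOrbit S' (φ d) (φ (g d))) {d d' : D}
    (hd : SameOrbit (Subgroup.zpowers g) d d') : SameOrbit S' (φ d) (φ d') := by
  rw [Subgroup.zpowers_eq_closure] at hd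
  exact SameOrbit.map_closure φ (by rintro _ rfl; exact h) hd

end Orbits

/-! ### The cylinder expansion and its planarity. -/

section Hat

variable {V E : Type*} (G : EmbeddedGraph V E) (T : ℕ)

/-- The nodes of the expansion: a column of `T + 2` nodes for every dart. -/
abbrev HatNode (E : Type*) (T : ℕ) : Type _ := Fin (T + 2) × (E × Bool)

/-- The edges of the expansion: the old edges, the vertical ones, and the diagonal ones. -/
abbrev HatEdge (E : Type*) (T : ℕ) : Type _ :=
  E ⊕ (Fin (T + 1) × (E × Bool) ⊕ Fin (T + 1) × (E × Bool))

/-- The dart of an old edge. -/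
def old {T : ℕ} (d : E × Bool) : HatEdge E T × Bool := (.inl d.1, d.2)

/-- The vertical edge from `(l, c)` to `(l + 1, c)`. -/
def ver {T : ℕ} (l : Fin (T + 1)) (c : E × Bool) (b : Bool) : HatEdge E T × Bool :=
  (.inr (.inl (l, c)), b)

/-- The diagonal edge from `(l, c)` to `(l + 1, rot c)`. -/
def diag {T : ℕ} (l : Fin (T + 1)) (c : E × Bool) (b : Bool) : HatEdge E T × Bool :=
  (.inr (.inr (l, c)), b)

theorem hatDart_cases {T : ℕ} {C : HatEdge E T × Bool → Prop} (ho : ∀ d, C (old d))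
    (hv : ∀ l c b, C (ver l c b)) (hd : ∀ l c b, C (diag l c b)) : ∀ d, C d
  | (.inl e, b) => ho (e, b)
  | (.inr (.inl (l, c)), b) => hv l c b
  | (.inr (.inr (l, c)), b) => hd l c b

/-- The end of a dart of the expansion. -/
def hatVert : HatEdge E T × Bool → HatNode E T
  | (.inl e, b) => (0, (e, b))
  | (.inr (.inl (l, c)), false) => (l.castSucc, c)
  | (.inr (.inl (l, c)), true) => (l.succ, c)
  | (.inr (.inr (l, c)), false) => (l.castSucc, c)
  | (.inr (.inr (l, c)), true) => (l.succ, G.rot c)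

@[simp] theorem hatVert_old (d : E × Bool) : G.hatVert T (old d) = (0, d) := rfl
@[simp] theorem hatVert_ver_false (l : Fin (T + 1)) (c : E × Bool) :
    G.hatVert T (ver l c false) = (l.castSucc, c) := rfl
@[simp] theorem hatVert_ver_true (l : Fin (T + 1)) (c : E × Bool) :
    G.hatVert T (ver l c true) = (l.succ, c) := rfl
@[simp] theorem hatVert_diag_false (l : Fin (T + 1)) (c : E × Bool) :
    G.hatVert T (diag l c false) = (l.castSucc, c) := rfl
@[simp] theorem hatVert_diag_true (l : Fin (T + 1)) (c : E × Bool) :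
    G.hatVert T (diag l c true) = (l.succ, G.rot c) := rfl

/-- The clockwise successor of a dart of the expansion. -/
def hatNext : HatEdge E T × Bool → HatEdge E T × Bool
  | (.inl e, b) => diag 0 (e, b) false
  | (.inr (.inl (l, c)), false) =>
      Fin.cases (old c) (fun k => diag k.castSucc (G.rot.symm c) true) l
  | (.inr (.inl (l, c)), true) =>
      Fin.lastCases (diag (Fin.last T) (G.rot.symm c) true) (fun k => diag k.succ c false) l
  | (.inr (.inr (l, c)), false) => ver l c false
  | (.inr (.inr (l, c)), true) => ver l (G.rot c) true

/-- The clockwise predecessor of a dart of the expansion. -/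
def hatPrev : HatEdge E T × Bool → HatEdge E T × Bool
  | (.inl e, b) => ver 0 (e, b) false
  | (.inr (.inl (l, c)), false) => diag l c false
  | (.inr (.inl (l, c)), true) => diag l (G.rot.symm c) true
  | (.inr (.inr (l, c)), false) => Fin.cases (old c) (fun k => ver k.castSucc c true) l
  | (.inr (.inr (l, c)), true) =>
      Fin.lastCases (ver (Fin.last T) (G.rot c) true) (fun k => ver k.succ (G.rot c) false) l

@[simp] theorem hatNext_old (d : E × Bool) : G.hatNext T (old d) = diag 0 d false := rfl
@[simp] theorem hatNext_diag_false (l : Fin (T + 1)) (c : E × Bool) :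
    G.hatNext T (diag l c false) = ver l c false := rfl
@[simp] theorem hatNext_diag_true (l : Fin (T + 1)) (c : E × Bool) :
    G.hatNext T (diag l c true) = ver l (G.rot c) true := rfl
@[simp] theorem hatNext_ver_false_zero (c : E × Bool) :
    G.hatNext T (ver 0 c false) = old c := rfl
@[simp] theorem hatNext_ver_false_succ (k : Fin T) (c : E × Bool) :
    G.hatNext T (ver k.succ c false) = diag k.castSucc (G.rot.symm c) true := rfl
@[simp] theorem hatNext_ver_true_last (c : E × Bool) :
    G.hatNext T (ver (Fin.last T) c true) = diag (Fin.last T) (G.rot.symm c) true := by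
  simp [hatNext, ver]
@[simp] theorem hatNext_ver_true_castSucc (k : Fin T) (c : E × Bool) :
    G.hatNext T (ver k.castSucc c true) = diag k.succ c false := by
  simp [hatNext, ver]

@[simp] theorem hatPrev_old (d : E × Bool) : G.hatPrev T (old d) = ver 0 d false := rfl
@[simp] theorem hatPrev_ver_false (l : Fin (T + 1)) (c : E × Bool) :
    G.hatPrev T (ver l c false) = diag l c false := rfl
@[simp] theorem hatPrev_ver_true (l : Fin (T + 1)) (c : E × Bool) :
    G.hatPrev T (ver l c true) = diag l (G.rot.symm c) true := rfl
@[simp] theorem hatPrev_diag_false_zero (c : E × Bool) :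
    G.hatPrev T (diag 0 c false) = old c := rfl
@[simp] theorem hatPrev_diag_false_succ (k : Fin T) (c : E × Bool) :
    G.hatPrev T (diag k.succ c false) = ver k.castSucc c true := rfl
@[simp] theorem hatPrev_diag_true_last (c : E × Bool) :
    G.hatPrev T (diag (Fin.last T) c true) = ver (Fin.last T) (G.rot c) true := by
  simp [hatPrev, diag]
@[simp] theorem hatPrev_diag_true_castSucc (k : Fin T) (c : E × Bool) :
    G.hatPrev T (diag k.castSucc c true) = ver k.succ (G.rot c) false := by
  simp [hatPrev, diag]

/-- The rotation of the expansion. -/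
def hatRot : Equiv.Perm (HatEdge E T × Bool) where
  toFun := G.hatNext T
  invFun := G.hatPrev T
  left_inv d := by
    induction d using hatDart_cases with
    | ho d => simp
    | hv l c b =>
      cases b
      · cases l using Fin.cases <;> simp
      · cases l using Fin.lastCases <;> simp
    | hd l c b => cases b <;> simp
  right_inv d := by
    induction d using hatDart_cases with
    | ho d => simp
    | hv l c b => cases b <;> simp
    | hd l c b =>
      cases b
      · cases l using Fin.cases <;> simp
      · cases l using Fin.lastCases <;> simp

@[simp] theorem hatRot_apply (d : HatEdge E T × Bool) : G.hatRot T d = G.hatNext T d := rfl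

theorem hatVert_hatNext (d : HatEdge E T × Bool) : G.hatVert T (G.hatNext T d) = G.hatVert T d := by
  induction d using hatDart_cases with
  | ho d => simp
  | hv l c b =>
    cases b
    · cases l using Fin.cases <;> simp
    · cases l using Fin.lastCases <;> simp
  | hd l c b => cases b <;> simp

/-- A dart at every node. -/
def nodeDart (x : HatNode E T) : HatEdge E T × Bool :=
  Fin.cases (old x.2) (fun l => ver l x.2 true) x.1

@[simp] theorem nodeDart_zero (c : E × Bool) : nodeDart T (0, c) = old c := rfl
@[simp] theorem nodeDart_succ (l : Fin (T + 1)) (c : E × Bool) :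
    nodeDart T (l.succ, c) = ver l c true := rfl

theorem hatVert_nodeDart (x : HatNode E T) : G.hatVert T (nodeDart T x) = x := by
  obtain ⟨l, c⟩ := x
  cases l using Fin.cases <;> simp

/-- A node has at most four darts, and following the rotation from the chosen one meets all of them.
Hence the cycles of the rotation are exactly the nodes. -/
theorem sameOrbit_nodeDart (d : HatEdge E T × Bool) :
    SameOrbit (Subgroup.zpowers (G.hatRot T)) (nodeDart T (G.hatVert T d)) d := by
  have step : ∀ d, SameOrbit (Subgroup.zpowers (G.hatRot T)) d (G.hatNext T d) := fun d =>
    sameOrbit_apply (Subgroup.mem_zpowers _) d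
  have hd : ∀ l c, SameOrbit (Subgroup.zpowers (G.hatRot T)) (nodeDart T (l.castSucc, c))
      (diag l c false) := by
    intro l c
    cases l using Fin.cases with
    | zero => exact step (old c)
    | succ k =>
      have := step (ver k.castSucc c true)
      rw [hatNext_ver_true_castSucc] at this
      rw [← Fin.succ_castSucc]
      exact this
  induction d using hatDart_cases with
  | ho d => exact SameOrbit.refl _ _
  | hv l c b =>
    cases b
    · exact (hd l c).trans (step _)
    · exact SameOrbit.refl _ _
  | hd l c b =>
    cases b
    · exact hd l c
    · exact (step (diag l c true)).symm

theorem hatVert_eq_iff (d d' : HatEdge E T × Bool) :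
    G.hatVert T d = G.hatVert T d' ↔ SameOrbit (Subgroup.zpowers (G.hatRot T)) d d' := by
  constructor
  · intro h
    have := G.sameOrbit_nodeDart T d
    rw [h] at this
    exact this.symm.trans (G.sameOrbit_nodeDart T d')
  · exact eq_of_sameOrbit_zpowers (G.hatVert T) (G.hatVert_hatNext T)

/-- The expansion of an embedded graph: every vertex is replaced by a cylinder grid with one column
for every dart attached to it. -/
def hat : EmbeddedGraph (HatNode E T) (HatEdge E T) where
  vert := G.hatVert T
  rot := G.hatRot T
  sameCycle_iff d d' := by rw [hatVert_eq_iff, sameOrbit_zpowers_iff]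

@[simp] theorem hat_vert (d : HatEdge E T × Bool) : (G.hat T).vert d = G.hatVert T d := rfl
@[simp] theorem hat_rot (d : HatEdge E T × Bool) : (G.hat T).rot d = G.hatNext T d := rfl

@[simp] theorem flip_old (d : E × Bool) : flip (old (T := T) d) = old (flip d) := rfl
@[simp] theorem flip_ver (l : Fin (T + 1)) (c : E × Bool) (b : Bool) :
    flip (ver l c b) = ver l c !b := rfl
@[simp] theorem flip_diag (l : Fin (T + 1)) (c : E × Bool) (b : Bool) :
    flip (diag l c b) = diag l c !b := rfl
@[simp] theorem flip_flip (d : E × Bool) : flip (flip d) = d := by simp [flip]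

theorem numOrbits_hat_rot :
    numOrbits (Subgroup.zpowers (G.hat T).rot) = (T + 2) * Nat.card (E × Bool) := by
  change numOrbits (Subgroup.zpowers (G.hatRot T)) = _
  rw [numOrbits_eq_card _ (G.hatVert T) (fun x => ⟨_, G.hatVert_nodeDart T x⟩)
    (G.hatVert_eq_iff T), Nat.card_prod, Nat.card_fin]

/-- The component of `G` in which a dart of the expansion lies, by way of a dart of `G`. -/
def hatColumn : HatEdge E T × Bool → E × Bool
  | (.inl e, b) => (e, b)
  | (.inr (.inl (_, c)), _) => c
  | (.inr (.inr (_, c)), _) => c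

@[simp] theorem hatColumn_old (d : E × Bool) : hatColumn T (old d) = d := rfl
@[simp] theorem hatColumn_ver (l : Fin (T + 1)) (c : E × Bool) (b : Bool) :
    hatColumn T (ver l c b) = c := rfl
@[simp] theorem hatColumn_diag (l : Fin (T + 1)) (c : E × Bool) (b : Bool) :
    hatColumn T (diag l c b) = c := rfl

/-- Inside a cylinder every dart is connected to the old dart of its column, and a diagonal edge
leads from column `c` to column `rot c`. Conversely, rotation and flip in the expansion change the
column at most by `rot`, its inverse, or `flip`. So components of the expansion correspond to
components of G. -/
theorem numOrbits_hat_closure :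
    numOrbits (Subgroup.closure {(G.hat T).rot, flip}) =
      numOrbits (Subgroup.closure {G.rot, flip}) := by
  set S := Subgroup.closure {(G.hat T).rot, flip} with hS
  set S₀ := Subgroup.closure {G.rot, flip} with hS₀
  have hr : G.rot ∈ S₀ := Subgroup.subset_closure (by simp)
  have hf : flip ∈ S₀ := Subgroup.subset_closure (by simp)
  have hr' : (G.hat T).rot ∈ S := Subgroup.subset_closure (by simp)
  have hf' : flip ∈ S := Subgroup.subset_closure (by simp)
  have rotStep : ∀ d, SameOrbit S d (G.hatNext T d) := fun d => sameOrbit_apply hr' d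
  have flipStep : ∀ d, SameOrbit S d (flip d) := fun d => sameOrbit_apply hf' d
  have hdown : ∀ l c, SameOrbit S (ver l c false) (old c) := by
    intro l
    induction l using Fin.induction with
    | zero => intro c; exact rotStep (ver 0 c false)
    | succ k ih =>
      intro c
      have h1 := rotStep (ver k.castSucc c true)
      rw [hatNext_ver_true_castSucc] at h1
      have h2 := rotStep (diag k.succ c false)
      have h3 := flipStep (ver k.castSucc c true)
      exact (h1.trans h2).symm.trans (h3.trans (ih c))
  have hcol : ∀ d, SameOrbit S d (old (hatColumn T d)) := by
    intro d
    induction d using hatDart_cases with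
    | ho d => exact SameOrbit.refl _ _
    | hv l c b =>
      cases b
      · exact hdown l c
      · exact (flipStep _).trans (hdown l c)
    | hd l c b =>
      cases b
      · exact (rotStep _).trans (hdown l c)
      · exact (flipStep _).trans ((rotStep _).trans (hdown l c))
  have hrot : ∀ d, SameOrbit S (old d) (old (G.rot d)) := fun d =>
    (hcol (diag 0 d true)).symm.trans ((rotStep (diag 0 d true)).trans (hcol _))
  have key : ∀ d d', SameOrbit S₀ (hatColumn T d) (hatColumn T d') ↔ SameOrbit S d d' := by
    intro d d'
    constructor
    · intro h
      refine (hcol d).trans (SameOrbit.trans ?_ (hcol d').symm)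
      refine SameOrbit.map_closure (fun d => old d) ?_ h
      rintro g (rfl | rfl) d
      · exact hrot d
      · exact flipStep (old d)
    · intro h
      refine SameOrbit.map_closure (hatColumn T) ?_ h
      rintro g (rfl | rfl) d
      · have hs : ∀ c, SameOrbit S₀ c (G.rot c) := fun c => sameOrbit_apply hr c
        have hs' : ∀ c, SameOrbit S₀ c (G.rot.symm c) := fun c => by
          have := hs (G.rot.symm c)
          rw [Equiv.apply_symm_apply] at this
          exact this.symm
        induction d using hatDart_cases with
        | ho d => simpa using SameOrbit.refl _ _
        | hv l c b =>
          cases b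
          · cases l using Fin.cases
            · simpa using SameOrbit.refl _ _
            · simpa using hs' c
          · cases l using Fin.lastCases
            · simpa using hs' c
            · simpa using SameOrbit.refl _ _
        | hd l c b =>
          cases b
          · simpa using SameOrbit.refl _ _
          · simpa using hs c
      · induction d using hatDart_cases with
        | ho d => exact sameOrbit_apply hf d
        | hv l c b => exact SameOrbit.refl _ _
        | hd l c b => exact SameOrbit.refl _ _
  refine numOrbits_eq_card S
    (fun d => Quotient.mk (MulAction.orbitRel S₀ (E × Bool)) (hatColumn T d)) ?_ ?_
  · rintro ⟨d⟩
    exact ⟨old d, rfl⟩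
  · intro d d'
    rw [mk_eq_mk_iff]
    exact key d d'

/-- The faces of the expansion: those of `G`, the cells of the grids, and one inside each grid. -/
abbrev HatFace : Type _ :=
  MulAction.orbitRel.Quotient (Subgroup.zpowers G.face) (E × Bool) ⊕ (Fin T × (E × Bool)) ⊕
    MulAction.orbitRel.Quotient (Subgroup.zpowers G.rot) (E × Bool)

/-- The face of `G` that belongs to a dart. -/
def outerFace (d : E × Bool) : HatFace G T := .inl (Quotient.mk _ d)

/-- The cell between the columns `c` and `rot c`. -/
def cellFace (k : Fin T) (c : E × Bool) : HatFace G T := .inr (.inl (k, c))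

/-- The face inside the grid to which the column `c` belongs. -/
def innerFace (c : E × Bool) : HatFace G T := .inr (.inr (Quotient.mk _ c))

/-- The face of a dart of the expansion. -/
def hatFace : HatEdge E T × Bool → HatFace G T
  | (.inl e, b) => G.outerFace T (e, b)
  | (.inr (.inl (l, c)), false) => Fin.lastCases (G.innerFace T c) (fun k => G.cellFace T k c) l
  | (.inr (.inl (l, c)), true) =>
      Fin.cases (G.outerFace T c) (fun k => G.cellFace T k (G.rot.symm c)) l
  | (.inr (.inr (l, c)), false) =>
      Fin.cases (G.outerFace T (flip c)) (fun k => G.cellFace T k c) l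
  | (.inr (.inr (l, c)), true) => Fin.lastCases (G.innerFace T c) (fun k => G.cellFace T k c) l

@[simp] theorem hatFace_old (d : E × Bool) : G.hatFace T (old d) = G.outerFace T d := rfl
@[simp] theorem hatFace_ver_true_zero (c : E × Bool) :
    G.hatFace T (ver 0 c true) = G.outerFace T c := rfl
@[simp] theorem hatFace_ver_true_succ (k : Fin T) (c : E × Bool) :
    G.hatFace T (ver k.succ c true) = G.cellFace T k (G.rot.symm c) := rfl
@[simp] theorem hatFace_diag_false_zero (c : E × Bool) :
    G.hatFace T (diag 0 c false) = G.outerFace T (flip c) := rfl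
@[simp] theorem hatFace_diag_false_succ (k : Fin T) (c : E × Bool) :
    G.hatFace T (diag k.succ c false) = G.cellFace T k c := rfl
@[simp] theorem hatFace_ver_false_last (c : E × Bool) :
    G.hatFace T (ver (Fin.last T) c false) = G.innerFace T c := by simp [hatFace, ver]
@[simp] theorem hatFace_ver_false_castSucc (k : Fin T) (c : E × Bool) :
    G.hatFace T (ver k.castSucc c false) = G.cellFace T k c := by simp [hatFace, ver]
@[simp] theorem hatFace_diag_true_last (c : E × Bool) :
    G.hatFace T (diag (Fin.last T) c true) = G.innerFace T c := by simp [hatFace, diag]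
@[simp] theorem hatFace_diag_true_castSucc (k : Fin T) (c : E × Bool) :
    G.hatFace T (diag k.castSucc c true) = G.cellFace T k c := by simp [hatFace, diag]

theorem outerFace_eq_iff (d d' : E × Bool) :
    G.outerFace T d = G.outerFace T d' ↔ SameOrbit (Subgroup.zpowers G.face) d d' := by
  rw [outerFace, outerFace, Sum.inl.injEq, mk_eq_mk_iff]

theorem innerFace_eq_iff (d d' : E × Bool) :
    G.innerFace T d = G.innerFace T d' ↔ SameOrbit (Subgroup.zpowers G.rot) d d' := by
  rw [innerFace, innerFace, Sum.inr.injEq, Sum.inr.injEq, mk_eq_mk_iff]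

/-- The face permutation takes `flip c` to `rot c`. This identifies the two columns that bound a
corner of a face of G. -/
theorem outerFace_rot (c : E × Bool) : G.outerFace T (G.rot c) = G.outerFace T (flip c) := by
  rw [outerFace_eq_iff]
  refine (SameOrbit.symm ?_)
  have := sameOrbit_apply (Subgroup.mem_zpowers G.face) (flip c)
  simpa [face] using this

theorem innerFace_symm (c : E × Bool) : G.innerFace T (G.rot.symm c) = G.innerFace T c := by
  rw [innerFace_eq_iff]
  have := sameOrbit_apply (Subgroup.mem_zpowers G.rot) (G.rot.symm c)
  simpa using this

theorem hat_face_apply (d : HatEdge E T × Bool) :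
    (G.hat T).face d = G.hatNext T (flip d) := rfl

theorem hatFace_face (d : HatEdge E T × Bool) :
    G.hatFace T ((G.hat T).face d) = G.hatFace T d := by
  rw [hat_face_apply]
  induction d using hatDart_cases with
  | ho d => simp
  | hv l c b =>
    cases b
    · cases l using Fin.lastCases <;> simp [innerFace_symm]
    · cases l using Fin.cases <;> simp
  | hd l c b =>
    cases b
    · cases l using Fin.cases <;> simp [outerFace_rot]
    · cases l using Fin.lastCases <;> simp

/-- Each dart is led along its boundary walk to a standard dart: an old dart for a face of G, a
reversed diagonal for a cell or an innermost face. The standard darts of one face are then linked: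
three steps lead from `old d` to `old (face d)`, and two steps lead around the innermost face from
column `rot d` to column `d`. -/
theorem sameOrbit_of_hatFace_eq {d d' : HatEdge E T × Bool} (h : G.hatFace T d = G.hatFace T d') :
    SameOrbit (Subgroup.zpowers (G.hat T).face) d d' := by
  set S := Subgroup.zpowers (G.hat T).face with hS
  have step : ∀ d, SameOrbit S d (G.hatNext T (flip d)) := fun d =>
    sameOrbit_apply (Subgroup.mem_zpowers _) d
  have houter : ∀ d d', G.outerFace T d = G.outerFace T d' → SameOrbit S (old d) (old d') := by
    intro d d' h
    rw [outerFace_eq_iff] at h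
    refine SameOrbit.map_zpowers (fun d => old d) ?_ h
    intro d
    have h1 := step (old d)
    have h2 := step (diag 0 (flip d) false)
    have h3 := step (ver 0 (G.rot (flip d)) true)
    simp only [flip_old, flip_diag, flip_ver, hatNext_old, Bool.not_false, Bool.not_true,
      hatNext_diag_true, hatNext_ver_false_zero] at h1 h2 h3
    exact h1.trans (h2.trans h3)
  have hinner : ∀ d d', G.innerFace T d = G.innerFace T d' →
      SameOrbit S (diag (Fin.last T) d true) (diag (Fin.last T) d' true) := by
    intro d d' h
    rw [innerFace_eq_iff] at h
    refine SameOrbit.map_zpowers (fun d => diag (Fin.last T) d true) ?_ h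
    intro d
    have h1 := step (diag (Fin.last T) (G.rot d) true)
    have h2 := step (ver (Fin.last T) (G.rot d) false)
    simp only [flip_diag, flip_ver, Bool.not_false, Bool.not_true, hatNext_diag_false,
      hatNext_ver_true_last, Equiv.symm_apply_apply] at h1 h2
    exact (h1.trans h2).symm
  -- every dart is in the orbit of a standard dart of its face
  let std : HatFace G T → HatEdge E T × Bool → Prop := fun F d =>
    match F with
    | .inl _ => ∃ c, d = old c ∧ F = G.outerFace T c
    | .inr (.inl (k, c)) => d = diag k.castSucc c true
    | .inr (.inr _) => ∃ c, d = diag (Fin.last T) c true ∧ F = G.innerFace T c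
  have hstd : ∀ d, ∃ e, SameOrbit S d e ∧ std (G.hatFace T d) e := by
    intro d
    have hv0 : ∀ k : Fin T, ∀ c, SameOrbit S (ver k.castSucc c false) (diag k.castSucc c true) := by
      intro k c
      have h1 := step (diag k.castSucc c true)
      simp only [flip_diag, Bool.not_true, hatNext_diag_false] at h1
      exact h1.symm
    have hd0 : ∀ k : Fin T, ∀ c, SameOrbit S (diag k.succ c false) (diag k.castSucc c true) := by
      intro k c
      have h1 := step (ver k.castSucc c false)
      simp only [flip_ver, Bool.not_false, hatNext_ver_true_castSucc] at h1
      exact h1.symm.trans (hv0 k c)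
    induction d using hatDart_cases with
    | ho d => exact ⟨old d, SameOrbit.refl _ _, d, rfl, rfl⟩
    | hv l c b =>
      cases b
      · cases l using Fin.lastCases with
        | last =>
          refine ⟨diag (Fin.last T) c true, ?_, ?_⟩
          · have h1 := step (diag (Fin.last T) c true)
            simp only [flip_diag, Bool.not_true, hatNext_diag_false] at h1
            exact h1.symm
          · rw [hatFace_ver_false_last]
            exact ⟨c, rfl, rfl⟩
        | cast k =>
          refine ⟨diag k.castSucc c true, hv0 k c, ?_⟩
          rw [hatFace_ver_false_castSucc]
          rfl
      · cases l using Fin.cases with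
        | zero => exact ⟨old c, step (ver 0 c true), c, rfl, rfl⟩
        | succ k => exact ⟨diag k.castSucc (G.rot.symm c) true, step (ver k.succ c true), rfl⟩
    | hd l c b =>
      cases b
      · cases l using Fin.cases with
        | zero =>
          refine ⟨old (flip c), ?_, flip c, rfl, rfl⟩
          have h1 := step (old (flip c))
          simp only [flip_old, flip_flip, hatNext_old] at h1
          exact h1.symm
        | succ k => exact ⟨_, hd0 k c, rfl⟩
      · cases l using Fin.lastCases with
        | last =>
          refine ⟨diag (Fin.last T) c true, SameOrbit.refl _ _, ?_⟩
          rw [hatFace_diag_true_last]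
          exact ⟨c, rfl, rfl⟩
        | cast k =>
          refine ⟨diag k.castSucc c true, SameOrbit.refl _ _, ?_⟩
          rw [hatFace_diag_true_castSucc]
          rfl
  have huniq : ∀ F e e', std F e → std F e' → SameOrbit S e e' := by
    rintro (F | ⟨k, c⟩ | F) e e' he he'
    · obtain ⟨c, rfl, hc⟩ := he
      obtain ⟨c', rfl, hc'⟩ := he'
      exact houter c c' (hc.symm.trans hc')
    · have h1 : e = diag k.castSucc c true := he
      have h2 : e' = diag k.castSucc c true := he'
      rw [h1, h2]
      exact SameOrbit.refl _ _
    · obtain ⟨c, rfl, hc⟩ := he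
      obtain ⟨c', rfl, hc'⟩ := he'
      exact hinner c c' (hc.symm.trans hc')
  obtain ⟨e, he, hse⟩ := hstd d
  obtain ⟨e', he', hse'⟩ := hstd d'
  rw [h] at hse
  exact he.trans ((huniq _ e e' hse hse').trans he'.symm)

theorem hatFace_surjective : Function.Surjective (G.hatFace T) := by
  rintro (⟨⟨d⟩⟩ | ⟨k, c⟩ | ⟨⟨c⟩⟩)
  · exact ⟨old d, rfl⟩
  · exact ⟨diag k.succ c false, rfl⟩
  · exact ⟨diag (Fin.last T) c true, G.hatFace_diag_true_last T c⟩

theorem numOrbits_hat_face [Finite E] :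
    numOrbits (Subgroup.zpowers (G.hat T).face) =
      numOrbits (Subgroup.zpowers G.face) + (T * Nat.card (E × Bool) +
        numOrbits (Subgroup.zpowers G.rot)) := by
  rw [numOrbits_eq_card _ (G.hatFace T) (G.hatFace_surjective T)
    (fun d d' => ⟨G.sameOrbit_of_hatFace_eq T,
      eq_of_sameOrbit_zpowers (G.hatFace T) (G.hatFace_face T)⟩)]
  have : Finite (MulAction.orbitRel.Quotient (Subgroup.zpowers G.face) (E × Bool)) :=
    Quotient.finite _
  have : Finite (MulAction.orbitRel.Quotient (Subgroup.zpowers G.rot) (E × Bool)) :=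
    Quotient.finite _
  rw [Nat.card_sum, Nat.card_sum, Nat.card_prod, Nat.card_fin]
  rfl

/-- With D darts, D(T + 2) nodes and the DT cells cancel the 2(T + 1)D new edges. The innermost
faces replace the vertices of G in the count, and the components are unchanged, so Euler's formula
for G is all that remains. -/
theorem Planar.hat [Finite E] (h : G.Planar) : (G.hat T).Planar := by
  unfold Planar at h ⊢
  rw [numOrbits_hat_rot, numOrbits_hat_face, numOrbits_hat_closure]
  have hc : Nat.card (HatEdge E T) = Nat.card E + 2 * ((T + 1) * Nat.card (E × Bool)) := by
    rw [Nat.card_sum, Nat.card_sum, Nat.card_prod, Nat.card_fin]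
    ring
  rw [hc]
  nlinarith

end Hat

end EmbeddedGraph

namespace EmbeddedGraph

/-! ### Splitting walks and extracting disjoint paths from disjoint connected sets. -/

section Walk

variable {V E K : Type*} (G : EmbeddedGraph V E)

@[simp] theorem isWalk_nil (s t : V) : G.IsWalk s t [] ↔ s = t := Iff.rfl

@[simp] theorem isWalk_cons (s t : V) (d : E × Bool) (p : List (E × Bool)) :
    G.IsWalk s t (d :: p) ↔ G.vert d = s ∧ G.IsWalk (G.head d) t p := Iff.rfl

@[simp] theorem vertices_nil (s : V) : G.vertices s [] = [s] := rfl

@[simp] theorem vertices_cons (s : V) (d : E × Bool) (p : List (E × Bool)) :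
    G.vertices s (d :: p) = s :: G.vertices (G.head d) p := rfl

variable {G}

theorem isWalk_append {s t : V} {p q : List (E × Bool)} :
    G.IsWalk s t (p ++ q) ↔ ∃ u, G.IsWalk s u p ∧ G.IsWalk u t q := by
  induction p generalizing s with
  | nil => simp
  | cons d p ih => simp [ih, and_assoc]

theorem start_mem_vertices (s : V) (p : List (E × Bool)) : s ∈ G.vertices s p := by
  simp [vertices]

theorem IsWalk.end_mem_vertices {s t : V} {p : List (E × Bool)} (h : G.IsWalk s t p) :
    t ∈ G.vertices s p := by
  induction p generalizing s with
  | nil => simp_all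
  | cons d p ih => simp [ih h.2]

theorem IsWalk.mem_vertices_append {s u : V} {p q : List (E × Bool)} (h : G.IsWalk s u p)
    (x : V) : x ∈ G.vertices s (p ++ q) ↔ x ∈ G.vertices s p ∨ x ∈ G.vertices u q := by
  induction p generalizing s with
  | nil =>
    obtain rfl : s = u := h
    have := start_mem_vertices (G := G) s q
    simp only [List.nil_append, vertices_nil, List.mem_singleton]
    constructor
    · exact Or.inr
    · rintro (rfl | h) <;> assumption
  | cons d p ih => simp [ih h.2, or_assoc]

theorem IsWalk.vert_mem {s t : V} {p : List (E × Bool)} (h : G.IsWalk s t p) {d : E × Bool}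
    (hd : d ∈ p) : G.vert d ∈ G.vertices s p := by
  induction p generalizing s with
  | nil => simp at hd
  | cons d' p ih =>
    rcases List.mem_cons.1 hd with rfl | hd
    · simp [h.1]
    · simp [ih h.2 hd]

theorem head_mem (s : V) {p : List (E × Bool)} {d : E × Bool} (hd : d ∈ p) :
    G.head d ∈ G.vertices s p := by
  simp only [vertices, List.mem_cons, List.mem_map]
  exact .inr ⟨d, hd, rfl⟩

/-- A vertex of a walk splits it. -/
theorem IsWalk.exists_split {s t w : V} {p : List (E × Bool)} (h : G.IsWalk s t p)
    (hw : w ∈ G.vertices s p) : ∃ p₁ p₂, p = p₁ ++ p₂ ∧ G.IsWalk s w p₁ ∧ G.IsWalk w t p₂ := by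
  induction p generalizing s with
  | nil =>
    obtain rfl : w = s := by simpa using hw
    exact ⟨[], [], rfl, rfl, h⟩
  | cons d p ih =>
    by_cases hws : w = s
    · exact ⟨[], d :: p, rfl, hws.symm, hws ▸ h⟩
    · obtain ⟨p₁, p₂, rfl, h₁, h₂⟩ := ih h.2 (by simpa [hws] using hw)
      exact ⟨d :: p₁, p₂, rfl, ⟨h.1, h₁⟩, h₂⟩

theorem IsPath.of_append {s w t : V} {p q : List (E × Bool)} (h : G.IsPath s t (p ++ q))
    (hq : G.IsWalk s w p) : G.IsPath w t q := by
  induction p generalizing s with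
  | nil =>
    obtain rfl : s = w := hq
    exact h
  | cons d p ih => exact ih ⟨h.1.2, (List.nodup_cons.1 h.2).2⟩ hq.2

/-- A path is split by each of its vertices in only one way. -/
theorem IsPath.split_unique {s w t : V} {p q p' q' : List (E × Bool)}
    (h : G.IsPath s t (p ++ q)) (he : p ++ q = p' ++ q') (hp : G.IsWalk s w p)
    (hp' : G.IsWalk s w p') : p = p' ∧ q = q' := by
  have aux : ∀ {s : V} {q d p}, G.IsPath s t ((d :: p) ++ q) → G.IsWalk s w (d :: p) →
      s ≠ w := by
    rintro s q d p h hp rfl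
    have := (hp.2.mem_vertices_append (q := q) s).2 (.inl hp.2.end_mem_vertices)
    exact (List.nodup_cons.1 h.2).1 this
  induction p generalizing s p' with
  | nil =>
    cases p' with
    | nil => exact ⟨rfl, he⟩
    | cons d' p' => exact absurd hp (aux (he ▸ h) hp')
  | cons d p ih =>
    cases p' with
    | nil => exact absurd hp' (aux h hp)
    | cons d' p' =>
      rw [List.cons_append, List.cons_append, List.cons.injEq] at he
      obtain ⟨rfl, he'⟩ := he
      obtain ⟨rfl, rfl⟩ := ih ⟨h.1.2, (List.nodup_cons.1 h.2).2⟩ he' hp.2 hp'.2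
      exact ⟨rfl, rfl⟩

/-- Using the edge of the first dart again, in either direction, would bring the walk back to its
first vertex. -/
theorem IsPath.edges_nodup {s t : V} {p : List (E × Bool)} (h : G.IsPath s t p) :
    (edges p).Nodup := by
  induction p generalizing s with
  | nil => simp [edges]
  | cons d p ih =>
    have hn := List.nodup_cons.1 h.2
    refine List.nodup_cons.2 ⟨?_, ih ⟨h.1.2, hn.2⟩⟩
    intro hd
    obtain ⟨d', hd', he⟩ := List.mem_map.1 hd
    apply hn.1
    have hds : G.vert d = s := h.1.1
    by_cases hb : d'.2 = d.2
    · have : d' = d := Prod.ext he hb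
      subst this
      exact hds ▸ h.1.2.vert_mem hd'
    · have : flip d' = d := by
        refine Prod.ext he ?_
        have hb' : d'.2 = !d.2 := Bool.eq_not.2 hb
        change (!d'.2) = d.2
        rw [hb', Bool.not_not]
      have hh := head_mem (G := G) (G.head d) hd'
      have hs : G.head d' = s := by rw [head, this, hds]
      exact hs ▸ hh

variable (G) in
/-- `y` is reached from `x` along an edge, both being in `S`. -/
def StepIn (S : V → Prop) (x y : V) : Prop :=
  ∃ d, G.vert d = x ∧ G.head d = y ∧ S x ∧ S y

theorem StepIn.symm {S : V → Prop} {x y : V} (h : G.StepIn S x y) : G.StepIn S y x := by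
  obtain ⟨d, h1, h2, h3, h4⟩ := h
  exact ⟨flip d, h2, by rw [head, flip_flip, h1], h4, h3⟩

/-- Vertices joined within `S` are joined by a path within `S`. -/
theorem exists_isPath {S : V → Prop} {x y : V} (h : Relation.ReflTransGen (G.StepIn S) x y)
    (hy : S y) : ∃ p, G.IsPath x y p ∧ ∀ v ∈ G.vertices x p, S v := by
  induction h using Relation.ReflTransGen.head_induction_on with
  | refl => exact ⟨[], ⟨rfl, by simp⟩, by simpa using hy⟩
  | @head x z hxz _ ih =>
    obtain ⟨p, hp, hS⟩ := ih
    obtain ⟨d, hdx, hdz, hx, hz⟩ := hxz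
    -- If the new vertex already lies on the path, the part from there on is kept; otherwise the
    -- edge is prepended.
    by_cases hmem : x ∈ G.vertices z p
    · obtain ⟨p₁, p₂, rfl, h₁, h₂⟩ := hp.1.exists_split hmem
      refine ⟨p₂, hp.of_append h₁, fun v hv => hS v ?_⟩
      exact (h₁.mem_vertices_append v).2 (.inr hv)
    · refine ⟨d :: p, ⟨⟨hdx, hdz ▸ hp.1⟩, ?_⟩, ?_⟩
      · rw [vertices_cons, hdz]
        exact List.nodup_cons.2 ⟨hmem, hp.2⟩
      · rw [vertices_cons, hdz]
        rintro v (_ | ⟨_, hv⟩)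
        · exact hx
        · exact hS v hv

/-- Disjoint connected sets, one for every demand, yield totally node-disjoint paths. -/
theorem hasNodeDisjointPaths_of_reachable (dem : K → V × V) (S : K → V → Prop)
    (hS : ∀ h h' v, S h v → S h' v → h = h') (hend : ∀ h, S h (dem h).2)
    (hreach : ∀ h, Relation.ReflTransGen (G.StepIn (S h)) (dem h).1 (dem h).2) :
    G.HasNodeDisjointPaths dem := by
  choose P hP hPS using fun h => exists_isPath (hreach h) (hend h)
  exact ⟨P, hP, fun h h' hne v hv hv' => hne (hS h h' v (hPS h v hv) (hPS h' v hv'))⟩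

end Walk

/-! ### Invariance under renaming vertices and edges. -/

section Relabel

variable {V E V' E' K : Type*}

/-- The bijection of darts induced by one of edges. -/
def dartEquiv (eE : E ≃ E') : E × Bool ≃ E' × Bool := eE.prodCongr (Equiv.refl Bool)

theorem dartEquiv_flip (eE : E ≃ E') (d : E × Bool) :
    dartEquiv eE (flip d) = flip (dartEquiv eE d) := rfl

theorem dartEquiv_symm_flip (eE : E ≃ E') (d : E' × Bool) :
    (dartEquiv eE).symm (flip d) = flip ((dartEquiv eE).symm d) := rfl

/-- Vertices and edges renamed. -/
def relabel (G : EmbeddedGraph V E) (eV : V ≃ V') (eE : E ≃ E') : EmbeddedGraph V' E' where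
  vert d := eV (G.vert ((dartEquiv eE).symm d))
  rot := (dartEquiv eE).permCongr G.rot
  sameCycle_iff d d' := by
    rw [eV.injective.eq_iff, ← G.sameCycle_iff]
    constructor
    · rintro ⟨i, rfl⟩
      refine ⟨i, ?_⟩
      have : ((dartEquiv eE).permCongr G.rot) ^ i = (dartEquiv eE).permCongr (G.rot ^ i) :=
        (map_zpow (dartEquiv eE).permCongrHom G.rot i).symm
      rw [this]
      simp
    · rintro ⟨i, h⟩
      refine ⟨i, ?_⟩
      have : ((dartEquiv eE).permCongr G.rot) ^ i = (dartEquiv eE).permCongr (G.rot ^ i) :=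
        (map_zpow (dartEquiv eE).permCongrHom G.rot i).symm
      rw [this]
      simp [h]

theorem numOrbits_zpowers_permCongr {D D' : Type*} (e : D ≃ D') (g : Equiv.Perm D)
    (g' : Equiv.Perm D') (h : ∀ d, g' (e d) = e (g d)) :
    numOrbits (Subgroup.zpowers g') = numOrbits (Subgroup.zpowers g) := by
  refine numOrbits_eq_card _ (fun d => Quotient.mk (MulAction.orbitRel _ D) (e.symm d)) ?_ ?_
  · rintro ⟨d⟩
    exact ⟨e d, congrArg (Quotient.mk _) (e.symm_apply_apply d)⟩
  · intro d d'
    rw [mk_eq_mk_iff]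
    constructor
    · intro hd
      have := SameOrbit.map_zpowers (S' := Subgroup.zpowers g') e
        (fun d => h d ▸ sameOrbit_apply (Subgroup.mem_zpowers g') (e d)) hd
      simpa using this
    · refine SameOrbit.map_zpowers e.symm fun d => ?_
      have := h (e.symm d)
      rw [e.apply_symm_apply] at this
      rw [this, e.symm_apply_apply]
      exact sameOrbit_apply (Subgroup.mem_zpowers g) _

theorem numOrbits_closure_permCongr {D D' : Type*} (e : D ≃ D') (g f : Equiv.Perm D)
    (g' f' : Equiv.Perm D') (hg : ∀ d, g' (e d) = e (g d)) (hf : ∀ d, f' (e d) = e (f d)) :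
    numOrbits (Subgroup.closure {g', f'}) = numOrbits (Subgroup.closure {g, f}) := by
  refine numOrbits_eq_card _ (fun d => Quotient.mk (MulAction.orbitRel _ D) (e.symm d)) ?_ ?_
  · rintro ⟨d⟩
    exact ⟨e d, congrArg (Quotient.mk _) (e.symm_apply_apply d)⟩
  · intro d d'
    rw [mk_eq_mk_iff]
    constructor
    · intro hd
      have := SameOrbit.map_closure (S' := Subgroup.closure {g', f'}) e
        (by
          rintro _ (rfl | rfl) d
          · exact hg d ▸ sameOrbit_apply (Subgroup.subset_closure (by simp)) (e d)
          · exact hf d ▸ sameOrbit_apply (Subgroup.subset_closure (by simp)) (e d)) hd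
      simpa using this
    · refine SameOrbit.map_closure e.symm ?_
      rintro _ (rfl | rfl) d
      · have := hg (e.symm d)
        rw [e.apply_symm_apply] at this
        rw [this, e.symm_apply_apply]
        exact sameOrbit_apply (Subgroup.subset_closure (by simp)) _
      · have := hf (e.symm d)
        rw [e.apply_symm_apply] at this
        rw [this, e.symm_apply_apply]
        exact sameOrbit_apply (Subgroup.subset_closure (by simp)) _

theorem Planar.relabel {G : EmbeddedGraph V E} (h : G.Planar) (eV : V ≃ V') (eE : E ≃ E') :
    (G.relabel eV eE).Planar := by
  unfold Planar at h ⊢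
  have hrot : ∀ d, (G.relabel eV eE).rot (dartEquiv eE d) = dartEquiv eE (G.rot d) := fun d => by
    simp [EmbeddedGraph.relabel]
  rw [numOrbits_zpowers_permCongr (dartEquiv eE) G.rot _ hrot,
    numOrbits_zpowers_permCongr (dartEquiv eE) G.face (G.relabel eV eE).face fun d => by
      change (G.relabel eV eE).rot (flip (dartEquiv eE d)) = _
      rw [← dartEquiv_flip, hrot]
      rfl,
    numOrbits_closure_permCongr (dartEquiv eE) G.rot flip _ flip hrot fun d => rfl, h,
    Nat.card_congr eE]

theorem relabel_isWalk (G : EmbeddedGraph V E) (eV : V ≃ V') (eE : E ≃ E') (s t : V)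
    (p : List (E × Bool)) :
    (G.relabel eV eE).IsWalk (eV s) (eV t) (p.map (dartEquiv eE)) ↔ G.IsWalk s t p := by
  induction p generalizing s with
  | nil => simp
  | cons d p ih =>
    have h1 : (G.relabel eV eE).vert (dartEquiv eE d) = eV (G.vert d) := by
      simp [relabel]
    have h2 : (G.relabel eV eE).head (dartEquiv eE d) = eV (G.head d) := by
      simp [relabel, head, dartEquiv_symm_flip]
    rw [List.map_cons, isWalk_cons, isWalk_cons, h1, h2, ih, eV.injective.eq_iff]

theorem relabel_vertices (G : EmbeddedGraph V E) (eV : V ≃ V') (eE : E ≃ E') (s : V)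
    (p : List (E × Bool)) :
    (G.relabel eV eE).vertices (eV s) (p.map (dartEquiv eE)) = (G.vertices s p).map eV := by
  simp [vertices, relabel, head, dartEquiv_symm_flip]

theorem relabel_hasNodeDisjointPaths (G : EmbeddedGraph V E) (eV : V ≃ V') (eE : E ≃ E')
    (dem : K → V × V) :
    (G.relabel eV eE).HasNodeDisjointPaths (fun h => (eV (dem h).1, eV (dem h).2)) ↔
      G.HasNodeDisjointPaths dem := by
  have disj : ∀ l l' : List V, (l.map eV).Disjoint (l'.map eV) ↔ l.Disjoint l' := fun l l' =>
    ⟨fun h v hv hv' => h (List.mem_map_of_mem hv) (List.mem_map_of_mem hv'),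
     fun h v hv hv' => by
      obtain ⟨w, hw, rfl⟩ := List.mem_map.1 hv
      exact h hw ((List.mem_map_of_injective eV.injective).1 hv')⟩
  constructor
  · rintro ⟨P, hP, hd⟩
    have hmap : ∀ h, P h = ((P h).map (dartEquiv eE).symm).map (dartEquiv eE) := fun h => by simp
    refine ⟨fun h => (P h).map (dartEquiv eE).symm, fun h => ⟨?_, ?_⟩, fun h h' hne => ?_⟩
    · have := (hP h).1
      rw [hmap h, relabel_isWalk] at this
      exact this
    · have := (hP h).2
      rw [hmap h, relabel_vertices] at this
      exact this.of_map
    · have := hd h h' hne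
      rw [hmap h, hmap h', relabel_vertices, relabel_vertices, disj] at this
      exact this
  · rintro ⟨P, hP, hd⟩
    refine ⟨fun h => (P h).map (dartEquiv eE), fun h => ⟨?_, ?_⟩, fun h h' hne => ?_⟩
    · exact (relabel_isWalk ..).2 (hP h).1
    · rw [relabel_vertices]
      exact (hP h).2.map eV.injective
    · rw [relabel_vertices, relabel_vertices, disj]
      exact hd h h' hne

end Relabel

end EmbeddedGraph

/-! ### From node-disjoint paths to trails: projection. -/

namespace EmbeddedGraph

variable {V E K : Type*} {G : EmbeddedGraph V E} {T : ℕ}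

theorem vert_rot (G : EmbeddedGraph V E) (d : E × Bool) : G.vert (G.rot d) = G.vert d :=
  ((G.sameCycle_iff d (G.rot d)).1 ⟨1, by simp⟩).symm

theorem vert_rot_pow (G : EmbeddedGraph V E) (d : E × Bool) (i : ℕ) :
    G.vert ((G.rot ^ i) d) = G.vert d :=
  ((G.sameCycle_iff d _).1 ⟨i, by simp⟩).symm

/-- The dart of the original graph that a dart of the expansion comes from, if any. -/
def getOld : HatEdge E T × Bool → Option (E × Bool)
  | (.inl e, b) => some (e, b)
  | (.inr _, _) => none

@[simp] theorem getOld_old (d : E × Bool) : getOld (old (T := T) d) = some d := rfl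
@[simp] theorem getOld_ver (l : Fin (T + 1)) (c : E × Bool) (b : Bool) :
    getOld (ver l c b) = none := rfl
@[simp] theorem getOld_diag (l : Fin (T + 1)) (c : E × Bool) (b : Bool) :
    getOld (diag l c b) = none := rfl

theorem getOld_eq_some {d : HatEdge E T × Bool} {c : E × Bool} :
    getOld d = some c ↔ d = old c := by
  induction d using hatDart_cases with
  | ho d => exact ⟨fun h => congrArg old (Option.some.inj h), fun h => h ▸ rfl⟩
  | hv l c b => exact ⟨fun h => by simp at h, fun h => absurd (congrArg getOld h) (by simp)⟩
  | hd l c b => exact ⟨fun h => by simp at h, fun h => absurd (congrArg getOld h) (by simp)⟩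

/-- The walk of the original graph that a walk of the expansion follows. -/
def proj (p : List (HatEdge E T × Bool)) : List (E × Bool) := p.filterMap getOld

theorem mem_proj {p : List (HatEdge E T × Bool)} {d : E × Bool} : d ∈ proj p ↔ old d ∈ p := by
  simp [proj, getOld_eq_some]

/-- Vertical and diagonal edges stay over one vertex of G, since `rot` preserves `vert`; so dropping
them leaves a walk. -/
theorem IsWalk.proj {x y : HatNode E T} {p : List (HatEdge E T × Bool)}
    (h : (G.hat T).IsWalk x y p) : G.IsWalk (G.vert x.2) (G.vert y.2) (proj p) := by
  induction p generalizing x with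
  | nil =>
    obtain rfl : x = y := h
    rfl
  | cons d p ih =>
    obtain ⟨rfl, h⟩ := h
    have := ih h
    induction d using hatDart_cases with
    | ho d => exact ⟨rfl, this⟩
    | hv l c b => cases b <;> exact this
    | hd l c b =>
      cases b
      · have h' : G.IsWalk (G.vert (G.rot c)) (G.vert y.2) (EmbeddedGraph.proj p) := this
        rw [vert_rot] at h'
        exact h'
      · change G.IsWalk (G.vert (G.rot c)) (G.vert y.2) (EmbeddedGraph.proj p)
        rw [vert_rot]
        exact this

theorem nodup_edges_proj {p : List (HatEdge E T × Bool)} (h : (edges p).Nodup) :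
    (edges (proj p)).Nodup := by
  induction p with
  | nil => simp [proj, edges]
  | cons d p ih =>
    obtain ⟨h1, h2⟩ := List.nodup_cons.1 h
    induction d using hatDart_cases with
    | ho d =>
      refine List.nodup_cons.2 ⟨fun hd => h1 ?_, ih h2⟩
      obtain ⟨d', hd', he⟩ := List.mem_map.1 hd
      rw [List.mem_map]
      exact ⟨old d', mem_proj.1 hd', congrArg Sum.inl he⟩
    | hv l c b => exact ih h2
    | hd l c b => exact ih h2

/-! ### The mod 2 crossing argument in a cylinder. -/

section Parity

open Classical in
/-- The indicator of a proposition modulo two. -/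
noncomputable def ind (p : Prop) : ZMod 2 := if p then 1 else 0

@[simp] theorem ind_true : ind True = 1 := if_pos trivial
@[simp] theorem ind_false : ind False = 0 := if_neg id

/-- Whether a dart is a diagonal edge that leaves the column `c` in layer `l` or below. -/
noncomputable def diagWeight (c : E × Bool) (l : ℕ) : HatEdge E T × Bool → ZMod 2
  | (.inr (.inr (l', c')), _) => ind (c' = c ∧ l ≤ l')
  | _ => 0

/-- Whether a dart is the vertical edge of the column `c` that leaves the layer `l`. -/
noncomputable def verWeight (c : E × Bool) (l : ℕ) : HatEdge E T × Bool → ZMod 2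
  | (.inr (.inl (l', c')), _) => ind (c' = c ∧ l' = l)
  | _ => 0

/-- Whether a node is in the column `c`, in layer `l` or below. -/
noncomputable def nodeWeight (c : E × Bool) (l : ℕ) (x : HatNode E T) : ZMod 2 :=
  ind (x.2 = c ∧ l ≤ x.1)

theorem zmod_two_add_self (x : ZMod 2) : x + x = 0 := CharTwo.add_self_eq_zero x

/-- A function on vertices, summed over the ends of the darts of a walk. -/
theorem IsWalk.sum_ends {s t : V} {p : List (E × Bool)} (h : G.IsWalk s t p) (f : V → ZMod 2) :
    (p.map fun d => f (G.vert d) + f (G.head d)).sum = f s + f t := by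
  induction p generalizing s with
  | nil =>
    obtain rfl : s = t := h
    simp [zmod_two_add_self]
  | cons d p ih =>
    obtain ⟨rfl, h⟩ := h
    rw [List.map_cons, List.sum_cons, ih h]
    linear_combination zmod_two_add_self (f (G.head d))

/-- The right side detects edges leaving the set of nodes of column `rot c` in layers l + 1 and
deeper. These are the diagonals out of that set, the diagonals into it from column `c`, and the one
vertical edge entering at its upper end. When `rot c = c`, diagonals within the set are counted
twice and cancel. -/
theorem weight_succ (d : HatEdge E T × Bool) (hd : getOld d = none) (c : E × Bool) (l : ℕ) :
    diagWeight (G.rot c) (l + 1) d + diagWeight c l d + verWeight (G.rot c) l d =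
      nodeWeight (G.rot c) (l + 1) ((G.hat T).vert d) +
        nodeWeight (G.rot c) (l + 1) ((G.hat T).head d) := by
  induction d using hatDart_cases with
  | ho d => simp at hd
  | hv l' c' b =>
    have : diagWeight (G.rot c) (l + 1) (ver l' c' b) + diagWeight c l (ver l' c' b) +
        verWeight (G.rot c) l (ver l' c' b) =
        nodeWeight (G.rot c) (l + 1) (l'.castSucc, c') +
          nodeWeight (T := T) (G.rot c) (l + 1) (l'.succ, c') := by
      simp only [diagWeight, verWeight, ver, nodeWeight]
      by_cases h1 : c' = G.rot c
      · rcases lt_trichotomy (l' : ℕ) l with h | h | h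
        · have h2 : ¬ l + 1 ≤ (l' : ℕ) := by omega
          have h3 : ¬ l ≤ (l' : ℕ) := by omega
          simp [h1, h2, h3, h.ne]
        · simp [h1, h]
        · have h2 : l + 1 ≤ (l' : ℕ) := by omega
          simp [h1, h2, h.le, h.ne', zmod_two_add_self]
      · simp [h1]
    cases b
    · exact this
    · exact this.trans (add_comm _ _)
  | hd l' c' b =>
    have : diagWeight (G.rot c) (l + 1) (diag l' c' b) + diagWeight c l (diag l' c' b) +
        verWeight (G.rot c) l (diag l' c' b) =
        nodeWeight (G.rot c) (l + 1) (l'.castSucc, c') +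
          nodeWeight (T := T) (G.rot c) (l + 1) (l'.succ, G.rot c') := by
      simp [diagWeight, verWeight, diag, nodeWeight]
    cases b
    · exact this
    · exact this.trans (add_comm _ _)

/-- The same cut for the whole column `rot c`; no vertical edge enters it. -/
theorem weight_zero (d : HatEdge E T × Bool) (hd : getOld d = none) (c : E × Bool) :
    diagWeight (G.rot c) 0 d + diagWeight c 0 d =
      nodeWeight (G.rot c) 0 ((G.hat T).vert d) + nodeWeight (G.rot c) 0 ((G.hat T).head d) := by
  induction d using hatDart_cases with
  | ho d => simp at hd
  | hv l' c' b =>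
    have : diagWeight (G.rot c) 0 (ver l' c' b) + diagWeight c 0 (ver l' c' b) =
        nodeWeight (G.rot c) 0 (l'.castSucc, c') +
          nodeWeight (T := T) (G.rot c) 0 (l'.succ, c') := by
      simp [diagWeight, ver, nodeWeight, zmod_two_add_self]
    cases b
    · exact this
    · exact this.trans (add_comm _ _)
  | hd l' c' b =>
    have : diagWeight (G.rot c) 0 (diag l' c' b) + diagWeight c 0 (diag l' c' b) =
        nodeWeight (G.rot c) 0 (l'.castSucc, c') +
          nodeWeight (T := T) (G.rot c) 0 (l'.succ, G.rot c') := by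
      simp [diagWeight, diag, nodeWeight]
    cases b
    · exact this
    · exact this.trans (add_comm _ _)

/-- The parity of the number of edges of a walk that a ray from the node `(l, c)` crosses. -/
noncomputable def side (m : List (HatEdge E T × Bool)) (c : E × Bool) (l : ℕ) : ZMod 2 :=
  (m.map (diagWeight c l)).sum

/-- A walk crosses the cut of `weight_succ` an even number of times, because both of its ends are in
layer 0 and thus outside the set. -/
theorem side_rot_succ {a a' : E × Bool} {m : List (HatEdge E T × Bool)}
    (hm : (G.hat T).IsWalk (0, a) (0, a') m) (hn : ∀ d ∈ m, getOld d = none) (c : E × Bool)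
    (l : ℕ) : side m (G.rot c) (l + 1) + side m c l + (m.map (verWeight (G.rot c) l)).sum = 0 := by
  rw [side, side, ← List.sum_map_add, ← List.sum_map_add,
    List.map_congr_left fun d hd => weight_succ (G := G) d (hn d hd) c l,
    hm.sum_ends (nodeWeight (G.rot c) (l + 1))]
  simp [nodeWeight]

/-- Here the cut surrounds a full column, so the parity of the crossings tells whether exactly one
end of the walk is in that column. -/
theorem side_rot_zero {a a' : E × Bool} {m : List (HatEdge E T × Bool)}
    (hm : (G.hat T).IsWalk (0, a) (0, a') m) (hn : ∀ d ∈ m, getOld d = none) (c : E × Bool) :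
    side m (G.rot c) 0 + side m c 0 =
      ind (a = G.rot c) + ind (a' = G.rot c) := by
  rw [side, side, ← List.sum_map_add,
    List.map_congr_left fun d hd => weight_zero (G := G) d (hn d hd) c,
    hm.sum_ends (nodeWeight (G.rot c) 0)]
  simp [nodeWeight]

theorem IsWalk.mem_vertices_of_mem_or_flip_mem {s t : V} {p : List (E × Bool)}
    (h : G.IsWalk s t p) {d : E × Bool} (hd : d ∈ p ∨ flip d ∈ p) : G.vert d ∈ G.vertices s p := by
  rcases hd with hd | hd
  · exact h.vert_mem hd
  · have := head_mem (G := G) s hd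
    rwa [head, flip_flip] at this

/-- The side of a walk on which a node lies does not change along edges that avoid the walk. -/
theorem side_step {a a' : E × Bool} {m : List (HatEdge E T × Bool)}
    (hm : (G.hat T).IsWalk (0, a) (0, a') m) (hn : ∀ d ∈ m, getOld d = none)
    {d : HatEdge E T × Bool} (hd : getOld d = none)
    (h1 : (G.hat T).vert d ∉ (G.hat T).vertices (0, a) m)
    (h2 : (G.hat T).head d ∉ (G.hat T).vertices (0, a) m) :
    side m ((G.hat T).vert d).2 ((G.hat T).vert d).1 =
      side m ((G.hat T).head d).2 ((G.hat T).head d).1 := by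
  -- The rays from the two ends of a vertical edge differ by a single diagonal, which starts at the
  -- upper end and hence is not used by the walk.
  have hver : ∀ (l : Fin (T + 1)) c, (l.castSucc, c) ∉ (G.hat T).vertices (0, a) m →
      side m c (l.castSucc : Fin (T + 2)) = side m c (l.succ : Fin (T + 2)) := by
    intro l c h
    rw [side, side]
    refine congrArg List.sum (List.map_congr_left fun e he => ?_)
    induction e using hatDart_cases with
    | ho d => rfl
    | hv l' c' b => rfl
    | hd l' c' b =>
      by_cases hc : c' = c
      · subst hc
        have hne : (l' : ℕ) ≠ l := by
          intro hl
          obtain rfl : l' = l := Fin.ext hl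
          refine h (hm.mem_vertices_of_mem_or_flip_mem (d := diag l' c' false) ?_)
          cases b
          · exact .inl he
          · exact .inr he
        have : ((l : ℕ) ≤ l') ↔ ((l : ℕ) + 1 ≤ l') := by omega
        simp [diagWeight, diag, this]
      · simp [diagWeight, diag, hc]
  -- By `side_rot_succ` the two sides differ by the uses of the vertical edge into the lower end,
  -- and there are none as that node is avoided.
  have hdiag : ∀ (l : Fin (T + 1)) c, (l.succ, G.rot c) ∉ (G.hat T).vertices (0, a) m →
      side m c (l.castSucc : Fin (T + 2)) = side m (G.rot c) (l.succ : Fin (T + 2)) := by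
    intro l c h
    have key := side_rot_succ hm hn c l
    have hz : (m.map (verWeight (G.rot c) l)).sum = 0 := by
      apply List.sum_eq_zero
      intro w hw
      obtain ⟨e, he, rfl⟩ := List.mem_map.1 hw
      induction e using hatDart_cases with
      | ho d => rfl
      | hv l' c' b =>
        have hne : ¬ (c' = G.rot c ∧ (l' : ℕ) = l) := by
          rintro ⟨rfl, hl⟩
          obtain rfl : l' = l := Fin.ext hl
          refine h (hm.mem_vertices_of_mem_or_flip_mem (d := ver l' (G.rot c) true) ?_)
          cases b
          · exact .inr he
          · exact .inl he
        simp [verWeight, ver, hne]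
      | hd l' c' b => rfl
    rw [hz, add_zero] at key
    exact (CharTwo.add_eq_zero.1 key).symm
  induction d using hatDart_cases with
  | ho d => simp at hd
  | hv l c b =>
    cases b
    · exact hver l c h1
    · exact (hver l c h2).symm
  | hd l c b =>
    cases b
    · exact hdiag l c h2
    · exact (hdiag l c h1).symm

theorem side_walk {a a' : E × Bool} {m : List (HatEdge E T × Bool)}
    (hm : (G.hat T).IsWalk (0, a) (0, a') m) (hn : ∀ d ∈ m, getOld d = none)
    {x y : HatNode E T} {m' : List (HatEdge E T × Bool)}
    (hm' : (G.hat T).IsWalk x y m') (hn' : ∀ d ∈ m', getOld d = none)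
    (hdisj : ((G.hat T).vertices (0, a) m).Disjoint ((G.hat T).vertices x m')) :
    side m x.2 x.1 = side m y.2 y.1 := by
  induction m' generalizing x with
  | nil =>
    obtain rfl : x = y := hm'
    rfl
  | cons d m' ih =>
    obtain ⟨rfl, hw⟩ := hm'
    have hsub : ((G.hat T).vertices (0, a) m).Disjoint
        ((G.hat T).vertices ((G.hat T).head d) m') := fun v hv hv' =>
      hdisj hv (by simp [hv'])
    rw [side_step hm hn (hn' d (by simp)) (fun h => hdisj h (by simp))
      (fun h => hsub h (start_mem_vertices _ _))]
    exact ih hw (fun e he => hn' e (by simp [he])) hsub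

theorem pow_rot_injOn (σ : Equiv.Perm (E × Bool)) (a : E × Bool) {i j : ℕ}
    (hi : i < Function.minimalPeriod σ a) (hj : j < Function.minimalPeriod σ a) :
    (σ ^ i) a = (σ ^ j) a ↔ i = j := by
  rw [Equiv.Perm.coe_pow, Equiv.Perm.coe_pow]
  exact Function.iterate_eq_iterate_iff_of_lt_minimalPeriod hi hj

/-- Disjoint walks in a grid do not join interleaved pairs of nodes of the outer layer. -/
theorem not_clockwise_of_disjoint {a a' b b' : E × Bool} {m m' : List (HatEdge E T × Bool)}
    {a₁ a₂ b₁ b₂ : E × Bool}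
    (ha : (a₁ = a ∧ a₂ = a') ∨ (a₁ = a' ∧ a₂ = a)) (hb : (b₁ = b ∧ b₂ = b') ∨ (b₁ = b' ∧ b₂ = b))
    (hm : (G.hat T).IsWalk (0, a₁) (0, a₂) m) (hn : ∀ d ∈ m, getOld d = none)
    (hm' : (G.hat T).IsWalk (0, b₁) (0, b₂) m') (hn' : ∀ d ∈ m', getOld d = none)
    (hdisj : ((G.hat T).vertices (0, a₁) m).Disjoint ((G.hat T).vertices (0, b₁) m')) :
    ¬ G.Clockwise a b a' b' := by
  rintro ⟨i, j, k, hi, hij, hjk, hk, rfl, rfl, rfl⟩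
  have hside : side m ((G.rot ^ i) a) 0 = side m ((G.rot ^ k) a) 0 := by
    have := side_walk hm hn hm' hn' hdisj
    rcases hb with ⟨rfl, rfl⟩ | ⟨rfl, rfl⟩
    · exact this
    · exact this.symm
  -- Going clockwise from `a` to `b'`, the side changes only on reaching `a'`; column `a` itself is
  -- not reached again, as k is less than the period.
  have hstep : ∀ u, u + 1 ≤ k → side m ((G.rot ^ (u + 1)) a) 0 + side m ((G.rot ^ u) a) 0 =
      ind (u + 1 = j) := by
    intro u hu
    have h0 : a ≠ (G.rot ^ (u + 1)) a := fun h => by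
      have := (pow_rot_injOn G.rot a (i := 0) (by omega) (by omega)).1 h
      omega
    have hj : ((G.rot ^ j) a = (G.rot ^ (u + 1)) a) ↔ u + 1 = j := by
      rw [pow_rot_injOn G.rot a (by omega) (by omega), eq_comm]
    have := side_rot_zero hm hn ((G.rot ^ u) a)
    rw [← Equiv.Perm.mul_apply, ← pow_succ'] at this
    rw [this]
    rcases ha with ⟨rfl, rfl⟩ | ⟨rfl, rfl⟩
    · simp only [h0, ind_false, hj, zero_add]
    · simp only [h0, ind_false, hj, add_zero]
  have hind : ∀ u, i ≤ u → u ≤ k → side m ((G.rot ^ u) a) 0 =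
      side m ((G.rot ^ i) a) 0 + ind (j ≤ u) := by
    intro u hu
    induction u, hu using Nat.le_induction with
    | base =>
      intro _
      simp [Nat.not_le.2 hij]
    | succ u hu ih =>
      intro hk'
      have h1 := hstep u hk'
      have h2 := ih (by omega)
      have h3 : side m ((G.rot ^ (u + 1)) a) 0 =
          side m ((G.rot ^ u) a) 0 + ind (u + 1 = j) := by
        rw [← h1]
        linear_combination -zmod_two_add_self (side m ((G.rot ^ u) a) 0)
      rw [h3, h2, add_assoc]
      congr 1
      rcases lt_trichotomy (u + 1) j with h | h | h
      · simp [show ¬ j ≤ u by omega, show u + 1 ≠ j by omega, show ¬ j ≤ u + 1 by omega]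
      · simp [show ¬ j ≤ u by omega, h]
      · simp [show j ≤ u by omega, show u + 1 ≠ j by omega, show j ≤ u + 1 by omega]
  -- `a'` lies between `b` and `b'`, so their sides differ by one, contrary to `hside`.
  have := hind k (by omega) le_rfl
  rw [← hside, show (j ≤ k) = True from eq_true (by omega), ind_true] at this
  exact one_ne_zero (left_eq_add.1 this)

end Parity

/-! ### Projected paths are uncrossed. -/

/-- A passage of the projected walk comes from a stretch within one grid. -/
theorem exists_stretch {p : List (HatEdge E T × Bool)} {a a' : E × Bool}
    (h : PassesVia (proj p) a a') : ∃ A m B x y, p = A ++ old x :: (m ++ old y :: B) ∧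
      (∀ d ∈ m, getOld d = none) ∧ ((flip x = a ∧ y = a') ∨ (flip x = a' ∧ y = a)) := by
  have aux : ∀ x y, [x, y] <:+: proj p → ∃ A m B, p = A ++ old x :: (m ++ old y :: B) ∧
      (∀ d ∈ m, getOld d = none) := by
    rintro x y ⟨l₁, l₂, h⟩
    rw [List.append_assoc] at h
    obtain ⟨A, q, rfl, -, hq⟩ := List.filterMap_eq_append_iff.1 h.symm
    obtain ⟨A', d, q', rfl, -, hd, hq'⟩ := List.filterMap_eq_cons_iff.1 hq
    obtain ⟨m, d', B, rfl, hm, hd', -⟩ := List.filterMap_eq_cons_iff.1 hq'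
    rw [getOld_eq_some] at hd hd'
    subst hd hd'
    exact ⟨A ++ A', m, B, by simp, hm⟩
  rcases h with h | h
  · obtain ⟨A, m, B, hp, hm⟩ := aux _ _ h
    exact ⟨A, m, B, flip a, a', hp, hm, .inl ⟨flip_flip a, rfl⟩⟩
  · obtain ⟨A, m, B, hp, hm⟩ := aux _ _ h
    exact ⟨A, m, B, flip a', a, hp, hm, .inr ⟨flip_flip a', rfl⟩⟩

theorem IsWalk.stretch {s t : HatNode E T} {A m B : List (HatEdge E T × Bool)} {x y : E × Bool}
    (h : (G.hat T).IsWalk s t (A ++ old x :: (m ++ old y :: B))) :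
    (G.hat T).IsWalk s (0, x) A ∧ (G.hat T).IsWalk (0, flip x) (0, y) m ∧
      (G.hat T).IsWalk (0, y) t (old y :: B) := by
  obtain ⟨u, h1, h2, h3⟩ := isWalk_append.1 h
  obtain ⟨w, h4, h5, h6⟩ := isWalk_append.1 h3
  obtain rfl : (0, x) = u := h2
  obtain rfl : (0, y) = w := h5
  exact ⟨h1, h4, rfl, h6⟩

theorem IsWalk.stretch_vertices {s t : HatNode E T} {A m B : List (HatEdge E T × Bool)}
    {x y : E × Bool} (h : (G.hat T).IsWalk s t (A ++ old x :: (m ++ old y :: B)))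
    {w : HatNode E T} (hw : w ∈ (G.hat T).vertices (0, flip x) m) :
    w ∈ (G.hat T).vertices s (A ++ old x :: (m ++ old y :: B)) := by
  obtain ⟨h1, h2, h3⟩ := h.stretch
  rw [h1.mem_vertices_append, vertices_cons, List.mem_cons]
  exact .inr (.inr ((h2.mem_vertices_append w).2 (.inl hw)))

/-- Stretches of a path that meet are the same. -/
theorem IsPath.stretch_eq {s t : HatNode E T} {p A m B A' m' B' : List (HatEdge E T × Bool)}
    {x y x' y' : E × Bool} (h : (G.hat T).IsPath s t p)
    (hp : p = A ++ old x :: (m ++ old y :: B)) (hp' : p = A' ++ old x' :: (m' ++ old y' :: B'))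
    (hm : ∀ d ∈ m, getOld d = none) (hm' : ∀ d ∈ m', getOld d = none) {w : HatNode E T}
    (hw : w ∈ (G.hat T).vertices (0, flip x) m) (hw' : w ∈ (G.hat T).vertices (0, flip x') m') :
    x = x' ∧ y = y' := by
  obtain ⟨h1, h2, h3⟩ := IsWalk.stretch (hp ▸ h.1)
  obtain ⟨h1', h2', h3'⟩ := IsWalk.stretch (hp' ▸ h.1)
  obtain ⟨m₁, m₂, rfl, hw₁, -⟩ := h2.exists_split hw
  obtain ⟨m₁', m₂', rfl, hw₁', -⟩ := h2'.exists_split hw'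
  -- Both decompositions are cut at the common node. A path has only one such cut, so the last old
  -- dart before it and the first one after it agree.
  have e1 : p = (A ++ old x :: m₁) ++ (m₂ ++ old y :: B) := by simp [hp]
  have e2 : p = (A' ++ old x' :: m₁') ++ (m₂' ++ old y' :: B') := by simp [hp']
  have w1 : (G.hat T).IsWalk s w (A ++ old x :: m₁) := isWalk_append.2 ⟨_, h1, rfl, hw₁⟩
  have w2 : (G.hat T).IsWalk s w (A' ++ old x' :: m₁') := isWalk_append.2 ⟨_, h1', rfl, hw₁'⟩
  obtain ⟨ea, eb⟩ := IsPath.split_unique (e1 ▸ h) (e1.symm.trans e2) w1 w2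
  have nil_of : ∀ l : List (HatEdge E T × Bool), (∀ d ∈ l, getOld d = none) → proj l = [] :=
    fun l hl => List.filterMap_eq_nil_iff.2 hl
  have pa := congrArg proj ea
  have pb := congrArg proj eb
  have q1 : proj m₁ = [] := nil_of _ fun d hd => hm d (by simp [hd])
  have q2 : proj m₂ = [] := nil_of _ fun d hd => hm d (by simp [hd])
  have q1' : proj m₁' = [] := nil_of _ fun d hd => hm' d (by simp [hd])
  have q2' : proj m₂' = [] := nil_of _ fun d hd => hm' d (by simp [hd])
  have pcons : ∀ (d : E × Bool) (l l' : List (HatEdge E T × Bool)),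
      proj (l' ++ old d :: l) = proj l' ++ d :: proj l := fun d l l' => by simp [proj]
  rw [pcons, pcons, q1, q1'] at pa
  rw [pcons, pcons, q2, q2'] at pb
  exact ⟨by simpa using (List.append_inj' pa rfl).2, (List.cons.inj pb).1⟩

/-- Totally node-disjoint paths of the expansion project to an uncrossed trail flow. -/
theorem hasUncrossedTrailFlow_of_hat {dem : K → V × V} {dem' : K → HatNode E T × HatNode E T}
    (h1 : ∀ h, G.vert (dem' h).1.2 = (dem h).1) (h2 : ∀ h, G.vert (dem' h).2.2 = (dem h).2)
    (H : (G.hat T).HasNodeDisjointPaths dem') : G.HasUncrossedTrailFlow dem := by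
  obtain ⟨P, hP, hdisj⟩ := H
  refine ⟨fun h => proj (P h), fun h => ⟨?_, nodup_edges_proj (hP h).edges_nodup⟩, ?_, ?_⟩
  · rw [← h1, ← h2]
    exact (hP h).1.proj
  · intro h h' hne e he he'
    obtain ⟨d, hd, rfl⟩ := List.mem_map.1 he
    obtain ⟨d', hd', hdd⟩ := List.mem_map.1 he'
    rw [mem_proj] at hd hd'
    have hmem := (hP h).1.vert_mem hd
    refine hdisj h h' hne hmem ?_
    by_cases hb : d'.2 = d.2
    · obtain rfl : d' = d := Prod.ext hdd hb
      exact (hP h').1.vert_mem hd'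
    · have : flip d' = d := Prod.ext hdd (by
        change (!d'.2) = d.2
        rw [Bool.eq_not.2 hb, Bool.not_not])
      have := head_mem (G := G.hat T) (dem' h').1 hd'
      rwa [head, flip_old, ‹flip d' = d›] at this
  · intro h h' a a' b b' hab hab' hcl
    obtain ⟨A, m, B, x, y, hp, hm, hxy⟩ := exists_stretch hab
    obtain ⟨A', m', B', x', y', hp', hm', hxy'⟩ := exists_stretch hab'
    have w1 := (hP h).1
    have w2 := (hP h').1
    rw [hp] at w1
    rw [hp'] at w2
    refine not_clockwise_of_disjoint hxy hxy' w1.stretch.2.1 hm w2.stretch.2.1 hm' ?_ hcl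
    intro w hw hw'
    -- Paths of different demands are disjoint anyway. Two stretches of one path that meet are
    -- equal, which would make two of the four distinct darts equal.
    by_cases hh : h = h'
    · subst hh
      obtain ⟨rfl, rfl⟩ := (hP h).stretch_eq hp hp' hm hm' hw hw'
      obtain ⟨i, j, k, hi, hij, hjk, hk, rfl, rfl, rfl⟩ := hcl
      have hne : ∀ u, 0 < u → u ≤ k → (G.rot ^ u) a ≠ a := fun u hu huk he => by
        have := (pow_rot_injOn G.rot a (i := u) (j := 0) (by omega) (by omega)).1 he
        omega
      have hbi := hne i hi (by omega)
      have hbk := hne k (by omega) le_rfl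
      rcases hxy with ⟨e1, e2⟩ | ⟨e1, e2⟩ <;> rcases hxy' with ⟨e3, e4⟩ | ⟨e3, e4⟩
      · exact hbi (e3.symm.trans e1)
      · exact hbk (e3.symm.trans e1)
      · exact hbk (e4.symm.trans e2)
      · exact hbi (e4.symm.trans e2)
    · have v1 := w1.stretch_vertices hw
      have v2 := w2.stretch_vertices hw'
      rw [← hp] at v1
      rw [← hp'] at v2
      exact hdisj h h' hh v1 v2

end EmbeddedGraph

namespace EmbeddedGraph

variable {V E K : Type*}

/-- The first or the second end of a demand. -/
def endOf {X : Type*} (x : X × X) (b : Bool) : X := cond b x.2 x.1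

/-! ### Linear positions of darts about a vertex. -/

section Position

variable (G : EmbeddedGraph V E)

/-- A dart chosen at the vertex of `a`. -/
noncomputable def origin (a : E × Bool) : E × Bool :=
  @Classical.epsilon _ ⟨a⟩ fun d => G.vert d = G.vert a

theorem vert_origin (a : E × Bool) : G.vert (G.origin a) = G.vert a :=
  @Classical.epsilon_spec_aux _ ⟨a⟩ (fun d => G.vert d = G.vert a) ⟨a, rfl⟩

/-- The predicate given to `epsilon` involves `a` only through its vertex, so all darts at a vertex
share one origin and their positions are comparable. -/
theorem origin_congr {a b : E × Bool} (h : G.vert a = G.vert b) : G.origin a = G.origin b := by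
  simp only [origin, h]

theorem minimalPeriod_rot_pos [Finite E] (a : E × Bool) : 0 < Function.minimalPeriod G.rot a := by
  obtain ⟨n, hn, h⟩ := (isOfFinOrder_of_finite G.rot).exists_pow_eq_one
  refine Function.IsPeriodicPt.minimalPeriod_pos hn ?_
  rw [Function.IsPeriodicPt, Function.IsFixedPt, ← Equiv.Perm.coe_pow, h, Equiv.Perm.one_apply]

theorem exists_pow_rot [Finite E] {a b : E × Bool} (h : G.vert a = G.vert b) :
    ∃ t < Function.minimalPeriod G.rot a, (G.rot ^ t) a = b := by
  obtain ⟨t, ht⟩ := ((G.sameCycle_iff a b).2 h).exists_nat_pow_eq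
  refine ⟨t % Function.minimalPeriod G.rot a, Nat.mod_lt _ (G.minimalPeriod_rot_pos a), ?_⟩
  rw [← ht, Equiv.Perm.coe_pow, Equiv.Perm.coe_pow, Function.iterate_mod_minimalPeriod_eq]

variable [Finite E]

/-- The place of a dart in the clockwise order about its vertex. -/
noncomputable def pos (a : E × Bool) : ℕ := (G.exists_pow_rot (G.vert_origin a)).choose

theorem pos_lt (a : E × Bool) : G.pos a < Function.minimalPeriod G.rot (G.origin a) :=
  (G.exists_pow_rot (G.vert_origin a)).choose_spec.1

theorem pow_pos_origin (a : E × Bool) : (G.rot ^ G.pos a) (G.origin a) = a :=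
  (G.exists_pow_rot (G.vert_origin a)).choose_spec.2

theorem minimalPeriod_origin (a : E × Bool) :
    Function.minimalPeriod G.rot (G.origin a) = Function.minimalPeriod G.rot a := by
  conv_rhs => rw [← G.pow_pos_origin a, Equiv.Perm.coe_pow]
  rw [Function.minimalPeriod_apply_iterate]
  exact Function.minimalPeriod_pos_iff_mem_periodicPts.1 (G.minimalPeriod_rot_pos _)

theorem pos_inj {a b : E × Bool} (h : G.vert a = G.vert b) (hp : G.pos a = G.pos b) : a = b := by
  rw [← G.pow_pos_origin a, ← G.pow_pos_origin b, hp, G.origin_congr h]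

theorem pow_sub_pos {a b : E × Bool} (h : G.vert a = G.vert b) (hp : G.pos a ≤ G.pos b) :
    (G.rot ^ (G.pos b - G.pos a)) a = b := by
  have h1 : (G.rot ^ (G.pos b - G.pos a)) ((G.rot ^ G.pos a) (G.origin a)) = b := by
    rw [← Equiv.Perm.mul_apply, ← pow_add, Nat.sub_add_cancel hp, G.origin_congr h,
      G.pow_pos_origin]
  rwa [G.pow_pos_origin] at h1

/-- Staying at or before the position of a dart means staying below the period, so the count does
not wrap around at the origin. -/
theorem pos_pow {a b : E × Bool} (h : G.vert a = G.vert b) {u : ℕ} (hu : G.pos a + u ≤ G.pos b) :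
    G.pos ((G.rot ^ u) a) = G.pos a + u := by
  have hv := G.vert_rot_pow a u
  have hb := G.pos_lt b
  have hc := G.pos_lt ((G.rot ^ u) a)
  rw [← G.origin_congr h] at hb
  rw [G.origin_congr hv] at hc
  rw [← pow_rot_injOn G.rot (G.origin a) hc (by omega), ← G.origin_congr hv, G.pow_pos_origin,
    G.origin_congr hv, add_comm, pow_add, Equiv.Perm.mul_apply, G.pow_pos_origin]

theorem clockwise_of_pos_lt {a b a' b' : E × Bool} (h₁ : G.vert b = G.vert a)
    (h₂ : G.vert a' = G.vert a) (h₃ : G.vert b' = G.vert a) (p₁ : G.pos a < G.pos b)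
    (p₂ : G.pos b < G.pos a') (p₃ : G.pos a' < G.pos b') : G.Clockwise a b a' b' := by
  have hlt := G.pos_lt b'
  rw [G.origin_congr h₃, minimalPeriod_origin] at hlt
  exact ⟨G.pos b - G.pos a, G.pos a' - G.pos a, G.pos b' - G.pos a, by omega, by omega, by omega,
    by omega, (G.pow_sub_pos h₁.symm (by omega)).symm, (G.pow_sub_pos h₂.symm (by omega)).symm,
    (G.pow_sub_pos h₃.symm (by omega)).symm⟩

end Position

/-- How an uncrossed trail flow passes through the vertices: the dart with which the trail of a
demand starts or ends, and the pairs of darts that are consecutive in the trail. -/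
structure Passages (G : EmbeddedGraph V E) (dem : K → V × V) where
  tm : K → Bool → E × Bool
  M : K → E × Bool → E × Bool → Prop
  vert_tm : ∀ h b, G.vert (tm h b) = endOf (dem h) b
  tm_inj : ∀ {h b h' b'}, tm h b = tm h' b' → h = h' ∧ b = b'
  M_symm : ∀ {h a a'}, M h a a' → M h a' a
  M_vert : ∀ {h a a'}, M h a a' → G.vert a = G.vert a'
  M_ne : ∀ {h a a'}, M h a a' → a ≠ a'
  M_unique : ∀ {h a a' h' b}, M h a a' → M h' a b → h = h' ∧ a' = b
  M_tm : ∀ {h a a'}, M h a a' → ∀ h' b, a ≠ tm h' b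
  uncrossed : ∀ {h h' a a' b b'}, M h a a' → M h' b b' → ¬ G.Clockwise a b a' b'
  connected : ∀ h, Relation.ReflTransGen
    (fun a a' => ((∃ b, a = tm h b) ∨ ∃ c, M h a c) ∧ ((∃ b, a' = tm h b) ∨ ∃ c, M h a' c) ∧
      (a' = flip a ∨ M h a a')) (tm h false) (tm h true)

/-! ### Reading off the passages of an uncrossed trail flow. -/

section FlowToPassages

variable {G : EmbeddedGraph V E} {dem : K → V × V}

theorem passesVia_comm {p : List (E × Bool)} {a b : E × Bool} :
    PassesVia p a b ↔ PassesVia p b a := Or.comm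

theorem infix_pair_iff {α : Type*} {p : List α} {x y : α} :
    [x, y] <:+: p ↔ ∃ A B, p = A ++ x :: y :: B := by
  constructor
  · rintro ⟨A, B, h⟩
    exact ⟨A, B, by simpa using h.symm⟩
  · rintro ⟨A, B, rfl⟩
    exact ⟨A, B, by simp⟩

theorem IsWalk.head_eq_vert {s t : V} {p : List (E × Bool)} (h : G.IsWalk s t p)
    {x y : E × Bool} (hxy : [x, y] <:+: p) : G.head x = G.vert y := by
  obtain ⟨A, B, rfl⟩ := infix_pair_iff.1 hxy
  obtain ⟨u, -, -, h2, -⟩ := isWalk_append.1 h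
  exact h2.symm

theorem nodup_of_nodup_edges {p : List (E × Bool)} (h : (edges p).Nodup) : p.Nodup := h.of_map

/-- In a list without repeated edges, the edge determines the dart. -/
theorem eq_of_mem_of_fst_eq {p : List (E × Bool)} (h : (edges p).Nodup) {x y : E × Bool}
    (hx : x ∈ p) (hy : y ∈ p) (he : x.1 = y.1) : x = y :=
  List.inj_on_of_nodup_map h hx hy he

theorem flip_ne (d : E × Bool) : flip d ≠ d := fun h => by
  have : (!d.2) = d.2 := congrArg Prod.snd h
  simp at this

theorem not_mem_flip {p : List (E × Bool)} (h : (edges p).Nodup) {x : E × Bool}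
    (hx : x ∈ p) : flip x ∉ p := fun hf =>
  flip_ne x (eq_of_mem_of_fst_eq h hf hx rfl)

theorem succ_unique {α : Type*} {p : List α} (h : p.Nodup) {x y z : α} (h1 : [x, y] <:+: p)
    (h2 : [x, z] <:+: p) : y = z := by
  obtain ⟨A, B, rfl⟩ := infix_pair_iff.1 h1
  obtain ⟨A', B', he⟩ := infix_pair_iff.1 h2
  have hx : x ∉ A := fun hx => (List.disjoint_of_nodup_append h) hx (by simp)
  have hx' : x ∉ y :: B := (List.nodup_cons.1 (List.nodup_append.1 h).2.1).1
  exact (List.cons.inj ((List.append_cons_inj_of_notMem hx hx').1 he).2.2).1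

theorem pred_unique {α : Type*} {p : List α} (h : p.Nodup) {x y z : α} (h1 : [x, z] <:+: p)
    (h2 : [y, z] <:+: p) : x = y := by
  have r1 : [z, x] <:+: p.reverse := by simpa using List.reverse_infix.2 h1
  have r2 : [z, y] <:+: p.reverse := by simpa using List.reverse_infix.2 h2
  exact succ_unique (List.nodup_reverse.2 h) r1 r2

theorem eq_head_or_pred {α : Type*} {p : List α} (hp : p ≠ []) {y : α} (hy : y ∈ p) :
    y = p.head hp ∨ ∃ x, [x, y] <:+: p := by
  obtain ⟨A, B, rfl⟩ := List.append_of_mem hy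
  rcases List.eq_nil_or_concat A with rfl | ⟨A, x, rfl⟩
  · exact .inl rfl
  · exact .inr ⟨x, infix_pair_iff.2 ⟨A, B, by simp⟩⟩

theorem eq_last_or_succ {α : Type*} {p : List α} (hp : p ≠ []) {y : α} (hy : y ∈ p) :
    y = p.getLast hp ∨ ∃ z, [y, z] <:+: p := by
  obtain ⟨A, B, rfl⟩ := List.append_of_mem hy
  cases B with
  | nil => exact .inl (by simp)
  | cons z B => exact .inr ⟨z, infix_pair_iff.2 ⟨A, B, rfl⟩⟩

theorem not_infix_head {α : Type*} {p : List α} (h : p.Nodup) (hp : p ≠ []) {x : α} :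
    ¬ [x, p.head hp] <:+: p := by
  rintro ⟨A, B, he⟩
  cases p with
  | nil => exact hp rfl
  | cons y p =>
    cases A with
    | nil =>
      simp only [List.head_cons, List.nil_append, List.cons_append, List.cons.injEq] at he
      exact (List.nodup_cons.1 h).1 (by rw [← he.2]; simp)
    | cons z A =>
      simp only [List.head_cons, List.cons_append, List.cons.injEq] at he
      exact (List.nodup_cons.1 h).1 (by rw [← he.2]; simp)

theorem not_infix_last {α : Type*} {p : List α} (h : p.Nodup) (hp : p ≠ []) {x : α} :
    ¬ [p.getLast hp, x] <:+: p := by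
  intro hi
  have hr : p.reverse ≠ [] := by simpa using hp
  refine not_infix_head (List.nodup_reverse.2 h) hr (x := x) ?_
  rw [List.head_reverse]
  simpa using List.reverse_infix.2 hi

/-- A trail alternates between traversing an edge, from `y` to `flip y`, and passing through a
vertex, from `flip y` to the next dart. -/
theorem reflTransGen_list {R : E × Bool → E × Bool → Prop} (p : List (E × Bool)) (hp : p ≠ [])
    (h1 : ∀ y z, [y, z] <:+: p → R (flip y) z) (h2 : ∀ y ∈ p, R y (flip y)) :
    Relation.ReflTransGen R (p.head hp) (flip (p.getLast hp)) := by
  induction p with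
  | nil => exact absurd rfl hp
  | cons x p ih =>
    have hx : R x (flip x) := h2 x (by simp)
    cases p with
    | nil => exact .single hx
    | cons y p =>
      refine .head hx (.head (h1 x y (infix_pair_iff.2 ⟨[], p, rfl⟩)) ?_)
      exact ih (by simp) (fun y' z' h => h1 y' z' (h.trans (List.suffix_cons _ _).isInfix))
        (fun y' hy => h2 y' (by simp [hy]))

theorem IsWalk.vert_head {s t : V} {p : List (E × Bool)} (h : G.IsWalk s t p) (hp : p ≠ []) :
    G.vert (p.head hp) = s := by
  cases p with
  | nil => exact absurd rfl hp
  | cons d p => exact h.1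

theorem IsWalk.head_getLast {s t : V} {p : List (E × Bool)} (h : G.IsWalk s t p) (hp : p ≠ []) :
    G.vert (flip (p.getLast hp)) = t := by
  induction p generalizing s with
  | nil => exact absurd rfl hp
  | cons d p ih =>
    cases p with
    | nil => exact h.2
    | cons d' p => exact ih h.2 (by simp)

/-- The passages of an uncrossed trail flow. -/
theorem exists_passages (hne : ∀ h, (dem h).1 ≠ (dem h).2) (H : G.HasUncrossedTrailFlow dem) :
    Nonempty (Passages G dem) := by
  obtain ⟨P, hP, hdisj, hcross⟩ := H
  -- This is where demands with equal ends must be excluded: an empty trail has no first or last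
  -- dart.
  have hnil : ∀ h, P h ≠ [] := fun h h0 => by
    have := (hP h).1
    rw [h0] at this
    exact hne h this
  have hnd : ∀ h, (P h).Nodup := fun h => nodup_of_nodup_edges (hP h).2
  have color : ∀ {h h' a}, a ∈ P h ∨ flip a ∈ P h → a ∈ P h' ∨ flip a ∈ P h' → h = h' := by
    intro h h' a ha ha'
    by_contra hh
    refine hdisj h h' hh (a := a.1) ?_ ?_
    · exact ha.elim (fun h => List.mem_map.2 ⟨_, h, rfl⟩) (fun h => List.mem_map.2 ⟨_, h, rfl⟩)
    · exact ha'.elim (fun h => List.mem_map.2 ⟨_, h, rfl⟩) (fun h => List.mem_map.2 ⟨_, h, rfl⟩)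
  have left_mem : ∀ {h : K} {x y}, [x, y] <:+: P h → x ∈ P h := fun hxy =>
    hxy.subset (by simp)
  have right_mem : ∀ {h : K} {x y}, [x, y] <:+: P h → y ∈ P h := fun hxy =>
    hxy.subset (by simp)
  -- The last dart is reversed, so that the dart recorded for an end is attached at that end.
  let tm : K → Bool → E × Bool := fun h b =>
    cond b (flip ((P h).getLast (hnil h))) ((P h).head (hnil h))
  have tm_used : ∀ h b, tm h b ∈ P h ∨ flip (tm h b) ∈ P h := by
    rintro h (_ | _)
    · exact .inl (List.head_mem _)
    · refine .inr ?_
      change flip (flip _) ∈ _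
      rw [flip_flip]
      exact List.getLast_mem _
  have M_used : ∀ {h a a'}, PassesVia (P h) a a' → a ∈ P h ∨ flip a ∈ P h := by
    rintro h a a' (hab | hab)
    · exact .inr (left_mem hab)
    · exact .inl (right_mem hab)
  have tm_ne : ∀ h, tm h false ≠ tm h true := by
    intro h he
    refine not_mem_flip (hP h).2 (List.getLast_mem (hnil h)) ?_
    have : flip ((P h).getLast (hnil h)) = (P h).head (hnil h) := he.symm
    rw [this]
    exact List.head_mem _
  have act : ∀ h, ∀ y ∈ P h, (∃ b, y = tm h b) ∨ ∃ c, PassesVia (P h) y c := by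
    intro h y hy
    rcases eq_head_or_pred (hnil h) hy with h0 | ⟨x, hx⟩
    · exact .inl ⟨false, h0⟩
    · exact .inr ⟨flip x, .inr (by rwa [flip_flip])⟩
  have act' : ∀ h, ∀ y ∈ P h, (∃ b, flip y = tm h b) ∨ ∃ c, PassesVia (P h) (flip y) c := by
    intro h y hy
    rcases eq_last_or_succ (hnil h) hy with h0 | ⟨z, hz⟩
    · exact .inl ⟨true, congrArg flip h0⟩
    · exact .inr ⟨z, .inl (by rwa [flip_flip])⟩
  refine ⟨⟨tm, fun h => PassesVia (P h), ?_, ?_, ?_, ?_, ?_, ?_, ?_, hcross _ _ _ _ _ _, ?_⟩⟩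
  · rintro h (_ | _)
    · exact (hP h).1.vert_head _
    · exact (hP h).1.head_getLast _
  · intro h b h' b' he
    obtain rfl : h = h' := color (tm_used h b) (he ▸ tm_used h' b')
    refine ⟨rfl, ?_⟩
    cases b <;> cases b'
    · rfl
    · exact absurd he (tm_ne h)
    · exact absurd he.symm (tm_ne h)
    · rfl
  · intro h a a' hab
    exact passesVia_comm.1 hab
  · rintro h a a' (hab | hab)
    · have := (hP h).1.head_eq_vert hab
      rwa [head, flip_flip] at this
    · have := (hP h).1.head_eq_vert hab
      rw [head, flip_flip] at this
      exact this.symm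
  · rintro h a a' (hab | hab) rfl
    · exact not_mem_flip (hP h).2 (right_mem hab) (left_mem hab)
    · exact not_mem_flip (hP h).2 (right_mem hab) (left_mem hab)
  · intro h a a' h' b hab hab'
    obtain rfl : h = h' := color (M_used hab) (M_used hab')
    refine ⟨rfl, ?_⟩
    rcases hab with hab | hab <;> rcases hab' with hab' | hab'
    · exact succ_unique (hnd h) hab hab'
    · exact absurd (left_mem hab) (not_mem_flip (hP h).2 (right_mem hab'))
    · exact absurd (left_mem hab') (not_mem_flip (hP h).2 (right_mem hab))
    · exact flip.injective (pred_unique (hnd h) hab hab')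
  · rintro h a a' hab h' b rfl
    obtain rfl : h = h' := color (M_used hab) (tm_used h' b)
    cases b
    · have hmem : tm h false ∈ P h := List.head_mem _
      rcases hab with hab | hab
      · exact not_mem_flip (hP h).2 hmem (left_mem hab)
      · exact not_infix_head (hnd h) (hnil h) hab
    · have hfl : flip (tm h true) = (P h).getLast (hnil h) := flip_flip _
      rcases hab with hab | hab
      · rw [hfl] at hab
        exact not_infix_last (hnd h) (hnil h) hab
      · refine not_mem_flip (hP h).2 (right_mem hab) ?_
        rw [hfl]
        exact List.getLast_mem _
  · intro h
    refine reflTransGen_list (P h) (hnil h) ?_ ?_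
    · intro y z hyz
      refine ⟨act' h y (left_mem hyz), act h z (right_mem hyz), .inr (.inl ?_)⟩
      rwa [flip_flip]
    · intro y hy
      exact ⟨act h y hy, act' h y hy, .inl rfl⟩

end FlowToPassages

end EmbeddedGraph

/-! ### From trails to node-disjoint paths: routing in the cylinders. -/

namespace EmbeddedGraph

variable {V E K : Type*}

/-- A schedule of unit shifts: in round `j`, which consists of `q` layers, one shifts until `hit j`
holds. -/
theorem exists_schedule {q : ℕ} (hit : ℕ → ℕ → Prop) (hq : 0 < q)
    (h : ∀ j r, ∃ t < q, hit j (r + t)) :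
    ∃ r : ℕ → ℕ, r 0 = 0 ∧ (∀ l, r (l + 1) = r l ∨ r (l + 1) = r l + 1) ∧
      (∀ j, hit j (r (q * j + (q - 1)))) ∧ ∀ l, hit (l / q) (r l) → r (l + 1) = r l := by
  classical
  -- Layer l belongs to round l / q. Once the goal of the round holds, the shift stays put until the
  -- round ends.
  let r : ℕ → ℕ := fun l => Nat.rec 0 (fun l x => if hit (l / q) x then x else x + 1) l
  have hr : ∀ l, r (l + 1) = if hit (l / q) (r l) then r l else r l + 1 := fun l => rfl
  refine ⟨r, rfl, fun l => ?_, fun j => ?_, fun l hl => by rw [hr, if_pos hl]⟩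
  · rw [hr]
    split_ifs
    · exact .inl rfl
    · exact .inr rfl
  · have key : ∀ i < q, hit j (r (q * j + i)) ∨
        (r (q * j + i) = r (q * j) + i ∧ ∀ t ≤ i, ¬ hit j (r (q * j) + t)) := by
      intro i
      induction i with
      | zero =>
        intro _
        by_cases h0 : hit j (r (q * j))
        · exact .inl h0
        · refine .inr ⟨rfl, fun t ht => ?_⟩
          obtain rfl : t = 0 := by omega
          exact h0
      | succ i ih =>
        intro hi
        have hdiv : (q * j + i) / q = j := by
          rw [Nat.mul_add_div hq, Nat.div_eq_of_lt (by omega), add_zero]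
        have hr' := hr (q * j + i)
        rw [hdiv] at hr'
        rcases ih (by omega) with h1 | ⟨h1, h2⟩
        · left
          rw [← add_assoc, hr', if_pos h1]
          exact h1
        · have hn : ¬ hit j (r (q * j + i)) := by
            rw [h1]
            exact h2 i le_rfl
          rw [if_neg hn, h1] at hr'
          by_cases h3 : hit j (r (q * j + (i + 1)))
          · exact .inl h3
          · refine .inr ⟨by rw [← add_assoc, hr', add_assoc], fun t ht => ?_⟩
            rcases Nat.lt_or_ge t (i + 1) with h4 | h4
            · exact h2 t (by omega)
            · obtain rfl : t = i + 1 := by omega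
              rw [← add_assoc, hr', add_assoc] at h3
              exact h3
    rcases key (q - 1) (by omega) with h1 | ⟨-, h2⟩
    · exact h1
    · obtain ⟨t, ht, hh⟩ := h j (r (q * j))
      exact absurd hh (h2 t (by omega))

theorem stepIn_layer {G : EmbeddedGraph V E} {T : ℕ} {S : HatNode E T → Prop} {x y : HatNode E T}
    (hl : (y.1 : ℕ) = x.1 + 1) (hc : y.2 = x.2 ∨ y.2 = G.rot x.2) (hx : S x) (hy : S y) :
    (G.hat T).StepIn S x y := by
  obtain ⟨⟨l, hl₁⟩, c⟩ := x
  obtain ⟨⟨l', hl₂⟩, c'⟩ := y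
  obtain rfl : l' = l + 1 := hl
  rcases hc with rfl | rfl
  · exact ⟨ver ⟨l, by omega⟩ c' false, rfl, rfl, hx, hy⟩
  · exact ⟨diag ⟨l, by omega⟩ c false, rfl, rfl, hx, hy⟩

theorem reflTransGen_stepIn_symm {G : EmbeddedGraph V E} {S : V → Prop} {x y : V}
    (h : Relation.ReflTransGen (G.StepIn S) x y) : Relation.ReflTransGen (G.StepIn S) y x :=
  haveI : Std.Symm (G.StepIn S) := ⟨fun _ _ => StepIn.symm⟩
  Relation.ReflTransGen.stdSymm.symm _ _ h

section Route

variable {G : EmbeddedGraph V E} {dem : K → V × V} [Finite E]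

/-- The strand of the dart `a`, which belongs to the demand `h`, reaches down to layer `l`. -/
def Passages.Live (Q : Passages G dem) (q : ℕ) (slot : K → Bool → ℕ) (h : K) (a : E × Bool)
    (l : ℕ) : Prop :=
  (∃ b, a = Q.tm h b ∧ l ≤ q * slot h b + (q - 1)) ∨
    -- One of the truncated differences vanishes, so their sum is the distance of the two positions.
    ∃ a', Q.M h a a' ∧ l ≤ q * q + 2 * ((G.pos a - G.pos a') + (G.pos a' - G.pos a))

/-- The node `(l, c)` lies on a strand of the demand `h`. -/
def Passages.OnStrand (Q : Passages G dem) (q : ℕ) (slot : K → Bool → ℕ) (r : V → ℕ → ℕ) (h : K)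
    (l : ℕ) (c : E × Bool) : Prop :=
  ∃ a, Q.Live q slot h a l ∧ c = (G.rot ^ r (G.vert a) l) a

/-- The node `(l, c)` lies on a zigzag line by which two strands of the demand `h` are joined. -/
def Passages.OnBridge (Q : Passages G dem) (q : ℕ) (r : V → ℕ → ℕ) (h : K)
    (l : ℕ) (c : E × Bool) : Prop :=
  ∃ a a' u, Q.M h a a' ∧ G.pos a < G.pos a' ∧ u ≤ G.pos a' - G.pos a ∧
    c = (G.rot ^ (r (G.vert a) (q * q) + u)) a ∧
    (l = q * q + 2 * (G.pos a' - G.pos a) ∨ l = q * q + 2 * (G.pos a' - G.pos a) + 1 ∧ 0 < u)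

variable {Q : Passages G dem} {q : ℕ} {slot : K → Bool → ℕ} {r : V → ℕ → ℕ}

/-- A dart is the end of at most one trail or is passed by at most one, and not both, so it
determines its demand. -/
theorem Passages.live_color {h h' : K} {a : E × Bool} {l l' : ℕ} (h₁ : Q.Live q slot h a l)
    (h₂ : Q.Live q slot h' a l') : h = h' := by
  rcases h₁ with ⟨b, rfl, -⟩ | ⟨c, hc, -⟩ <;> rcases h₂ with ⟨b', hb, -⟩ | ⟨c', hc', -⟩
  · exact (Q.tm_inj hb).1
  · exact absurd rfl (Q.M_tm hc' h b)
  · exact absurd hb (Q.M_tm hc h' b')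
  · exact (Q.M_unique hc hc').1

theorem Passages.live_mono {h : K} {a : E × Bool} {l l' : ℕ} (hl : l' ≤ l)
    (h₁ : Q.Live q slot h a l) : Q.Live q slot h a l' := by
  rcases h₁ with ⟨b, hb, h⟩ | ⟨c, hc, h⟩
  · exact .inl ⟨b, hb, by omega⟩
  · exact .inr ⟨c, hc, by omega⟩

/-- In a given layer all strands at a vertex are rotated by the same amount; strands that meet start
at the same dart. -/
theorem Passages.onStrand_disjoint {h h' : K} {l : ℕ} {c : E × Bool}
    (h₁ : Q.OnStrand q slot r h l c) (h₂ : Q.OnStrand q slot r h' l c) : h = h' := by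
  obtain ⟨a, ha, rfl⟩ := h₁
  obtain ⟨b, hb, he⟩ := h₂
  have hv : G.vert a = G.vert b := by
    rw [← G.vert_rot_pow a (r (G.vert a) l), he, G.vert_rot_pow]
  rw [hv] at he
  obtain rfl := (G.rot ^ r (G.vert b) l).injective he
  exact Passages.live_color ha hb

/-- Terminal strands end above layer q², and bridges lie at or below it. A passing strand at a
column within the span of a bridge either shares a dart with the bridged pair, hence its demand, or
starts strictly between the two. Then uncrossedness puts its partner between them too, so it is
closer to its partner and stops above the bridge. -/
theorem Passages.strand_bridge_disjoint {h h' : K} {l : ℕ} {c : E × Bool}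
    (hslot : ∀ h b, slot h b < q) (hr : ∀ v l, q * q ≤ l → r v l = r v (q * q))
    (h₁ : Q.OnStrand q slot r h l c) (h₂ : Q.OnBridge q r h' l c) : h = h' := by
  obtain ⟨a, ha, rfl⟩ := h₁
  obtain ⟨b, b', u, hM, hlt, hu, he, hl⟩ := h₂
  have hv : G.vert a = G.vert b := by
    rw [← G.vert_rot_pow a (r (G.vert a) l), he, G.vert_rot_pow]
  have hvb := Q.M_vert hM
  rw [hv, hr _ l (by omega), pow_add, Equiv.Perm.mul_apply] at he
  obtain rfl := (G.rot ^ r (G.vert b) (q * q)).injective he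
  have hp : G.pos ((G.rot ^ u) b) = G.pos b + u := G.pos_pow hvb (by omega)
  rcases ha with ⟨x, -, hx⟩ | ⟨a', hM', hx⟩
  · have h1 : q * slot h x + q ≤ q * q := by
      have := Nat.mul_le_mul_left q (hslot h x)
      rwa [Nat.mul_succ] at this
    have := hslot h x
    omega
  · have hva' := Q.M_vert hM'
    set a := (G.rot ^ u) b with hadef
    by_cases e1 : a = b
    · exact (Q.M_unique (e1 ▸ hM') hM).1
    by_cases e2 : a = b'
    · exact (Q.M_unique (e2 ▸ hM') (Q.M_symm hM)).1
    by_cases e3 : a' = b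
    · exact (Q.M_unique (e3 ▸ Q.M_symm hM') hM).1
    by_cases e4 : a' = b'
    · exact (Q.M_unique (e4 ▸ Q.M_symm hM') (Q.M_symm hM)).1
    have n1 : G.pos a ≠ G.pos b := fun e => e1 (G.pos_inj hv e)
    have n2 : G.pos a ≠ G.pos b' := fun e => e2 (G.pos_inj (hv.trans hvb) e)
    have n3 : G.pos a' ≠ G.pos b := fun e => e3 (G.pos_inj (hva'.symm.trans hv) e)
    have n4 : G.pos a' ≠ G.pos b' := fun e => e4 (G.pos_inj (hva'.symm.trans (hv.trans hvb)) e)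
    -- A partner before `b` or after `b'` would give a crossing.
    rcases Nat.lt_or_ge (G.pos a') (G.pos b) with h5 | h5
    · refine absurd ?_ (Q.uncrossed (Q.M_symm hM') hM)
      exact G.clockwise_of_pos_lt (hv.symm.trans hva') hva'
        (hvb.symm.trans (hv.symm.trans hva')) h5 (by omega) (by omega)
    rcases Nat.lt_or_ge (G.pos b') (G.pos a') with h6 | h6
    · refine absurd ?_ (Q.uncrossed hM hM')
      exact G.clockwise_of_pos_lt hv hvb.symm (hva'.symm.trans hv) (by omega) (by omega) h6
    omega

/-- A bridge over distance x occupies layers q² + 2x and q² + 2x + 1 only, so bridges that meet span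
equal distances. Two overlapping intervals of equal length without a common end interleave, which is
a crossing. -/
theorem Passages.onBridge_disjoint {h h' : K} {l : ℕ} {c : E × Bool}
    (h₁ : Q.OnBridge q r h l c) (h₂ : Q.OnBridge q r h' l c) : h = h' := by
  obtain ⟨a, a', u, hM, hlt, hu, rfl, hl⟩ := h₁
  obtain ⟨b, b', w, hM', hlt', hw, he, hl'⟩ := h₂
  have hv : G.vert a = G.vert b := by
    rw [← G.vert_rot_pow a (r (G.vert a) (q * q) + u), he, G.vert_rot_pow]
  have hva := Q.M_vert hM
  have hvb := Q.M_vert hM'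
  rw [hv, pow_add, pow_add, Equiv.Perm.mul_apply, Equiv.Perm.mul_apply] at he
  have he := (G.rot ^ r (G.vert b) (q * q)).injective he
  have hp : G.pos ((G.rot ^ u) a) = G.pos a + u := G.pos_pow hva (by omega)
  have hp' : G.pos ((G.rot ^ w) b) = G.pos b + w := G.pos_pow hvb (by omega)
  rw [he, hp'] at hp
  by_cases e1 : a = b
  · exact (Q.M_unique (e1 ▸ hM) hM').1
  by_cases e2 : b = a'
  · exact (Q.M_unique (e2 ▸ Q.M_symm hM) hM').1
  by_cases e3 : a = b'
  · exact (Q.M_unique (e3 ▸ hM) (Q.M_symm hM')).1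
  have n1 : G.pos a ≠ G.pos b := fun e => e1 (G.pos_inj hv e)
  have n2 : G.pos b ≠ G.pos a' := fun e => e2 (G.pos_inj (hv.symm.trans hva) e)
  have n3 : G.pos a ≠ G.pos b' := fun e => e3 (G.pos_inj (hv.trans hvb) e)
  rcases Nat.lt_or_ge (G.pos a) (G.pos b) with h5 | h5
  · refine absurd ?_ (Q.uncrossed hM hM')
    exact G.clockwise_of_pos_lt hv.symm hva.symm (hvb.symm.trans hv.symm) h5 (by omega) (by omega)
  · refine absurd ?_ (Q.uncrossed hM' hM)
    exact G.clockwise_of_pos_lt hv hvb.symm (hva.symm.trans hv) (by omega) (by omega) (by omega)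

/-- The nodes used for a demand. -/
def Passages.Used (Q : Passages G dem) (q T : ℕ) (slot : K → Bool → ℕ) (r : V → ℕ → ℕ) (h : K)
    (x : HatNode E T) : Prop :=
  Q.OnStrand q slot r h x.1 x.2 ∨ Q.OnBridge q r h x.1 x.2

theorem Passages.reach_strand {T : ℕ} {h : K} {a : E × Bool} (hr0 : ∀ v, r v 0 = 0)
    (hr1 : ∀ v l, r v (l + 1) = r v l ∨ r v (l + 1) = r v l + 1) {l : ℕ} (hl : l < T + 2)
    (hlive : Q.Live q slot h a l) :
    Relation.ReflTransGen ((G.hat T).StepIn (Q.Used q T slot r h)) (0, a)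
      (⟨l, hl⟩, (G.rot ^ r (G.vert a) l) a) := by
  induction l with
  | zero =>
    rw [hr0]
    exact .refl
  | succ l ih =>
    have hlive' := Passages.live_mono (Nat.le_succ l) hlive
    refine (ih (by omega) hlive').tail (stepIn_layer rfl ?_ (.inl ⟨a, hlive', rfl⟩)
      (.inl ⟨a, hlive, rfl⟩))
    rcases hr1 (G.vert a) l with e | e
    · exact .inl (by rw [e])
    · exact .inr (by rw [e, pow_succ', Equiv.Perm.mul_apply])

/-- Down the strand of `a`, along the bridge, and up the strand of `a'`. The distance is less than
q, so the bridge fits in the cylinder. -/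
theorem Passages.reach_partner {T : ℕ} {h : K} {a a' : E × Bool} (hr0 : ∀ v, r v 0 = 0)
    (hr1 : ∀ v l, r v (l + 1) = r v l ∨ r v (l + 1) = r v l + 1)
    (hr : ∀ v l, q * q ≤ l → r v l = r v (q * q))
    (hq : ∀ a : E × Bool, Function.minimalPeriod G.rot a ≤ q) (hT : q * q + 2 * q ≤ T + 1)
    (hM : Q.M h a a') (hlt : G.pos a < G.pos a') :
    Relation.ReflTransGen ((G.hat T).StepIn (Q.Used q T slot r h)) (0, a) (0, a') := by
  have hv := Q.M_vert hM
  have hpos := G.pos_lt a'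
  have hq' := hq (G.origin a')
  set x := G.pos a' - G.pos a with hx
  have hl : q * q + 2 * x < T + 2 := by omega
  have hl' : q * q + 2 * x + 1 < T + 2 := by omega
  have s1 := Passages.reach_strand (Q := Q) (q := q) (slot := slot) (T := T) hr0 hr1 hl
    (.inr ⟨a', hM, by omega⟩)
  have s2 := Passages.reach_strand (Q := Q) (q := q) (slot := slot) (T := T) hr0 hr1 hl
    (.inr ⟨a, Q.M_symm hM, by omega⟩)
  rw [hr _ _ (by omega)] at s1 s2
  -- There are no horizontal edges: a step to the next column goes down a diagonal edge and back up
  -- a vertical one.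
  have zig : ∀ u ≤ x, Relation.ReflTransGen ((G.hat T).StepIn (Q.Used q T slot r h))
      (⟨_, hl⟩, (G.rot ^ r (G.vert a) (q * q)) a)
      (⟨_, hl⟩, (G.rot ^ (r (G.vert a) (q * q) + u)) a) := by
    intro u
    induction u with
    | zero => intro _; exact .refl
    | succ u ih =>
      intro hu
      have m1 : Q.Used q T slot r h (⟨_, hl⟩, (G.rot ^ (r (G.vert a) (q * q) + u)) a) :=
        .inr ⟨a, a', u, hM, hlt, by omega, rfl, .inl rfl⟩
      have m2 : Q.Used q T slot r h (⟨_, hl'⟩, (G.rot ^ (r (G.vert a) (q * q) + (u + 1))) a) :=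
        .inr ⟨a, a', u + 1, hM, hlt, by omega, rfl, .inr ⟨rfl, by omega⟩⟩
      have m3 : Q.Used q T slot r h (⟨_, hl⟩, (G.rot ^ (r (G.vert a) (q * q) + (u + 1))) a) :=
        .inr ⟨a, a', u + 1, hM, hlt, by omega, rfl, .inl rfl⟩
      refine ((ih (by omega)).tail (stepIn_layer rfl (.inr ?_) m1 m2)).tail
        (StepIn.symm (stepIn_layer rfl (.inl rfl) m3 m2))
      rw [← add_assoc, pow_succ', Equiv.Perm.mul_apply]
  have z := zig x le_rfl
  rw [pow_add, Equiv.Perm.mul_apply, G.pow_sub_pos hv hlt.le] at z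
  rw [← hv] at s2
  exact s1.trans (z.trans (reflTransGen_stepIn_symm s2))

/-- The nodes used for a demand contain its terminals and connect them by following the trail over
strands, bridges and old edges; those used for different demands are disjoint. -/
theorem Passages.hasNodeDisjointPaths (Q : Passages G dem) {T : ℕ}
    (hq : ∀ a : E × Bool, Function.minimalPeriod G.rot a ≤ q) (hT : q * q + 2 * q ≤ T + 1)
    {base : K → Bool → E × Bool} (hbase : ∀ h b, G.vert (base h b) = endOf (dem h) b)
    (hslot : ∀ h b, slot h b < q)
    (hinj : ∀ h b h' b', endOf (dem h) b = endOf (dem h') b' → slot h b = slot h' b' →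
      h = h' ∧ b = b')
    {dem' : K → HatNode E T × HatNode E T}
    (h1 : ∀ h b, ((endOf (dem' h) b).1 : ℕ) = q * slot h b + (q - 1))
    (h2 : ∀ h b, (endOf (dem' h) b).2 = base h b) : (G.hat T).HasNodeDisjointPaths dem' := by
  rcases isEmpty_or_nonempty K with hK | ⟨⟨k⟩⟩
  · exact ⟨fun h => isEmptyElim h, fun h => isEmptyElim h, fun h => isEmptyElim h⟩
  have hq0 : 0 < q := (Nat.zero_le _).trans_lt (hslot k false)
  -- The goal of round j at v is that the end with slot j, if there is one, has its strand in the
  -- base column. Slots at v are distinct, so there is at most one such end, and a full turn of at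
  -- most q shifts meets the goal.
  have hsched := fun v => exists_schedule (q := q)
    (fun j ρ => ∀ h b, endOf (dem h) b = v → slot h b = j →
      (G.rot ^ ρ) (Q.tm h b) = base h b) hq0 (by
    intro j ρ
    by_cases hx : ∃ h b, endOf (dem h) b = v ∧ slot h b = j
    · obtain ⟨h, b, hv, hj⟩ := hx
      obtain ⟨t, ht, he⟩ := G.exists_pow_rot (a := (G.rot ^ ρ) (Q.tm h b)) (b := base h b)
        (by rw [G.vert_rot_pow, Q.vert_tm, hbase])
      refine ⟨t, ht.trans_le (hq _), fun h' b' hv' hj' => ?_⟩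
      obtain ⟨rfl, rfl⟩ := hinj h b h' b' (hv.trans hv'.symm) (hj.trans hj'.symm)
      rw [add_comm, pow_add, Equiv.Perm.mul_apply, he]
    · exact ⟨0, hq0, fun h b hv hj => absurd ⟨h, b, hv, hj⟩ hx⟩)
  choose r hr0 hr1 hr2 hr3 using hsched
  -- No end has a slot of q or more, so the later goals are vacuous and the rotation stops.
  have hr : ∀ v l, q * q ≤ l → r v l = r v (q * q) := by
    intro v l hl
    induction l, hl using Nat.le_induction with
    | base => rfl
    | succ l hl ih =>
      rw [hr3 v l, ih]
      intro h b _ hs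
      have := hslot h b
      have := (Nat.le_div_iff_mul_le hq0).2 hl
      omega
  have hend : ∀ h b, Q.Used q T slot r h (endOf (dem' h) b) ∧
      Relation.ReflTransGen ((G.hat T).StepIn (Q.Used q T slot r h)) (0, Q.tm h b)
        (endOf (dem' h) b) := by
    intro h b
    have hlive : Q.Live q slot h (Q.tm h b) ((endOf (dem' h) b).1 : ℕ) :=
      .inl ⟨b, rfl, (h1 h b).le⟩
    have hcol : (endOf (dem' h) b).2 =
        (G.rot ^ r (G.vert (Q.tm h b)) (endOf (dem' h) b).1) (Q.tm h b) := by
      rw [h2, h1]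
      exact (hr2 _ _ h b (Q.vert_tm h b).symm rfl).symm
    refine ⟨.inl ⟨_, hlive, hcol⟩, ?_⟩
    have := Passages.reach_strand (T := T) hr0 hr1 (endOf (dem' h) b).1.isLt hlive
    rw [← hcol] at this
    exact this
  have htop : ∀ h a, ((∃ b, a = Q.tm h b) ∨ ∃ c, Q.M h a c) → Q.Used q T slot r h (0, a) := by
    intro h a ha
    refine .inl ⟨a, ?_, ?_⟩
    · rcases ha with ⟨b, rfl⟩ | ⟨c, hc⟩
      · exact .inl ⟨b, rfl, by simp⟩
      · exact .inr ⟨c, hc, by simp⟩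
    · simp [hr0]
  refine hasNodeDisjointPaths_of_reachable dem' (Q.Used q T slot r) ?_
    (fun h => (hend h true).1) fun h => ?_
  · rintro h h' x (hx | hx) (hx' | hx')
    · exact Passages.onStrand_disjoint hx hx'
    · exact Passages.strand_bridge_disjoint hslot hr hx hx'
    · exact (Passages.strand_bridge_disjoint hslot hr hx' hx).symm
    · exact Passages.onBridge_disjoint hx hx'
  · refine (reflTransGen_stepIn_symm (hend h false).2).trans (.trans ?_ (hend h true).2)
    -- Each link of the trail is lifted to layer 0: traversing an edge to the old edge, passing
    -- through a vertex to `Passages.reach_partner`.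
    refine Relation.ReflTransGen.trans_induction_on
      (motive := fun {a b} _ => Relation.ReflTransGen ((G.hat T).StepIn (Q.Used q T slot r h))
        (0, a) (0, b)) (Q.connected h) (fun a => .refl) ?_ (fun _ _ => .trans)
    rintro a a' ⟨ha, ha', rfl | hM⟩
    · exact .single ⟨old a, rfl, rfl, htop h _ ha, htop h _ ha'⟩
    · rcases Nat.lt_trichotomy (G.pos a) (G.pos a') with hlt | heq | hlt
      · exact Passages.reach_partner hr0 hr1 hr hq hT hM hlt
      · exact absurd (G.pos_inj (Q.M_vert hM) heq) (Q.M_ne hM)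
      · exact reflTransGen_stepIn_symm
          (Passages.reach_partner hr0 hr1 hr hq hT (Q.M_symm hM) hlt)

end Route

/-- The expansion is a faithful reduction, whatever darts `base` and distinct slots are chosen for
the terminals at each vertex. -/
theorem hat_hasNodeDisjointPaths_iff [Finite E] (G : EmbeddedGraph V E) {dem : K → V × V}
    (hne : ∀ h, (dem h).1 ≠ (dem h).2) {q T : ℕ}
    (hq : ∀ a : E × Bool, Function.minimalPeriod G.rot a ≤ q) (hT : q * q + 2 * q ≤ T + 1)
    {base : K → Bool → E × Bool} (hbase : ∀ h b, G.vert (base h b) = endOf (dem h) b)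
    {slot : K → Bool → ℕ} (hslot : ∀ h b, slot h b < q)
    (hinj : ∀ h b h' b', endOf (dem h) b = endOf (dem h') b' → slot h b = slot h' b' →
      h = h' ∧ b = b')
    {dem' : K → HatNode E T × HatNode E T}
    (h1 : ∀ h b, ((endOf (dem' h) b).1 : ℕ) = q * slot h b + (q - 1))
    (h2 : ∀ h b, (endOf (dem' h) b).2 = base h b) :
    G.HasUncrossedTrailFlow dem ↔ (G.hat T).HasNodeDisjointPaths dem' := by
  constructor
  · intro H
    obtain ⟨Q⟩ := exists_passages hne H
    exact Q.hasNodeDisjointPaths hq hT hbase hslot hinj h1 h2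
  · refine hasUncrossedTrailFlow_of_hat (fun h => ?_) (fun h => ?_)
    · have := hbase h false
      rw [← h2] at this
      exact this
    · have := hbase h true
      rw [← h2] at this
      exact this

end EmbeddedGraph

/-! ### Loops of the machine and the tables they produce. -/

namespace RAM

open Function

/-- "For `reg 3 = 0, 1, …` while it is less than `N`, do `body`." -/
def forLoop (N : Expr) (body : Program) : Program :=
  .seq (.assign 3 (.const 0))
    (.loop (.sub N (.reg 3)) (.seq body (.assign 3 (.add (.reg 3) (.const 1)))))

/-- `σ i` is the state before pass i. A pass costs t steps for the body, one for the counter and one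
for the test; the initial assignment and the last test add two. -/
theorem runs_forLoop {N : Expr} {body : Program} {s : State} {n t : ℕ} (σ : ℕ → State)
    (h0 : s.setReg 3 0 = σ 0) (hx : ∀ i, (σ i).reg 3 = i) (hN : ∀ i ≤ n, N.eval (σ i) = n)
    (hb : ∀ i < n, ∃ s', Runs body (σ i) s' t ∧ s'.reg 3 = i ∧ s'.setReg 3 (i + 1) = σ (i + 1)) :
    Runs (forLoop N body) s (σ n) (n * (t + 2) + 2) := by
  have key : ∀ d i, i + d = n →
      Runs (.loop (.sub N (.reg 3)) (.seq body (.assign 3 (.add (.reg 3) (.const 1)))))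
        (σ i) (σ n) (d * (t + 2) + 1) := by
    intro d
    induction d with
    | zero =>
      intro i hi
      obtain rfl : i = n := hi
      rw [zero_mul, zero_add]
      exact Runs.loop_stop (by simp [Expr.eval, hN i le_rfl, hx])
    | succ d ih =>
      intro i hi
      obtain ⟨s', hr, hs', he⟩ := hb i (by omega)
      have h1 : Runs (.assign 3 (.add (.reg 3) (.const 1))) s' (σ (i + 1)) 1 := by
        have := Runs.assign 3 (.add (.reg 3) (.const 1)) s'
        simp only [Expr.eval, hs', he] at this
        exact this
      have h2 := Runs.loop_step (e := .sub N (.reg 3))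
        (by simp only [Expr.eval, hN i (by omega), hx]; omega) (hr.seq h1) (ih (i + 1) (by omega))
      have e1 : t + 1 + (d * (t + 2) + 1) + 1 = (d + 1) * (t + 2) + 1 := by ring
      rw [e1] at h2
      exact h2
  have h1 : Runs (.assign 3 (.const 0)) s (σ 0) 1 := by
    have := Runs.assign 3 (.const 0) s
    rwa [Expr.eval, h0] at this
  have h2 := h1.seq (key n 0 (by omega))
  have e1 : 1 + (n * (t + 2) + 1) = n * (t + 2) + 2 := by ring
  rw [e1] at h2
  exact h2

/-- An array after `n` assignments. -/
def table (t₀ : ℕ → ℕ) (idx : ℕ → ℕ) (val : ℕ → (ℕ → ℕ) → ℕ) : ℕ → ℕ → ℕ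
  | 0 => t₀
  | i + 1 => update (table t₀ idx val i) (idx i) (val i (table t₀ idx val i))

section Table

variable {t₀ : ℕ → ℕ} {idx : ℕ → ℕ} {val : ℕ → (ℕ → ℕ) → ℕ}

theorem table_succ (n x : ℕ) : table t₀ idx val (n + 1) x =
    if x = idx n then val n (table t₀ idx val n) else table t₀ idx val n x := by
  rw [table, update_apply]

theorem table_of_not_mem {n x : ℕ} (h : ∀ i < n, idx i ≠ x) : table t₀ idx val n x = t₀ x := by
  induction n with
  | zero => rfl
  | succ n ih =>
    rw [table_succ, if_neg (fun e => h n (by omega) e.symm), ih fun i hi => h i (by omega)]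

/-- An entry keeps the value from pass i provided that no later pass overwrites it; earlier
collisions are harmless. -/
theorem table_apply {n i : ℕ} (h : ∀ j < n, i < j → idx j ≠ idx i) (hi : i < n) :
    table t₀ idx val n (idx i) = val i (table t₀ idx val i) := by
  induction n with
  | zero => omega
  | succ n ih =>
    rw [table_succ]
    rcases Nat.lt_or_ge i n with h1 | h1
    · rw [if_neg (fun e => h n (by omega) h1 e.symm), ih (fun j hj => h j (by omega)) h1]
    · obtain rfl : i = n := by omega
      rw [if_pos rfl]

/-- The last index at which a value is taken. -/
theorem table_last (e : ℕ → ℕ) (n v : ℕ) (h0 : t₀ v = 0) :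
    (table t₀ e (fun i _ => i + 1) n v = 0 ∧ ∀ i < n, e i ≠ v) ∨
      ∃ i < n, e i = v ∧ table t₀ e (fun i _ => i + 1) n v = i + 1 := by
  induction n with
  | zero => exact .inl ⟨h0, fun i hi => by omega⟩
  | succ n ih =>
    rw [table_succ]
    by_cases hv : v = e n
    · exact .inr ⟨n, by omega, hv.symm, if_pos hv⟩
    · rw [if_neg hv]
      rcases ih with ⟨h1, h2⟩ | ⟨i, h1, h2, h3⟩
      · refine .inl ⟨h1, fun i hi he => ?_⟩
        rcases Nat.lt_or_ge i n with h | h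
        · exact h2 i h he
        · obtain rfl : i = n := by omega
          exact hv he.symm
      · exact .inr ⟨i, by omega, h2, h3⟩

/-- Counting how often every value is taken. -/
theorem table_count (e : ℕ → ℕ) (n v : ℕ) :
    table t₀ e (fun i t => t (e i) + 1) n v =
      t₀ v + ((Finset.range n).filter fun i => e i = v).card := by
  induction n with
  | zero => simp [table]
  | succ n ih =>
    rw [table_succ, Finset.range_add_one, Finset.filter_insert]
    by_cases hv : e n = v
    · subst hv
      rw [if_pos rfl, if_pos rfl, Finset.card_insert_of_notMem (by simp), ih, add_assoc]
    · rw [if_neg (Ne.symm hv), if_neg hv, ih]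

/-- The maximum of a sequence. -/
theorem table_max (f : ℕ → ℕ) (n : ℕ) :
    table t₀ (fun _ => 0) (fun i t => t 0 + (f i - t 0)) n 0 =
      (Finset.range n).sup f ⊔ t₀ 0 := by
  induction n with
  | zero => simp [table]
  | succ n ih =>
    rw [table_succ, if_pos rfl, ih, Finset.range_add_one, Finset.sup_insert]
    simp only [sup_assoc]
    omega

theorem table_sum (f : ℕ → ℕ) (n : ℕ) :
    table t₀ (fun _ => 0) (fun i t => t 0 + f i) n 0 = t₀ 0 + ∑ i ∈ Finset.range n, f i := by
  induction n with
  | zero => simp [table]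
  | succ n ih => rw [table_succ, if_pos rfl, ih, Finset.sum_range_succ, add_assoc]

/-- A table whose entries are computed from entries a fixed distance before. -/
theorem table_shift (c d n j : ℕ) (hc : 0 < c) (hj : j < n) :
    table t₀ (fun i => i + c) (fun i t => t i + d) n (j + c) =
      table t₀ (fun i => i + c) (fun i t => t i + d) n j + d := by
  have h1 := table_apply (t₀ := t₀) (idx := fun i => i + c) (val := fun i t => t i + d)
    (n := n) (i := j) (fun j' _ h e => by simp at e; omega) hj
  -- From pass j on only indices above j are written, so the entry read in pass j is already final.
  have h2 : ∀ k, table t₀ (fun i => i + c) (fun i t => t i + d) (j + k) j =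
      table t₀ (fun i => i + c) (fun i t => t i + d) j j := by
    intro k
    induction k with
    | zero => rfl
    | succ k ih => rw [← add_assoc, table_succ, if_neg (by omega), ih]
  have h3 := h2 (n - j)
  rw [Nat.add_sub_cancel' hj.le] at h3
  rw [h1, h3]

end Table

/-- "For `reg 3 = 0, 1, …` while it is less than `N`, store the value of `v` in `arr a i`." -/
def fill (N : Expr) (a : ℕ) (i v : Expr) : Program := forLoop N (.store a i v)

/-- The state in which the counter is `i` and the array `a` has been replaced by `t`. -/
def State.during (s : State) (a i : ℕ) (t : ℕ → ℕ) : State :=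
  ⟨update s.reg 3 i, update s.arr a t⟩

theorem runs_fill (idx : ℕ → ℕ) (val : ℕ → (ℕ → ℕ) → ℕ) {N : Expr} {a : ℕ} {ie ve : Expr}
    {s : State} {n : ℕ} (hN : ∀ i t, N.eval (s.during a i t) = n)
    (hi : ∀ i t, ie.eval (s.during a i t) = idx i)
    (hv : ∀ i t, ve.eval (s.during a i t) = val i t) :
    Runs (fill N a ie ve) s (s.during a n (table (s.arr a) idx val n)) (3 * n + 2) := by
  have := runs_forLoop (N := N) (body := .store a ie ve) (s := s) (n := n) (t := 1)
    (fun i => s.during a i (table (s.arr a) idx val i))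
    (by simp [State.setReg, State.during, table]) (by simp [State.during])
    (fun i _ => hN i _) (by
      intro i _
      refine ⟨_, .store a ie ve _, by simp [State.setArr, State.during], ?_⟩
      rw [hi, hv]
      simp [State.setArr, State.setReg, State.during, table])
  rwa [mul_comm] at this

/-- "For `reg 3 = 0, 1, …` while it is less than `N`, copy `arr b i` to `arr a (reg 3)` and
increase it." -/
def tally (N : Expr) (a b : ℕ) (i : Expr) : Program :=
  forLoop N (.seq (.store a (.reg 3) (.get b i)) (.store b i (.add (.get b i) (.const 1))))

/-- The state in which the counter is `i` and the arrays `a`, `b` have been replaced. -/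
def State.during₂ (s : State) (a b i : ℕ) (t u : ℕ → ℕ) : State :=
  ⟨update s.reg 3 i, update (update s.arr a t) b u⟩

theorem runs_tally (idx : ℕ → ℕ) {N : Expr} {a b : ℕ} {ie : Expr} {s : State} {n : ℕ}
    (hab : a ≠ b) (hN : ∀ i t u, N.eval (s.during₂ a b i t u) = n)
    (hi : ∀ i t u, ie.eval (s.during₂ a b i t u) = idx i) :
    Runs (tally N a b ie) s (s.during₂ a b n
      (table (s.arr a) id (fun i _ => table (s.arr b) idx (fun i t => t (idx i) + 1) i (idx i)) n)
      (table (s.arr b) idx (fun i t => t (idx i) + 1) n)) (4 * n + 2) := by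
  have := runs_forLoop (N := N) (s := s) (n := n) (t := 2)
    (body := .seq (.store a (.reg 3) (.get b ie)) (.store b ie (.add (.get b ie) (.const 1))))
    (fun i => s.during₂ a b i
      (table (s.arr a) id (fun i _ => table (s.arr b) idx (fun i t => t (idx i) + 1) i (idx i)) i)
      (table (s.arr b) idx (fun i t => t (idx i) + 1) i))
    (by
      simp only [State.setReg, State.during₂, table, update_eq_self]) (by simp [State.during₂])
    (fun i _ => hN i _ _) (by
      intro i _
      set t := table (s.arr a) id
        (fun i _ => table (s.arr b) idx (fun i t => t (idx i) + 1) i (idx i)) with ht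
      set u := table (s.arr b) idx (fun i t => t (idx i) + 1) with hu
      have h1 : (s.during₂ a b i (t i) (u i)).setArr a i (u i (idx i)) =
          s.during₂ a b i (t (i + 1)) (u i) := by
        simp only [State.setArr, State.during₂, State.mk.injEq, true_and]
        rw [update_comm hab]
        simp [ht, hu, table]
        rw [update_comm hab]
      refine ⟨s.during₂ a b i (t (i + 1)) (u (i + 1)), ?_, by simp [State.during₂],
        by simp [State.during₂, State.setReg]⟩
      have r1 := Runs.store a (.reg 3) (.get b ie) (s.during₂ a b i (t i) (u i))
      have e1 : (Expr.get b ie).eval (s.during₂ a b i (t i) (u i)) = u i (idx i) := by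
        rw [Expr.eval, hi]
        simp [State.during₂]
      have e2 : (Expr.reg 3).eval (s.during₂ a b i (t i) (u i)) = i := by
        simp [Expr.eval, State.during₂]
      rw [e1, e2, h1] at r1
      have r2 := Runs.store b ie (.add (.get b ie) (.const 1)) (s.during₂ a b i (t (i + 1)) (u i))
      have e3 : (Expr.add (.get b ie) (.const 1)).eval (s.during₂ a b i (t (i + 1)) (u i)) =
          u i (idx i) + 1 := by
        rw [Expr.eval, Expr.eval, Expr.eval, hi]
        simp [State.during₂]
      have h2 : (s.during₂ a b i (t (i + 1)) (u i)).setArr b (idx i) (u i (idx i) + 1) =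
          s.during₂ a b i (t (i + 1)) (u (i + 1)) := by
        simp [State.setArr, State.during₂, hu, table]
      rw [e3, hi, h2] at r2
      exact r1.seq r2)
  rwa [mul_comm] at this

end RAM

open RAM

/-! ### Numbering nodes and darts of the expansion. -/

namespace EmbeddedGraph

variable {m : ℕ}

/-- The darts numbered. -/
def dartNum (m : ℕ) : Fin m × Bool ≃ Fin (m * 2) :=
  ((Equiv.refl (Fin m)).prodCongr finTwoEquiv.symm).trans finProdFinEquiv

theorem dartNum_val (d : Fin m × Bool) : (dartNum m d : ℕ) = dartIndex d := by
  obtain ⟨e, b⟩ := d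
  cases b <;> simp [dartNum, dartIndex, finProdFinEquiv, finTwoEquiv, add_comm]

theorem dartIndex_lt (d : Fin m × Bool) : dartIndex d < 2 * m := by
  have := (dartNum m d).isLt
  rw [dartNum_val] at this
  omega

theorem dartIndex_injective : Function.Injective (dartIndex (m := m)) := fun d d' h => by
  rw [← dartNum_val, ← dartNum_val] at h
  exact (dartNum m).injective (Fin.ext h)

theorem exists_dartIndex {i : ℕ} (hi : i < 2 * m) : ∃ d : Fin m × Bool, dartIndex d = i := by
  refine ⟨(dartNum m).symm ⟨i, by omega⟩, ?_⟩
  rw [← dartNum_val, Equiv.apply_symm_apply]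

/-- The nodes of the expansion numbered. -/
def nodeNum (m T : ℕ) : HatNode (Fin m) T ≃ Fin ((T + 2) * (m * 2)) :=
  ((Equiv.refl (Fin (T + 2))).prodCongr (dartNum m)).trans finProdFinEquiv

theorem nodeNum_val {T : ℕ} (x : HatNode (Fin m) T) :
    (nodeNum m T x : ℕ) = x.1 * (2 * m) + dartIndex x.2 := by
  simp only [nodeNum, finProdFinEquiv, Equiv.trans_apply, Equiv.prodCongr_apply, Prod.map,
    Equiv.refl_apply, Equiv.coe_fn_mk, dartNum_val]
  ring

/-- The edges of the expansion numbered. -/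
def edgeNum (m T : ℕ) :
    HatEdge (Fin m) T ≃ Fin (m + ((T + 1) * (m * 2) + (T + 1) * (m * 2))) :=
  let e : Fin (T + 1) × (Fin m × Bool) ≃ Fin ((T + 1) * (m * 2)) :=
    ((Equiv.refl (Fin (T + 1))).prodCongr (dartNum m)).trans finProdFinEquiv
  ((Equiv.refl (Fin m)).sumCongr ((e.sumCongr e).trans finSumFinEquiv)).trans finSumFinEquiv

/-- The number of a dart of the expansion. -/
def hatIndex {T : ℕ} (d : HatEdge (Fin m) T × Bool) : ℕ :=
  dartIndex (dartEquiv (edgeNum m T) d)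

theorem hatIndex_old {T : ℕ} (d : Fin m × Bool) : hatIndex (old (T := T) d) = dartIndex d := by
  simp [hatIndex, dartIndex, dartEquiv, old, edgeNum]

theorem hatIndex_ver {T : ℕ} (l : Fin (T + 1)) (c : Fin m × Bool) (b : Bool) :
    hatIndex (ver l c b) = 2 * m + 2 * (l * (2 * m) + dartIndex c) + b.toNat := by
  simp only [hatIndex, dartIndex, dartEquiv, ver, edgeNum, Equiv.prodCongr_apply, Prod.map,
    Equiv.trans_apply, Equiv.sumCongr_apply, Sum.map_inr, Sum.map_inl, finSumFinEquiv_apply_right,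
    finSumFinEquiv_apply_left, Fin.val_natAdd, Fin.val_castAdd, finProdFinEquiv, Equiv.coe_fn_mk,
    Equiv.refl_apply, dartNum_val]
  ring

theorem hatIndex_diag {T : ℕ} (l : Fin (T + 1)) (c : Fin m × Bool) (b : Bool) :
    hatIndex (diag l c b) = 2 * m + 2 * (T * (2 * m) + 2 * m) + 2 * (l * (2 * m) + dartIndex c) +
      b.toNat := by
  simp only [hatIndex, dartIndex, dartEquiv, diag, edgeNum, Equiv.prodCongr_apply, Prod.map,
    Equiv.trans_apply, Equiv.sumCongr_apply, Sum.map_inr, finSumFinEquiv_apply_right,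
    Fin.val_natAdd, finProdFinEquiv, Equiv.coe_fn_mk, Equiv.refl_apply, dartNum_val]
  ring

end EmbeddedGraph

open EmbeddedGraph

/-- The expansion of the graph of an instance, with given terminals, as an instance. -/
def hatInstance (I : PlanarInstance) (T : ℕ) (dem : Fin I.k → HatNode (Fin I.m) T × HatNode (Fin I.m) T)
    (hne : ∀ h, (dem h).1 ≠ (dem h).2) : PlanarInstance where
  n := (T + 2) * (I.m * 2)
  m := I.m + ((T + 1) * (I.m * 2) + (T + 1) * (I.m * 2))
  k := I.k
  G := (I.G.hat T).relabel (nodeNum I.m T) (edgeNum I.m T)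
  planar := (I.planar.hat I.G T).relabel _ _
  H h := (nodeNum I.m T (dem h).1, nodeNum I.m T (dem h).2)
  H_ne h e := hne h ((nodeNum I.m T).injective e)

theorem holds_hatInstance (I : PlanarInstance) (T : ℕ)
    (dem : Fin I.k → HatNode (Fin I.m) T × HatNode (Fin I.m) T)
    (hne : ∀ h, (dem h).1 ≠ (dem h).2) (s : State)
    (h0 : s.reg 0 = T * (2 * I.m) + 2 * I.m + 2 * I.m)
    (h1 : s.reg 1 = I.m + 2 * (T * (2 * I.m) + 2 * I.m)) (h2 : s.reg 2 = I.k)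
    (ha0 : ∀ d : HatEdge (Fin I.m) T × Bool, s.arr 0 (hatIndex d) = nodeNum I.m T (I.G.hatVert T d))
    (ha1 : ∀ d : HatEdge (Fin I.m) T × Bool, s.arr 1 (hatIndex d) = hatIndex (I.G.hatNext T d))
    (ha2 : ∀ h : Fin I.k, s.arr 2 h = nodeNum I.m T (dem h).1)
    (ha3 : ∀ h : Fin I.k, s.arr 3 h = nodeNum I.m T (dem h).2) :
    s.Holds (hatInstance I T dem hne) := by
  refine ⟨?_, ?_, h2, ?_, ?_, ha2, ha3⟩
  · rw [h0]
    simp only [hatInstance]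
    ring
  · rw [h1]
    simp only [hatInstance]
    ring
  · have key : ∀ d : Fin (I.m + ((T + 1) * (I.m * 2) + (T + 1) * (I.m * 2))) × Bool,
        s.arr 0 (dartIndex d) = ((I.G.hat T).relabel (nodeNum I.m T) (edgeNum I.m T)).vert d := by
      intro d
      have := ha0 ((dartEquiv (edgeNum I.m T)).symm d)
      rw [hatIndex, Equiv.apply_symm_apply] at this
      exact this
    exact key
  · have key : ∀ d : Fin (I.m + ((T + 1) * (I.m * 2) + (T + 1) * (I.m * 2))) × Bool,
        s.arr 1 (dartIndex d) =
          dartIndex (((I.G.hat T).relabel (nodeNum I.m T) (edgeNum I.m T)).rot d) := by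
      intro d
      have := ha1 ((dartEquiv (edgeNum I.m T)).symm d)
      rw [hatIndex, Equiv.apply_symm_apply] at this
      exact this
    exact key

/-- What the arrays have to hold, in terms of numbers. -/
structure Filled (C R : ℕ) (A₀ A₁ S Z : ℕ → ℕ) : Prop where
  f0 : ∀ i < C, A₀ i = i
  f1 : ∀ j < R + C, A₀ (C + 2 * j) = j
  f2 : ∀ j < R + C, A₀ (C + 2 * j + 1) = j + C
  f3 : ∀ j < R + C, A₀ (C + 2 * (R + C) + 2 * j) = j
  f4 : ∀ j < R + C, A₀ (C + 2 * (R + C) + 2 * j + 1) = S j + C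
  g0 : ∀ i < C, A₁ i = C + 2 * (R + C) + 2 * i
  g1 : ∀ j < R + C, A₁ (C + 2 * (R + C) + 2 * j) = C + 2 * j
  g2 : ∀ j < R + C, A₁ (C + 2 * (R + C) + 2 * j + 1) = C + 2 * S j + 1
  g3 : ∀ i < C, A₁ (C + 2 * i) = i
  g4 : ∀ j < R, A₁ (C + 2 * (j + C)) = C + 2 * (R + C) + 2 * Z j + 1
  g5 : ∀ j < R, A₁ (C + 2 * j + 1) = C + 2 * (R + C) + 2 * (j + C)
  g6 : ∀ i < C, A₁ (C + 2 * (R + i) + 1) = C + 2 * (R + C) + 2 * Z (R + i) + 1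

/-! ### Array entries against the combinatorial definition. -/

section Filled

variable {m T : ℕ} {A₀ A₁ S Z : ℕ → ℕ} {V : Type*} {G : EmbeddedGraph V (Fin m)}

theorem index_lt (l : Fin (T + 1)) (c : Fin m × Bool) :
    l * (2 * m) + dartIndex c < T * (2 * m) + 2 * m := by
  have h1 := dartIndex_lt c
  have h2 := Nat.mul_le_mul_right (2 * m) (Nat.lt_succ_iff.1 l.isLt)
  omega

theorem index_lt' (l : Fin T) (c : Fin m × Bool) :
    l * (2 * m) + dartIndex c < T * (2 * m) := by
  have h1 := dartIndex_lt c
  have h2 := Nat.mul_le_mul_right (2 * m) (Nat.succ_le_of_lt l.isLt)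
  rw [Nat.succ_mul] at h2
  omega

theorem Filled.vert (h : Filled (2 * m) (T * (2 * m)) A₀ A₁ S Z)
    (hS : ∀ (l : Fin (T + 1)) d, S (l * (2 * m) + dartIndex d) = l * (2 * m) + dartIndex (G.rot d))
    (d : HatEdge (Fin m) T × Bool) : A₀ (hatIndex d) = nodeNum m T (G.hatVert T d) := by
  induction d using hatDart_cases with
  | ho d =>
    rw [hatIndex_old, hatVert_old, nodeNum_val, h.f0 _ (dartIndex_lt d)]
    simp
  | hv l c b =>
    have hl := index_lt l c
    rw [hatIndex_ver]
    cases b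
    · rw [hatVert_ver_false, nodeNum_val, Bool.toNat_false, add_zero, h.f1 _ hl]
      simp
    · rw [hatVert_ver_true, nodeNum_val, Bool.toNat_true, h.f2 _ hl]
      simp only [Fin.val_succ]
      ring
  | hd l c b =>
    have hl := index_lt l c
    rw [hatIndex_diag]
    cases b
    · rw [hatVert_diag_false, nodeNum_val, Bool.toNat_false, add_zero, h.f3 _ hl]
      simp
    · rw [hatVert_diag_true, nodeNum_val, Bool.toNat_true, h.f4 _ hl, hS]
      simp only [Fin.val_succ]
      ring

/-- The two darts of a vertical edge are each treated in two ways: the upper one according to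
whether the edge leaves layer 0, the lower one according to whether the edge enters the last layer.
`S` and `Z` are `rot` and its inverse, repeated in every layer. -/
theorem Filled.next (h : Filled (2 * m) (T * (2 * m)) A₀ A₁ S Z)
    (hS : ∀ (l : Fin (T + 1)) d, S (l * (2 * m) + dartIndex d) = l * (2 * m) + dartIndex (G.rot d))
    (hZ : ∀ (l : Fin (T + 1)) d,
      Z (l * (2 * m) + dartIndex d) = l * (2 * m) + dartIndex (G.rot.symm d))
    (d : HatEdge (Fin m) T × Bool) : A₁ (hatIndex d) = hatIndex (G.hatNext T d) := by
  induction d using hatDart_cases with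
  | ho d =>
    rw [hatIndex_old, hatNext_old, hatIndex_diag, h.g0 _ (dartIndex_lt d)]
    simp
  | hv l c b =>
    cases b
    · cases l using Fin.cases with
      | zero =>
        have := h.g3 _ (dartIndex_lt c)
        rw [hatNext_ver_false_zero, hatIndex_old, hatIndex_ver]
        simpa using this
      | succ k =>
        have h1 := h.g4 _ (index_lt' k c)
        have h2 := hZ k.castSucc c
        rw [Fin.val_castSucc] at h2
        rw [hatNext_ver_false_succ, hatIndex_diag, hatIndex_ver, Bool.toNat_true,
          Bool.toNat_false, Fin.val_castSucc, Fin.val_succ, add_zero, ← h2, ← h1]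
        congr 1
        ring
    · cases l using Fin.lastCases with
      | last =>
        have h1 := h.g6 _ (dartIndex_lt c)
        have h2 := hZ (Fin.last T) c
        rw [Fin.val_last] at h2
        rw [hatNext_ver_true_last, hatIndex_diag, hatIndex_ver, Bool.toNat_true, Fin.val_last,
          ← h2, ← h1]
      | cast k =>
        have h1 := h.g5 _ (index_lt' k c)
        rw [hatNext_ver_true_castSucc, hatIndex_diag, hatIndex_ver, Bool.toNat_true,
          Bool.toNat_false, Fin.val_castSucc, Fin.val_succ, h1]
        ring
  | hd l c b =>
    have hl := index_lt l c
    rw [hatIndex_diag]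
    cases b
    · rw [hatNext_diag_false, hatIndex_ver, Bool.toNat_false, add_zero, h.g1 _ hl, add_zero]
    · rw [hatNext_diag_true, hatIndex_ver, Bool.toNat_true, h.g2 _ hl, hS]

end Filled

/-! ### Computing the parameters. -/

namespace RAM

open Function EmbeddedGraph RAM.Expr

/-- `p` leads from `s` to `s'` within `b` steps. -/
def RunsIn (p : Program) (s s' : State) (b : ℕ) : Prop := ∃ t ≤ b, Runs p s s' t

theorem RunsIn.seq {p q : Program} {s s' s'' : State} {b c : ℕ} (h : RunsIn p s s' b)
    (h' : RunsIn q s' s'' c) : RunsIn (.seq p q) s s'' (b + c) := by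
  obtain ⟨t, ht, r⟩ := h
  obtain ⟨u, hu, r'⟩ := h'
  exact ⟨t + u, by omega, r.seq r'⟩

theorem assign_spec {x : ℕ} {e : Expr} {s : State} (v : ℕ) (hv : e.eval s = v) :
    ∃ s', RunsIn (.assign x e) s s' 1 ∧ (∀ y, s'.reg y = if y = x then v else s.reg y) ∧
      ∀ b, s'.arr b = s.arr b :=
  ⟨_, ⟨1, le_rfl, .assign x e s⟩, fun y => by simp [State.setReg, update_apply, hv],
    fun b => rfl⟩

theorem store_spec {a : ℕ} {i e : Expr} {s : State} (j v : ℕ) (hj : i.eval s = j)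
    (hv : e.eval s = v) :
    ∃ s', RunsIn (.store a i e) s s' 1 ∧ (∀ y, s'.reg y = s.reg y) ∧
      ∀ b, s'.arr b = if b = a then update (s.arr a) j v else s.arr b :=
  ⟨_, ⟨1, le_rfl, .store a i e s⟩, fun y => rfl,
    fun b => by simp [State.setArr, update_apply, hj, hv]⟩

/-- One bound `4 * B + 2` serves every loop, so that running times add up as multiples of it. -/
theorem fill_spec {N : Expr} {a : ℕ} {ie ve : Expr} {s : State} {B : ℕ} (n : ℕ) (t₀ : ℕ → ℕ)
    (idx : ℕ → ℕ) (val : ℕ → (ℕ → ℕ) → ℕ) (hB : n ≤ B) (ha : s.arr a = t₀)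
    (hN : ∀ i t, N.eval (s.during a i t) = n) (hi : ∀ i t, ie.eval (s.during a i t) = idx i)
    (hv : ∀ i t, ve.eval (s.during a i t) = val i t) :
    ∃ s', RunsIn (fill N a ie ve) s s' (4 * B + 2) ∧
      (∀ y, s'.reg y = if y = 3 then n else s.reg y) ∧
      ∀ b, s'.arr b = if b = a then table t₀ idx val n else s.arr b := by
  refine ⟨_, ⟨_, ?_, runs_fill idx val hN hi hv⟩, fun y => ?_, fun b => ?_⟩
  · omega
  · simp [State.during, update_apply]
  · simp [State.during, update_apply, ha]

theorem tally_spec {N : Expr} {a b : ℕ} {ie : Expr} {s : State} {B : ℕ} (n : ℕ) (t₀ u₀ : ℕ → ℕ)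
    (idx : ℕ → ℕ) (hab : a ≠ b) (hB : n ≤ B) (ha : s.arr a = t₀) (hb : s.arr b = u₀)
    (hN : ∀ i t u, N.eval (s.during₂ a b i t u) = n)
    (hi : ∀ i t u, ie.eval (s.during₂ a b i t u) = idx i) :
    ∃ s', RunsIn (tally N a b ie) s s' (4 * B + 2) ∧
      (∀ y, s'.reg y = if y = 3 then n else s.reg y) ∧
      ∀ c, s'.arr c = if c = b then table u₀ idx (fun i t => t (idx i) + 1) n else if c = a then
        table t₀ id (fun i _ => table u₀ idx (fun i t => t (idx i) + 1) i (idx i)) n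
        else s.arr c := by
  refine ⟨_, ⟨_, ?_, runs_tally idx hab hN hi⟩, fun y => ?_, fun c => ?_⟩
  · omega
  · simp [State.during₂, update_apply]
  · simp [State.during₂, update_apply, ha, hb]

/-- The entry `0` of an array. -/
abbrev Expr.get0 (a : ℕ) : Expr := .get a (.const 0)

/-- The counter of the loops. -/
abbrev Expr.cnt : Expr := .reg 3



/-- The part of the program that computes the numbers of columns and layers. -/
def paramProgram : Program :=
  -- With C = 2m: registers 4 to 9 receive C, q, T + 1, (T + 1)C, TC and qC. Arrays 4 and 5 receive
  -- the rotation and its inverse, array 6 one plus a dart at each vertex (0 if there is none),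
  -- array 7 the degrees.
  .seq (.assign 4 (.add (.reg 1) (.reg 1))) <|
  .seq (fill (.reg 4) 4 cnt (.get 1 cnt)) <|
  .seq (fill (.reg 4) 5 (.get 1 cnt) cnt) <|
  .seq (fill (.reg 4) 6 (.get 0 cnt) (.add cnt (.const 1))) <|
  .seq (fill (.reg 4) 7 (.get 0 cnt) (.add (.get 7 (.get 0 cnt)) (.const 1))) <|
  -- The maximum starts at 1; adding a truncated difference then computes max(1, Δ).
  .seq (.store 8 (.const 0) (.const 1)) <|
  .seq (fill (.reg 0) 8 (.const 0) (.add (get0 8) (.sub (.get 7 cnt) (get0 8)))) <|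
  .seq (.assign 5 (get0 8)) <|
  .seq (fill (.reg 5) 9 (.const 0) (.add (get0 9) (.reg 5))) <|
  .seq (.assign 6 (.add (get0 9) (.add (.reg 5) (.reg 5)))) <|
  .seq (fill (.reg 6) 10 (.const 0) (.add (get0 10) (.reg 4))) <|
  .seq (.assign 7 (get0 10)) <|
  .seq (.assign 8 (.sub (.reg 7) (.reg 4))) <|
  .seq (fill (.reg 5) 11 (.const 0) (.add (get0 11) (.reg 4)))
  (.assign 9 (get0 11))

/-- The part of the program that assigns slots to the ends of the demands, and finds out whether
there are too many of them. -/
def slotProgram : Program :=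
  -- The counters in array 13 carry over from the first ends to the second ones, so all ends at a
  -- vertex get distinct slots.
  .seq (tally (.reg 2) 12 13 (.get 2 cnt)) <|
  .seq (tally (.reg 2) 14 13 (.get 3 cnt)) <|
  .seq (fill (.reg 5) 15 (.add cnt (.const 1)) (.add (.get 15 cnt) (.reg 9)))
  -- Each summand is positive exactly for an obstacle: an end without a dart, or a slot of at least
  -- q.
  (fill (.reg 2) 16 (.const 0) (.add (get0 16)
    (.add (.add (.sub (.const 1) (.get 6 (.get 2 cnt))) (.sub (.const 1) (.get 6 (.get 3 cnt))))
      (.add (.sub (.add (.get 12 cnt) (.const 1)) (.reg 5))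
        (.sub (.add (.get 14 cnt) (.const 1)) (.reg 5))))))

/-- What the first part of the program achieves. -/
structure Params (I : PlanarInstance) (q : ℕ) (s₀ s : State) : Prop where
  r0 : s.reg 0 = I.n
  r1 : s.reg 1 = I.m
  r2 : s.reg 2 = I.k
  r4 : s.reg 4 = 2 * I.m
  r5 : s.reg 5 = q
  r7 : s.reg 7 = (q * q + 2 * q) * (2 * I.m)
  r8 : s.reg 8 = (q * q + 2 * q) * (2 * I.m) - 2 * I.m
  r9 : s.reg 9 = q * (2 * I.m)
  a4 : ∀ d, s.arr 4 (dartIndex d) = dartIndex (I.G.rot d)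
  a5 : ∀ d, s.arr 5 (dartIndex d) = dartIndex (I.G.rot.symm d)
  a6 : ∀ v : Fin I.n, (s.arr 6 v = 0 ∧ ∀ d, I.G.vert d ≠ v) ∨
    ∃ d, I.G.vert d = v ∧ s.arr 6 v = dartIndex d + 1
  frame : ∀ a, (a < 4 ∨ 12 ≤ a) → s.arr a = s₀.arr a

theorem degree_eq_card (I : PlanarInstance) {s : State} (hs : s.Holds I) (v : Fin I.n) :
    I.G.degree v = ((Finset.range (2 * I.m)).filter fun i => s.arr 0 i = v).card := by
  rw [degree, ← Set.ncard_image_of_injective _ dartIndex_injective, ← Set.ncard_coe_finset]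
  congr 1
  ext i
  simp only [Set.mem_image, Set.mem_ofPred_eq, Finset.coe_filter, Finset.mem_range]
  constructor
  · rintro ⟨d, rfl, rfl⟩
    exact ⟨dartIndex_lt d, hs.2.2.2.1 d⟩
  · rintro ⟨hi, hv⟩
    obtain ⟨d, rfl⟩ := exists_dartIndex hi
    rw [hs.2.2.2.1] at hv
    exact ⟨d, Fin.ext hv, rfl⟩

theorem params_spec (I : PlanarInstance) {s : State} (hs : s.IsInitial I) {B q : ℕ}
    (hq : q = max 1 I.G.maxDegree) (hB₁ : 2 * I.m ≤ B) (hB₂ : I.n ≤ B)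
    (hB₃ : q * q + 2 * q ≤ B) :
    ∃ s', RunsIn paramProgram s s' (15 * (4 * B + 2)) ∧ Params I q s s' := by
  have hqB : q ≤ B := by nlinarith
  have hz : ∀ a, 4 ≤ a → ∀ i, s.arr a i = 0 := fun a ha i => hs.2.2 a i (by omega) (by omega)
  have hv := hs.1.2.2.2.1
  have hrot := hs.1.2.2.2.2.1
  have i0 : s.reg 0 = I.n := hs.1.1
  have i1 : s.reg 1 = I.m := hs.1.2.1
  have i2 : s.reg 2 = I.k := hs.1.2.2.1
  obtain ⟨s1, R1, g1, b1⟩ := assign_spec (x := 4) (e := .add (.reg 1) (.reg 1)) (s := s)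
    (2 * I.m) (by simp only [Expr.eval, i1]; ring)
  obtain ⟨s2, R2, g2, b2⟩ := fill_spec (N := .reg 4) (a := 4) (ie := cnt) (ve := .get 1 cnt)
    (s := s1) (B := B) (2 * I.m) (s.arr 4) id (fun i _ => s.arr 1 i) hB₁ (by simp [b1])
    (by simp [Expr.eval, State.during, g1]) (by simp [Expr.eval, State.during])
    (by simp [Expr.eval, State.during, b1])
  obtain ⟨s3, R3, g3, b3⟩ := fill_spec (N := .reg 4) (a := 5) (ie := .get 1 cnt) (ve := cnt)
    (s := s2) (B := B) (2 * I.m) (s.arr 5) (s.arr 1) (fun i _ => i) hB₁ (by simp [b1, b2])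
    (by simp [Expr.eval, State.during, g1, g2]) (by simp [Expr.eval, State.during, b1, b2])
    (by simp [Expr.eval, State.during])
  obtain ⟨s4, R4, g4, b4⟩ := fill_spec (N := .reg 4) (a := 6) (ie := .get 0 cnt)
    (ve := .add cnt (.const 1)) (s := s3) (B := B) (2 * I.m) (s.arr 6) (s.arr 0)
    (fun i _ => i + 1) hB₁ (by simp [b1, b2, b3]) (by simp [Expr.eval, State.during, g1, g2, g3])
    (by simp [Expr.eval, State.during, b1, b2, b3]) (by simp [Expr.eval, State.during])
  obtain ⟨s5, R5, g5, b5⟩ := fill_spec (N := .reg 4) (a := 7) (ie := .get 0 cnt)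
    (ve := .add (.get 7 (.get 0 cnt)) (.const 1)) (s := s4) (B := B) (2 * I.m) (s.arr 7) (s.arr 0)
    (fun i t => t (s.arr 0 i) + 1) hB₁ (by simp [b1, b2, b3, b4])
    (by simp [Expr.eval, State.during, g1, g2, g3, g4])
    (by simp [Expr.eval, State.during, b1, b2, b3, b4])
    (by simp [Expr.eval, State.during, b1, b2, b3, b4])
  obtain ⟨s6, R6, g6, b6⟩ := store_spec (a := 8) (i := .const 0) (e := .const 1) (s := s5) 0 1
    rfl rfl
  set f : ℕ → ℕ := fun v => ((Finset.range (2 * I.m)).filter fun i => s.arr 0 i = v).card with hf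
  have h7 : s6.arr 7 = f := by
    funext v
    rw [b6, if_neg (by omega), b5, if_pos rfl, table_count, hz 7 (by omega), zero_add]
  obtain ⟨s7, R7, g7, b7⟩ := fill_spec (N := .reg 0) (a := 8) (ie := .const 0)
    (ve := .add (get0 8) (.sub (.get 7 cnt) (get0 8))) (s := s6) (B := B) I.n (s6.arr 8)
    (fun _ => 0) (fun i t => t 0 + (f i - t 0)) hB₂ rfl
    (by simp [Expr.eval, State.during, g1, g2, g3, g4, g5, g6, i0]) (by simp [Expr.eval])
    (by simp [Expr.eval, State.during, h7])
  have h8 : s7.arr 8 0 = q := by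
    have h61 : s6.arr 8 0 = 1 := by simp [b6]
    rw [b7, if_pos rfl, table_max, h61, hq, sup_comm]
    congr 1
    refine le_antisymm (Finset.sup_le fun v hv => ?_) (Finset.sup_le fun v _ => ?_)
    · rw [Finset.mem_range] at hv
      have := degree_eq_card I hs.1 ⟨v, hv⟩
      rw [hf]
      simp only
      rw [← this]
      exact Finset.le_sup (f := I.G.degree) (Finset.mem_univ _)
    · rw [degree_eq_card I hs.1 v]
      exact Finset.le_sup (f := f) (Finset.mem_range.2 v.isLt)
  obtain ⟨s8, R8, g8, b8⟩ := assign_spec (x := 5) (e := get0 8) (s := s7) q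
    (by simp [Expr.eval, h8])
  obtain ⟨s9, R9, g9, b9⟩ := fill_spec (N := .reg 5) (a := 9) (ie := .const 0)
    (ve := .add (get0 9) (.reg 5)) (s := s8) (B := B) q (s.arr 9) (fun _ => 0)
    (fun _ t => t 0 + q) hqB (by simp [b1, b2, b3, b4, b5, b6, b7, b8])
    (by simp [Expr.eval, State.during, g8]) (by simp [Expr.eval])
    (by simp [Expr.eval, State.during, g8])
  have h9 : s9.arr 9 0 = q * q := by
    rw [b9, if_pos rfl, table_sum, hz 9 (by omega)]
    simp
  obtain ⟨s10, R10, g10, b10⟩ := assign_spec (x := 6)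
    (e := .add (get0 9) (.add (.reg 5) (.reg 5))) (s := s9) (q * q + 2 * q)
    (by simp only [Expr.eval, h9, g9, g8]; simp; ring)
  obtain ⟨s11, R11, g11, b11⟩ := fill_spec (N := .reg 6) (a := 10) (ie := .const 0)
    (ve := .add (get0 10) (.reg 4)) (s := s10) (B := B) (q * q + 2 * q) (s.arr 10) (fun _ => 0)
    (fun _ t => t 0 + 2 * I.m) hB₃ (by simp [b1, b2, b3, b4, b5, b6, b7, b8, b9, b10])
    (by simp [Expr.eval, State.during, g10]) (by simp [Expr.eval])
    (by simp [Expr.eval, State.during, g1, g2, g3, g4, g5, g6, g7, g8, g9, g10])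
  have h11 : s11.arr 10 0 = (q * q + 2 * q) * (2 * I.m) := by
    rw [b11, if_pos rfl, table_sum, hz 10 (by omega)]
    simp
  obtain ⟨s12, R12, g12, b12⟩ := assign_spec (x := 7) (e := get0 10) (s := s11)
    ((q * q + 2 * q) * (2 * I.m)) (by simp [Expr.eval, h11])
  obtain ⟨s13, R13, g13, b13⟩ := assign_spec (x := 8) (e := .sub (.reg 7) (.reg 4)) (s := s12)
    ((q * q + 2 * q) * (2 * I.m) - 2 * I.m)
    (by simp [Expr.eval, g1, g2, g3, g4, g5, g6, g7, g8, g9, g10, g11, g12])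
  obtain ⟨s14, R14, g14, b14⟩ := fill_spec (N := .reg 5) (a := 11) (ie := .const 0)
    (ve := .add (get0 11) (.reg 4)) (s := s13) (B := B) q (s.arr 11) (fun _ => 0)
    (fun _ t => t 0 + 2 * I.m) hqB
    (by simp [b1, b2, b3, b4, b5, b6, b7, b8, b9, b10, b11, b12, b13])
    (by simp [Expr.eval, State.during, g8, g9, g10, g11, g12, g13]) (by simp [Expr.eval])
    (by simp [Expr.eval, State.during, g1, g2, g3, g4, g5, g6, g7, g8, g9, g10, g11, g12, g13])
  have h14 : s14.arr 11 0 = q * (2 * I.m) := by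
    rw [b14, if_pos rfl, table_sum, hz 11 (by omega)]
    simp
  obtain ⟨s15, R15, g15, b15⟩ := assign_spec (x := 9) (e := get0 11) (s := s14)
    (q * (2 * I.m)) (by simp [Expr.eval, h14])
  have run := R1.seq (R2.seq (R3.seq (R4.seq (R5.seq (R6.seq (R7.seq (R8.seq (R9.seq (R10.seq
    (R11.seq (R12.seq (R13.seq (R14.seq R15)))))))))))))
  obtain ⟨t, ht, run⟩ := run
  refine ⟨s15, ⟨t, by omega, run⟩, ?_⟩
  have A : ∀ a, a < 8 → s15.arr a = s6.arr a := by
    intro a ha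
    rw [b15, b14, if_neg (by omega), b13, b12, b11, if_neg (by omega), b10, b9, if_neg (by omega),
      b8, b7, if_neg (by omega)]
  constructor
  · simp [g1, g2, g3, g4, g5, g6, g7, g8, g9, g10, g11, g12, g13, g14, g15, i0]
  · simp [g1, g2, g3, g4, g5, g6, g7, g8, g9, g10, g11, g12, g13, g14, g15, i1]
  · simp [g1, g2, g3, g4, g5, g6, g7, g8, g9, g10, g11, g12, g13, g14, g15, i2]
  · simp [g1, g2, g3, g4, g5, g6, g7, g8, g9, g10, g11, g12, g13, g14, g15]
  · simp [g8, g9, g10, g11, g12, g13, g14, g15]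
  · simp [g12, g13, g14, g15]
  · simp [g13, g14, g15]
  · simp [g15]
  · intro d
    have e : s15.arr 4 = table (s.arr 4) id (fun i _ => s.arr 1 i) (2 * I.m) := by
      rw [A 4 (by omega)]
      simp [b6, b5, b4, b3, b2]
    rw [e]
    have := table_apply (t₀ := s.arr 4) (idx := id) (val := fun i _ => s.arr 1 i)
      (n := 2 * I.m) (i := dartIndex d) (fun j _ h e => by simp at e; omega) (dartIndex_lt d)
    exact this.trans (hrot d)
  · intro d
    have e : s15.arr 5 = table (s.arr 5) (s.arr 1) (fun i _ => i) (2 * I.m) := by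
      rw [A 5 (by omega)]
      simp [b6, b5, b4, b3]
    rw [e]
    -- Writing i at place `rot i` inverts the permutation; injectivity ensures that no entry is
    -- overwritten.
    have := table_apply (t₀ := s.arr 5) (idx := s.arr 1) (val := fun i _ => i)
      (n := 2 * I.m) (i := dartIndex (I.G.rot.symm d)) (fun j hj h e => by
        obtain ⟨d', rfl⟩ := exists_dartIndex hj
        rw [hrot, hrot] at e
        have := I.G.rot.injective (dartIndex_injective e)
        rw [this] at h
        omega) (dartIndex_lt _)
    rwa [hrot, Equiv.apply_symm_apply] at this
  · intro v
    have e : s15.arr 6 = table (s.arr 6) (s.arr 0) (fun i _ => i + 1) (2 * I.m) := by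
      rw [A 6 (by omega)]
      simp [b6, b5, b4]
    rw [e]
    rcases table_last (s.arr 0) (2 * I.m) v (hz 6 (by omega) v) with ⟨h1, h2⟩ | ⟨i, h1, h2, h3⟩
    · refine .inl ⟨h1, fun d hd => h2 _ (dartIndex_lt d) ?_⟩
      rw [hv, hd]
    · obtain ⟨d, rfl⟩ := exists_dartIndex h1
      rw [hv] at h2
      exact .inr ⟨d, Fin.ext h2, h3⟩
  · intro a ha
    rw [b15, b14, if_neg (by omega), b13, b12, b11, if_neg (by omega), b10, b9, if_neg (by omega),
      b8, b7, if_neg (by omega), b6, if_neg (by omega), b5, if_neg (by omega), b4,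
      if_neg (by omega), b3, if_neg (by omega), b2, if_neg (by omega), b1]

end RAM

/-! ### Assigning slots to the demand ends. -/

namespace RAM

open Function EmbeddedGraph RAM.Expr

/-- How many of the first `n` values of `e` are equal to `v`. -/
def countBefore (e : ℕ → ℕ) (n v : ℕ) : ℕ := ((Finset.range n).filter fun i => e i = v).card

theorem countBefore_lt {e : ℕ → ℕ} {i n : ℕ} (h : i < n) :
    countBefore e i (e i) < countBefore e n (e i) := by
  refine Finset.card_lt_card (Finset.ssubset_iff_of_subset ?_ |>.2 ⟨i, ?_, ?_⟩)
  · intro j hj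
    simp only [Finset.mem_filter, Finset.mem_range] at hj ⊢
    exact ⟨by omega, hj.2⟩
  · simp [h]
  · simp

/-- The count of a value grows strictly with each occurrence, so occurrences are told apart by the
count before them. -/
theorem countBefore_inj {e : ℕ → ℕ} {i j : ℕ} (h : e i = e j)
    (hc : countBefore e i (e i) = countBefore e j (e j)) : i = j := by
  rcases Nat.lt_trichotomy i j with hlt | heq | hlt
  · have := countBefore_lt (e := e) hlt
    rw [hc, ← h] at this
    exact absurd this (lt_irrefl _)
  · exact heq
  · have := countBefore_lt (e := e) hlt
    rw [← hc, h] at this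
    exact absurd this (lt_irrefl _)

theorem countBefore_eq_sum (e : ℕ → ℕ) (n v : ℕ) :
    countBefore e n v = ∑ i : Fin n, if e i = v then 1 else 0 := by
  rw [countBefore, Finset.card_filter, Finset.sum_range]

/-- The ends of demands at a vertex. -/
theorem countBefore_add (I : PlanarInstance) {s : State} (hs : s.Holds I) (v : Fin I.n) :
    countBefore (s.arr 2) I.k v + countBefore (s.arr 3) I.k v =
      {p : Fin I.k × Bool | endOf (I.H p.1) p.2 = v}.ncard := by
  classical
  have h1 : {p : Fin I.k × Bool | endOf (I.H p.1) p.2 = v} =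
      ((Finset.univ.filter fun p : Fin I.k × Bool => endOf (I.H p.1) p.2 = v :
        Finset (Fin I.k × Bool)) : Set _) := by
    ext p
    simp
  rw [h1, Set.ncard_coe_finset, Finset.card_filter, Fintype.sum_prod_type,
    countBefore_eq_sum, countBefore_eq_sum, ← Finset.sum_add_distrib]
  refine Finset.sum_congr rfl fun h _ => ?_
  rw [Fintype.sum_bool, hs.2.2.2.2.2.1, hs.2.2.2.2.2.2, add_comm]
  simp only [endOf, cond_true, cond_false, Fin.ext_iff]

/-- What the second part of the program achieves. -/
structure Slots (I : PlanarInstance) (q : ℕ) (s₁ s : State) : Prop where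
  reg : ∀ x, x ≠ 3 → s.reg x = s₁.reg x
  arr : ∀ a, a < 12 → s.arr a = s₁.arr a
  a15 : ∀ j ≤ q, s.arr 15 j = j * (q * (2 * I.m))
  inj : ∀ (h : Fin I.k) b (h' : Fin I.k) b', endOf (I.H h) b = endOf (I.H h') b' →
    s.arr (cond b 14 12) h = s.arr (cond b' 14 12) h' → h = h' ∧ b = b'
  lt : ∀ (h : Fin I.k) b, s.arr (cond b 14 12) h <
    {p : Fin I.k × Bool | endOf (I.H p.1) p.2 = endOf (I.H h) b}.ncard
  a16 : s.arr 16 0 = 0 ↔ ∀ (h : Fin I.k) b,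
    s.arr 6 (endOf (I.H h) b : Fin I.n) ≠ 0 ∧ s.arr (cond b 14 12) h < q

theorem slots_spec (I : PlanarInstance) {s₀ s : State} (hs : s₀.IsInitial I) {B q : ℕ}
    (hp : Params I q s₀ s) (hB₁ : I.k ≤ B) (hB₂ : q ≤ B) :
    ∃ s', RunsIn slotProgram s s' (4 * (4 * B + 2)) ∧ Slots I q s s' := by
  have hz : ∀ a, 12 ≤ a → ∀ i, s.arr a i = 0 := fun a ha i => by
    rw [hp.frame a (by omega)]
    exact hs.2.2 a i (by omega) (by omega)
  have e2 : s.arr 2 = s₀.arr 2 := hp.frame 2 (by omega)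
  have e3 : s.arr 3 = s₀.arr 3 := hp.frame 3 (by omega)
  obtain ⟨s1, R1, g1, b1⟩ := tally_spec (N := .reg 2) (a := 12) (b := 13) (ie := .get 2 cnt)
    (s := s) (B := B) I.k (s.arr 12) (s.arr 13) (s.arr 2) (by omega) hB₁ rfl rfl
    (by simp [Expr.eval, State.during₂, hp.r2]) (by simp [Expr.eval, State.during₂])
  obtain ⟨s2, R2, g2, b2⟩ := tally_spec (N := .reg 2) (a := 14) (b := 13) (ie := .get 3 cnt)
    (s := s1) (B := B) I.k (s.arr 14) (s1.arr 13) (s.arr 3) (by omega) hB₁ (by simp [b1]) rfl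
    (by simp [Expr.eval, State.during₂, g1, hp.r2]) (by simp [Expr.eval, State.during₂, b1])
  obtain ⟨s3, R3, g3, b3⟩ := fill_spec (N := .reg 5) (a := 15) (ie := .add cnt (.const 1))
    (ve := .add (.get 15 cnt) (.reg 9)) (s := s2) (B := B) q (s.arr 15) (fun i => i + 1)
    (fun i t => t i + q * (2 * I.m)) hB₂ (by simp [b1, b2])
    (by simp [Expr.eval, State.during, g1, g2, hp.r5]) (by simp [Expr.eval, State.during])
    (by simp [Expr.eval, State.during, g1, g2, hp.r9])
  set A := s3.arr 12 with hA
  set A' := s3.arr 14 with hA'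
  set f : ℕ → ℕ := fun i => ((1 - s.arr 6 (s.arr 2 i)) + (1 - s.arr 6 (s.arr 3 i))) +
    ((A i + 1 - q) + (A' i + 1 - q)) with hf
  obtain ⟨s4, R4, g4, b4⟩ := fill_spec (N := .reg 2) (a := 16) (ie := .const 0)
    (ve := .add (get0 16) (.add (.add (.sub (.const 1) (.get 6 (.get 2 cnt)))
      (.sub (.const 1) (.get 6 (.get 3 cnt)))) (.add (.sub (.add (.get 12 cnt) (.const 1)) (.reg 5))
        (.sub (.add (.get 14 cnt) (.const 1)) (.reg 5))))) (s := s3) (B := B) I.k (s.arr 16)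
    (fun _ => 0) (fun i t => t 0 + f i) hB₁ (by simp [b1, b2, b3])
    (by simp [Expr.eval, State.during, g1, g2, g3, hp.r2]) (by simp [Expr.eval])
    (by
      intro i t
      have h6 : s3.arr 6 = s.arr 6 := by simp [b1, b2, b3]
      have h2 : s3.arr 2 = s.arr 2 := by simp [b1, b2, b3]
      have h3 : s3.arr 3 = s.arr 3 := by simp [b1, b2, b3]
      have h5 : s3.reg 5 = q := by simp [g1, g2, g3, hp.r5]
      simp [Expr.eval, State.during, h6, h2, h3, h5, hf, A, A'])
  obtain ⟨t, ht, run⟩ := R1.seq (R2.seq (R3.seq R4))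
  have hAv : ∀ i < I.k, A i = countBefore (s.arr 2) i (s.arr 2 i) := by
    intro i hi
    have e : A = table (s.arr 12) id
        (fun i _ => table (s.arr 13) (s.arr 2) (fun i t => t (s.arr 2 i) + 1) i (s.arr 2 i)) I.k := by
      simp [hA, b3, b2, b1]
    rw [e]
    refine (table_apply (idx := id) (fun j _ h e => by simp at e; omega) hi).trans ?_
    rw [table_count, hz 13 (by omega), zero_add]
    rfl
  have hAv' : ∀ i < I.k, A' i =
      countBefore (s.arr 2) I.k (s.arr 3 i) + countBefore (s.arr 3) i (s.arr 3 i) := by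
    intro i hi
    have e : A' = table (s.arr 14) id
        (fun i _ => table (s1.arr 13) (s.arr 3) (fun i t => t (s.arr 3 i) + 1) i (s.arr 3 i)) I.k := by
      simp [hA', b3, b2]
    rw [e]
    refine (table_apply (idx := id) (fun j _ h e => by simp at e; omega) hi).trans ?_
    have h13 : s1.arr 13 (s.arr 3 i) = countBefore (s.arr 2) I.k (s.arr 3 i) := by
      rw [b1, if_pos rfl, table_count, hz 13 (by omega), zero_add]
      rfl
    rw [table_count, h13]
    rfl
  have hends : ∀ h : Fin I.k, s.arr 2 h = (endOf (I.H h) false : Fin I.n) ∧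
      s.arr 3 h = (endOf (I.H h) true : Fin I.n) := by
    intro h
    rw [e2, e3, hs.1.2.2.2.2.2.1, hs.1.2.2.2.2.2.2]
    exact ⟨rfl, rfl⟩
  have htot : ∀ v : Fin I.n, countBefore (s.arr 2) I.k v + countBefore (s.arr 3) I.k v =
      {p : Fin I.k × Bool | endOf (I.H p.1) p.2 = v}.ncard := by
    rw [e2, e3]
    exact countBefore_add I hs.1
  have h12 : s4.arr 12 = A := by simp [b4, hA]
  have h14 : s4.arr 14 = A' := by simp [b4, hA']
  refine ⟨s4, ⟨t, by omega, run⟩, ?_, ?_, ?_, ?_, ?_, ?_⟩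
  · intro x hx
    simp [g1, g2, g3, g4, hx]
  · intro a ha
    rw [b4, if_neg (by omega), b3, if_neg (by omega), b2, if_neg (by omega), if_neg (by omega),
      b1, if_neg (by omega), if_neg (by omega)]
  · intro j
    rw [b4, if_neg (by omega), b3, if_pos rfl]
    induction j with
    | zero =>
      intro _
      rw [table_of_not_mem (fun i _ => by omega), hz 15 (by omega), zero_mul]
    | succ j ih =>
      intro hj
      have := table_shift (t₀ := s.arr 15) 1 (q * (2 * I.m)) q j one_pos (by omega)
      rw [this, ih (by omega)]
      ring
  · rintro h (_ | _) h' (_ | _) he hc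
    · simp only [cond_false, h12, hAv _ h.isLt, hAv _ h'.isLt] at hc
      refine ⟨Fin.ext (countBefore_inj ?_ hc), rfl⟩
      rw [(hends h).1, (hends h').1, he]
    · simp only [cond_false, cond_true, h12, h14, hAv _ h.isLt, hAv' _ h'.isLt] at hc
      -- A first end has a slot below the total number of first ends at its vertex, and a second end
      -- has a slot at or above it.
      have := countBefore_lt (e := s.arr 2) h.isLt
      rw [(hends h').2, ← he, ← (hends h).1] at hc
      omega
    · simp only [cond_false, cond_true, h12, h14, hAv' _ h.isLt, hAv _ h'.isLt] at hc
      have := countBefore_lt (e := s.arr 2) h'.isLt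
      rw [(hends h).2, he, ← (hends h').1] at hc
      omega
    · simp only [cond_true, h14, hAv' _ h.isLt, hAv' _ h'.isLt] at hc
      have h3 : s.arr 3 h = s.arr 3 h' := by rw [(hends h).2, (hends h').2, he]
      refine ⟨Fin.ext (countBefore_inj h3 ?_), rfl⟩
      rw [h3] at hc ⊢
      omega
  · rintro h (_ | _)
    · have := countBefore_lt (e := s.arr 2) h.isLt
      simp only [cond_false, h12, hAv _ h.isLt]
      rw [← htot, ← (hends h).1]
      omega
    · have := countBefore_lt (e := s.arr 3) h.isLt
      simp only [cond_true, h14, hAv' _ h.isLt]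
      rw [← htot, ← (hends h).2]
      omega
  · have h16 : s4.arr 16 0 = ∑ i ∈ Finset.range I.k, f i := by
      rw [b4, if_pos rfl, table_sum, hz 16 (by omega), zero_add]
    have h6 : s4.arr 6 = s.arr 6 := by simp [b1, b2, b3, b4]
    rw [h16, Finset.sum_eq_zero_iff, h6]
    constructor
    · intro hall h b
      have := hall h (Finset.mem_range.2 h.isLt)
      simp only [hf, (hends h).1, (hends h).2] at this
      cases b
      · simp only [cond_false, h12]
        omega
      · simp only [cond_true, h14]
        omega
    · intro hall i hi
      have hi' := Finset.mem_range.1 hi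
      have a1 := hall ⟨i, hi'⟩ false
      have a2 := hall ⟨i, hi'⟩ true
      have a3 := hends ⟨i, hi'⟩
      simp only [cond_false, cond_true, h12, h14] at a1 a2 a3
      simp only [hf, a3.1, a3.2]
      omega

end RAM

/-! ### Writing the expansion into the arrays. -/

namespace RAM

open Function EmbeddedGraph RAM.Expr

/-- The number of the node at which the demand end in the array `a` gets its terminal, given its
slot in the array `b`. -/
def terminalExpr (a b : ℕ) : Expr :=
  .add (.add (.get 15 (.get b cnt)) (.sub (.reg 9) (.reg 4))) (.sub (.get 6 (.get a cnt)) (.const 1))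

/-- The number of a dart at an end of the `j`-th vertical edge. -/
def verExpr (j : Expr) : Expr := .add (.reg 4) (.add j j)

/-- The number of a dart at an end of the `j`-th diagonal edge. -/
def diagExpr (j : Expr) : Expr := .add (.add (.reg 4) (.add (.reg 7) (.reg 7))) (.add j j)

/-- The successor of an expression. -/
def succExpr (e : Expr) : Expr := .add e (.const 1)

/-- The part of the program that writes the terminals and prepares the successors of all columns in
all layers. -/
def terminalProgram : Program :=
  .seq (fill (.reg 2) 2 cnt (terminalExpr 2 12)) <|
  .seq (fill (.reg 2) 3 cnt (terminalExpr 3 14)) <|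
  .seq (fill (.reg 8) 4 (.add cnt (.reg 4)) (.add (.get 4 cnt) (.reg 4)))
  (fill (.reg 8) 5 (.add cnt (.reg 4)) (.add (.get 5 cnt) (.reg 4)))

/-- The part of the program that writes the ends of the darts. -/
def vertProgram : Program :=
  .seq (fill (.reg 4) 0 cnt cnt) <|
  .seq (fill (.reg 7) 0 (verExpr cnt) cnt) <|
  .seq (fill (.reg 7) 0 (succExpr (verExpr cnt)) (.add cnt (.reg 4))) <|
  .seq (fill (.reg 7) 0 (diagExpr cnt) cnt)
  (fill (.reg 7) 0 (succExpr (diagExpr cnt)) (.add (.get 4 cnt) (.reg 4)))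

/-- The part of the program that writes the rotation. -/
def rotProgram : Program :=
  .seq (fill (.reg 4) 1 cnt (diagExpr cnt)) <|
  .seq (fill (.reg 7) 1 (diagExpr cnt) (verExpr cnt)) <|
  .seq (fill (.reg 7) 1 (succExpr (diagExpr cnt)) (succExpr (verExpr (.get 4 cnt)))) <|
  .seq (fill (.reg 4) 1 (verExpr cnt) cnt) <|
  .seq (fill (.reg 8) 1 (verExpr (.add cnt (.reg 4))) (succExpr (diagExpr (.get 5 cnt)))) <|
  .seq (fill (.reg 8) 1 (succExpr (verExpr cnt)) (diagExpr (.add cnt (.reg 4))))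
  (fill (.reg 4) 1 (succExpr (verExpr (.add (.reg 8) cnt)))
    (succExpr (diagExpr (.get 5 (.add (.reg 8) cnt)))))

/-- The passes write to disjoint sets of indices: old darts below C, then blocks of vertical and
diagonal darts, split by direction. Each entry thus survives the later passes. -/
theorem vert_spec {s : State} {C R B : ℕ} (S : ℕ → ℕ) (h4 : s.reg 4 = C) (h7 : s.reg 7 = R + C)
    (hS : s.arr 4 = S) (hB : R + C ≤ B) :
    ∃ s', RunsIn vertProgram s s' (5 * (4 * B + 2)) ∧ (∀ x, x ≠ 3 → s'.reg x = s.reg x) ∧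
      (∀ a, a ≠ 0 → s'.arr a = s.arr a) ∧
      (∀ i < C, s'.arr 0 i = i) ∧
      (∀ j < R + C, s'.arr 0 (C + 2 * j) = j) ∧
      (∀ j < R + C, s'.arr 0 (C + 2 * j + 1) = j + C) ∧
      (∀ j < R + C, s'.arr 0 (C + 2 * (R + C) + 2 * j) = j) ∧
      (∀ j < R + C, s'.arr 0 (C + 2 * (R + C) + 2 * j + 1) = S j + C) := by
  obtain ⟨s1, R1, g1, b1⟩ := fill_spec (N := .reg 4) (a := 0) (ie := cnt) (ve := cnt) (s := s)
    (B := B) C (s.arr 0) (fun i => i) (fun i _ => i) (by omega) rfl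
    (by simp [Expr.eval, State.during, h4]) (by simp [Expr.eval, State.during])
    (by simp [Expr.eval, State.during])
  obtain ⟨s2, R2, g2, b2⟩ := fill_spec (N := .reg 7) (a := 0) (ie := verExpr cnt) (ve := cnt)
    (s := s1) (B := B) (R + C) (s1.arr 0) (fun i => C + 2 * i) (fun i _ => i) hB rfl
    (by simp [Expr.eval, State.during, g1, h7])
    (by simp [verExpr, Expr.eval, State.during, g1, h4, two_mul])
    (by simp [Expr.eval, State.during])
  obtain ⟨s3, R3, g3, b3⟩ := fill_spec (N := .reg 7) (a := 0) (ie := succExpr (verExpr cnt))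
    (ve := .add cnt (.reg 4))
    (s := s2) (B := B) (R + C) (s2.arr 0) (fun i => C + 2 * i + 1) (fun i _ => i + C) hB rfl
    (by simp [Expr.eval, State.during, g1, g2, h7])
    (by simp [verExpr, succExpr, Expr.eval, State.during, g1, g2, h4, two_mul])
    (by simp [Expr.eval, State.during, g1, g2, h4])
  obtain ⟨s4, R4, g4, b4⟩ := fill_spec (N := .reg 7) (a := 0) (ie := diagExpr cnt)
    (ve := cnt)
    (s := s3) (B := B) (R + C) (s3.arr 0) (fun i => C + 2 * (R + C) + 2 * i) (fun i _ => i) hB rfl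
    (by simp [Expr.eval, State.during, g1, g2, g3, h7])
    (by simp [diagExpr, Expr.eval, State.during, g1, g2, g3, h4, h7, two_mul])
    (by simp [Expr.eval, State.during])
  obtain ⟨s5, R5, g5, b5⟩ := fill_spec (N := .reg 7) (a := 0) (ie := succExpr (diagExpr cnt))
    (ve := .add (.get 4 cnt) (.reg 4))
    (s := s4) (B := B) (R + C) (s4.arr 0) (fun i => C + 2 * (R + C) + 2 * i + 1)
    (fun i _ => S i + C) hB rfl
    (by simp [Expr.eval, State.during, g1, g2, g3, g4, h7])
    (by simp [diagExpr, succExpr, Expr.eval, State.during, g1, g2, g3, g4, h4, h7, two_mul])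
    (by simp [Expr.eval, State.during, g1, g2, g3, g4, h4, b1, b2, b3, b4, hS])
  obtain ⟨t, ht, run⟩ := R1.seq (R2.seq (R3.seq (R4.seq R5)))
  have k1 : s1.arr 0 = _ := (b1 0).trans (if_pos rfl)
  have k2 : s2.arr 0 = _ := (b2 0).trans (if_pos rfl)
  have k3 : s3.arr 0 = _ := (b3 0).trans (if_pos rfl)
  have k4 : s4.arr 0 = _ := (b4 0).trans (if_pos rfl)
  have k5 : s5.arr 0 = _ := (b5 0).trans (if_pos rfl)
  refine ⟨s5, ⟨t, by omega, run⟩, fun x hx => by simp [g1, g2, g3, g4, g5, hx],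
    fun a ha => by simp [b1, b2, b3, b4, b5, ha], ?_, ?_, ?_, ?_, ?_⟩
  · intro i hi
    rw [k5, table_of_not_mem (by intros; omega), k4, table_of_not_mem (by intros; omega), k3,
      table_of_not_mem (by intros; omega), k2, table_of_not_mem (by intros; omega), k1]
    exact table_apply (idx := fun i => i) (by intros; omega) hi
  · intro j hj
    rw [k5, table_of_not_mem (by intros; omega), k4, table_of_not_mem (by intros; omega), k3,
      table_of_not_mem (by intros; omega), k2]
    exact table_apply (idx := fun i => C + 2 * i) (by intros; omega) hj
  · intro j hj
    rw [k5, table_of_not_mem (by intros; omega), k4, table_of_not_mem (by intros; omega), k3]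
    exact table_apply (idx := fun i => C + 2 * i + 1) (by intros; omega) hj
  · intro j hj
    rw [k5, table_of_not_mem (by intros; omega), k4]
    exact table_apply (idx := fun i => C + 2 * (R + C) + 2 * i) (by intros; omega) hj
  · intro j hj
    rw [k5]
    exact table_apply (idx := fun i => C + 2 * (R + C) + 2 * i + 1) (by intros; omega) hj

theorem rot_spec {s : State} {C R B : ℕ} (S Z : ℕ → ℕ) (h4 : s.reg 4 = C) (h7 : s.reg 7 = R + C)
    (h8 : s.reg 8 = R) (hS : s.arr 4 = S) (hZ : s.arr 5 = Z) (hB : R + C ≤ B) :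
    ∃ s', RunsIn rotProgram s s' (7 * (4 * B + 2)) ∧ (∀ x, x ≠ 3 → s'.reg x = s.reg x) ∧
      (∀ a, a ≠ 1 → s'.arr a = s.arr a) ∧
      (∀ i < C, s'.arr 1 i = C + 2 * (R + C) + 2 * i) ∧
      (∀ j < R + C, s'.arr 1 (C + 2 * (R + C) + 2 * j) = C + 2 * j) ∧
      (∀ j < R + C, s'.arr 1 (C + 2 * (R + C) + 2 * j + 1) = C + 2 * S j + 1) ∧
      (∀ i < C, s'.arr 1 (C + 2 * i) = i) ∧
      (∀ j < R, s'.arr 1 (C + 2 * (j + C)) = C + 2 * (R + C) + 2 * Z j + 1) ∧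
      (∀ j < R, s'.arr 1 (C + 2 * j + 1) = C + 2 * (R + C) + 2 * (j + C)) ∧
      (∀ i < C, s'.arr 1 (C + 2 * (R + i) + 1) = C + 2 * (R + C) + 2 * Z (R + i) + 1) := by
  obtain ⟨s1, R1, g1, b1⟩ := fill_spec (N := .reg 4) (a := 1) (ie := cnt) (ve := diagExpr cnt)
    (s := s) (B := B) C (s.arr 1) (fun i => i) (fun i _ => C + 2 * (R + C) + 2 * i) (by omega) rfl
    (by simp [Expr.eval, State.during, h4]) (by simp [Expr.eval, State.during])
    (by simp [diagExpr, Expr.eval, State.during, h4, h7, two_mul])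
  obtain ⟨s2, R2, g2, b2⟩ := fill_spec (N := .reg 7) (a := 1) (ie := diagExpr cnt)
    (ve := verExpr cnt) (s := s1) (B := B) (R + C) (s1.arr 1)
    (fun i => C + 2 * (R + C) + 2 * i) (fun i _ => C + 2 * i) hB rfl
    (by simp [Expr.eval, State.during, g1, h7])
    (by simp [diagExpr, Expr.eval, State.during, g1, h4, h7, two_mul])
    (by simp [verExpr, Expr.eval, State.during, g1, h4, two_mul])
  obtain ⟨s3, R3, g3, b3⟩ := fill_spec (N := .reg 7) (a := 1) (ie := succExpr (diagExpr cnt))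
    (ve := succExpr (verExpr (.get 4 cnt))) (s := s2) (B := B) (R + C) (s2.arr 1)
    (fun i => C + 2 * (R + C) + 2 * i + 1) (fun i _ => C + 2 * S i + 1) hB rfl
    (by simp [Expr.eval, State.during, g1, g2, h7])
    (by simp [diagExpr, succExpr, Expr.eval, State.during, g1, g2, h4, h7, two_mul])
    (by simp [verExpr, succExpr, Expr.eval, State.during, g1, g2, b1, b2, hS, h4, two_mul])
  obtain ⟨s4, R4, g4, b4⟩ := fill_spec (N := .reg 4) (a := 1) (ie := verExpr cnt)
    (ve := cnt) (s := s3) (B := B) C (s3.arr 1)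
    (fun i => C + 2 * i) (fun i _ => i) (by omega) rfl
    (by simp [Expr.eval, State.during, g1, g2, g3, h4])
    (by simp [verExpr, Expr.eval, State.during, g1, g2, g3, h4, two_mul])
    (by simp [Expr.eval, State.during])
  obtain ⟨s5, R5, g5, b5⟩ := fill_spec (N := .reg 8) (a := 1)
    (ie := verExpr (.add cnt (.reg 4))) (ve := succExpr (diagExpr (.get 5 cnt)))
    (s := s4) (B := B) R (s4.arr 1)
    (fun i => C + 2 * (i + C)) (fun i _ => C + 2 * (R + C) + 2 * Z i + 1) (by omega) rfl
    (by simp [Expr.eval, State.during, g1, g2, g3, g4, h8])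
    (by simp [verExpr, Expr.eval, State.during, g1, g2, g3, g4, h4, two_mul])
    (by simp [diagExpr, succExpr, Expr.eval, State.during, g1, g2, g3, g4, b1, b2, b3, b4, hZ,
      h4, h7, two_mul])
  obtain ⟨s6, R6, g6, b6⟩ := fill_spec (N := .reg 8) (a := 1)
    (ie := succExpr (verExpr cnt)) (ve := diagExpr (.add cnt (.reg 4)))
    (s := s5) (B := B) R (s5.arr 1)
    (fun i => C + 2 * i + 1) (fun i _ => C + 2 * (R + C) + 2 * (i + C)) (by omega) rfl
    (by simp [Expr.eval, State.during, g1, g2, g3, g4, g5, h8])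
    (by simp [verExpr, succExpr, Expr.eval, State.during, g1, g2, g3, g4, g5, h4, two_mul])
    (by simp [diagExpr, Expr.eval, State.during, g1, g2, g3, g4, g5, h4, h7, two_mul])
  obtain ⟨s7, R7, g7, b7⟩ := fill_spec (N := .reg 4) (a := 1)
    (ie := succExpr (verExpr (.add (.reg 8) cnt)))
    (ve := succExpr (diagExpr (.get 5 (.add (.reg 8) cnt))))
    (s := s6) (B := B) C (s6.arr 1)
    (fun i => C + 2 * (R + i) + 1) (fun i _ => C + 2 * (R + C) + 2 * Z (R + i) + 1) (by omega) rfl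
    (by simp [Expr.eval, State.during, g1, g2, g3, g4, g5, g6, h4])
    (by simp [verExpr, succExpr, Expr.eval, State.during, g1, g2, g3, g4, g5, g6, h4, h8, two_mul])
    (by simp [diagExpr, succExpr, Expr.eval, State.during, g1, g2, g3, g4, g5, g6, b1, b2, b3, b4,
      b5, b6, hZ, h4, h7, h8, two_mul])
  obtain ⟨t, ht, run⟩ := R1.seq (R2.seq (R3.seq (R4.seq (R5.seq (R6.seq R7)))))
  have k1 : s1.arr 1 = _ := (b1 1).trans (if_pos rfl)
  have k2 : s2.arr 1 = _ := (b2 1).trans (if_pos rfl)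
  have k3 : s3.arr 1 = _ := (b3 1).trans (if_pos rfl)
  have k4 : s4.arr 1 = _ := (b4 1).trans (if_pos rfl)
  have k5 : s5.arr 1 = _ := (b5 1).trans (if_pos rfl)
  have k6 : s6.arr 1 = _ := (b6 1).trans (if_pos rfl)
  have k7 : s7.arr 1 = _ := (b7 1).trans (if_pos rfl)
  refine ⟨s7, ⟨t, by omega, run⟩, fun x hx => by simp [g1, g2, g3, g4, g5, g6, g7, hx],
    fun a ha => by simp [b1, b2, b3, b4, b5, b6, b7, ha], ?_, ?_, ?_, ?_, ?_, ?_, ?_⟩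
  · intro i hi
    rw [k7, table_of_not_mem (by intros; omega), k6, table_of_not_mem (by intros; omega), k5,
      table_of_not_mem (by intros; omega), k4, table_of_not_mem (by intros; omega), k3,
      table_of_not_mem (by intros; omega), k2, table_of_not_mem (by intros; omega), k1]
    exact table_apply (idx := fun i => i) (by intros; omega) hi
  · intro j hj
    rw [k7, table_of_not_mem (by intros; omega), k6, table_of_not_mem (by intros; omega), k5,
      table_of_not_mem (by intros; omega), k4, table_of_not_mem (by intros; omega), k3,
      table_of_not_mem (by intros; omega), k2]
    exact table_apply (idx := fun i => C + 2 * (R + C) + 2 * i) (by intros; omega) hj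
  · intro j hj
    rw [k7, table_of_not_mem (by intros; omega), k6, table_of_not_mem (by intros; omega), k5,
      table_of_not_mem (by intros; omega), k4, table_of_not_mem (by intros; omega), k3]
    exact table_apply (idx := fun i => C + 2 * (R + C) + 2 * i + 1) (by intros; omega) hj
  · intro i hi
    rw [k7, table_of_not_mem (by intros; omega), k6, table_of_not_mem (by intros; omega), k5,
      table_of_not_mem (by intros; omega), k4]
    exact table_apply (idx := fun i => C + 2 * i) (by intros; omega) hi
  · intro j hj
    rw [k7, table_of_not_mem (by intros; omega), k6, table_of_not_mem (by intros; omega), k5]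
    exact table_apply (idx := fun i => C + 2 * (i + C)) (by intros; omega) hj
  · intro j hj
    rw [k7, table_of_not_mem (by intros; omega), k6]
    exact table_apply (idx := fun i => C + 2 * i + 1) (by intros; omega) hj
  · intro i hi
    rw [k7]
    exact table_apply (idx := fun i => C + 2 * (R + i) + 1) (by intros; omega) hi

/-- A function on columns, repeated in every layer. -/
theorem table_layers {m T : ℕ} {t₀ : ℕ → ℕ} (g : Fin m × Bool → Fin m × Bool)
    (h : ∀ d, t₀ (dartIndex d) = dartIndex (g d)) (l : ℕ) (hl : l ≤ T) (d : Fin m × Bool) :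
    table t₀ (fun i => i + 2 * m) (fun i t => t i + 2 * m) (T * (2 * m))
      (l * (2 * m) + dartIndex d) = l * (2 * m) + dartIndex (g d) := by
  have hd := dartIndex_lt d
  induction l with
  | zero =>
    rw [zero_mul, zero_add, zero_add, table_of_not_mem (by intros; omega), h]
  | succ l ih =>
    have h1 := table_shift (t₀ := t₀) (2 * m) (2 * m) (T * (2 * m)) (l * (2 * m) + dartIndex d)
      (by omega) (index_lt' ⟨l, by omega⟩ d)
    rw [ih (by omega)] at h1
    rw [show (l + 1) * (2 * m) + dartIndex d = l * (2 * m) + dartIndex d + 2 * m by ring, h1]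
    ring

/-- With array 15 holding multiples of qC, the value written is (q · slot + q − 1)C plus the number
of the base dart, the number of the terminal node. -/
theorem terminal_spec {s : State} {C R k B : ℕ} (h2 : s.reg 2 = k) (h4 : s.reg 4 = C)
    (h8 : s.reg 8 = R) (hB₁ : k ≤ B) (hB₂ : R ≤ B) :
    ∃ s', RunsIn terminalProgram s s' (4 * (4 * B + 2)) ∧ (∀ x, x ≠ 3 → s'.reg x = s.reg x) ∧
      (s'.arr 4 = table (s.arr 4) (fun i => i + C) (fun i t => t i + C) R) ∧
      (s'.arr 5 = table (s.arr 5) (fun i => i + C) (fun i t => t i + C) R) ∧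
      (∀ h < k, s'.arr 2 h = s.arr 15 (s.arr 12 h) + (s.reg 9 - C) + (s.arr 6 (s.arr 2 h) - 1)) ∧
      (∀ h < k, s'.arr 3 h = s.arr 15 (s.arr 14 h) + (s.reg 9 - C) + (s.arr 6 (s.arr 3 h) - 1)) := by
  obtain ⟨s1, R1, g1, b1⟩ := fill_spec (N := .reg 2) (a := 2) (ie := cnt)
    (ve := terminalExpr 2 12) (s := s) (B := B) k (s.arr 2) (fun i => i)
    -- The old vertex is read from the very entry that is being overwritten, hence `t i`.
    (fun i t => s.arr 15 (s.arr 12 i) + (s.reg 9 - C) + (s.arr 6 (t i) - 1)) hB₁ rfl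
    (by simp [Expr.eval, State.during, h2]) (by simp [Expr.eval, State.during])
    (by simp [terminalExpr, Expr.eval, State.during, h4])
  obtain ⟨s2, R2, g2, b2⟩ := fill_spec (N := .reg 2) (a := 3) (ie := cnt)
    (ve := terminalExpr 3 14) (s := s1) (B := B) k (s.arr 3) (fun i => i)
    (fun i t => s.arr 15 (s.arr 14 i) + (s.reg 9 - C) + (s.arr 6 (t i) - 1)) hB₁ (by simp [b1])
    (by simp [Expr.eval, State.during, h2, g1]) (by simp [Expr.eval, State.during])
    (by simp [terminalExpr, Expr.eval, State.during, h4, g1, b1])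
  obtain ⟨s3, R3, g3, b3⟩ := fill_spec (N := .reg 8) (a := 4) (ie := .add cnt (.reg 4))
    (ve := .add (.get 4 cnt) (.reg 4)) (s := s2) (B := B) R (s.arr 4) (fun i => i + C)
    (fun i t => t i + C) hB₂ (by simp [b1, b2])
    (by simp [Expr.eval, State.during, h8, g1, g2])
    (by simp [Expr.eval, State.during, h4, g1, g2])
    (by simp [Expr.eval, State.during, h4, g1, g2])
  obtain ⟨s4, R4, g4, b4⟩ := fill_spec (N := .reg 8) (a := 5) (ie := .add cnt (.reg 4))
    (ve := .add (.get 5 cnt) (.reg 4)) (s := s3) (B := B) R (s.arr 5) (fun i => i + C)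
    (fun i t => t i + C) hB₂ (by simp [b1, b2, b3])
    (by simp [Expr.eval, State.during, h8, g1, g2, g3])
    (by simp [Expr.eval, State.during, h4, g1, g2, g3])
    (by simp [Expr.eval, State.during, h4, g1, g2, g3])
  obtain ⟨t, ht, run⟩ := R1.seq (R2.seq (R3.seq R4))
  have aux : ∀ (t₀ : ℕ → ℕ) (f : ℕ → ℕ → ℕ), ∀ h < k,
      table t₀ (fun i => i) (fun i t => f i (t i)) k h = f h (t₀ h) := by
    intro t₀ f h hh
    have := table_apply (t₀ := t₀) (idx := fun i => i) (val := fun i t => f i (t i)) (n := k)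
      (by intros; omega) hh
    rw [this, table_of_not_mem (by intros; omega)]
  refine ⟨s4, ⟨t, by omega, run⟩, fun x hx => by simp [g1, g2, g3, g4, hx], by simp [b4, b3],
    by simp [b4], fun h hh => ?_, fun h hh => ?_⟩
  · rw [b4, if_neg (by omega), b3, if_neg (by omega), b2, if_neg (by omega), b1, if_pos rfl]
    exact aux _ (fun i x => s.arr 15 (s.arr 12 i) + (s.reg 9 - C) + (s.arr 6 x - 1)) h hh
  · rw [b4, if_neg (by omega), b3, if_neg (by omega), b2, if_pos rfl]
    exact aux _ (fun i x => s.arr 15 (s.arr 14 i) + (s.reg 9 - C) + (s.arr 6 x - 1)) h hh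

end RAM

open EmbeddedGraph

/-! ### Degree bounds. -/

section Degree

namespace EmbeddedGraph

variable {V : Type*} {m : ℕ} (G : EmbeddedGraph V (Fin m))

theorem minimalPeriod_le_degree (a : Fin m × Bool) :
    Function.minimalPeriod G.rot a ≤ G.degree (G.vert a) := by
  have h := Set.ncard_le_ncard_of_injOn (s := Set.Iio (Function.minimalPeriod G.rot a))
    (t := {d | G.vert d = G.vert a}) (fun i => (G.rot ^ i) a) (fun i _ => G.vert_rot_pow a i)
    (fun i hi j hj he => (pow_rot_injOn G.rot a hi hj).1 he) (Set.toFinite _)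
  rwa [← Finset.coe_Iio, Set.ncard_coe_finset, Nat.card_Iio] at h

theorem degree_le_darts (v : V) : G.degree v ≤ 2 * m := by
  have h := Set.ncard_le_card {d | G.vert d = v}
  rw [Nat.card_eq_fintype_card] at h
  simpa [degree, mul_comm] using h

theorem degree_le_maxDegree [Fintype V] (v : V) : G.degree v ≤ G.maxDegree :=
  Finset.le_sup (f := G.degree) (Finset.mem_univ v)

/-- The darts are distributed over the vertices, at most Δ at each. This supplies the factor Δ|V(G)|
in the size bound. -/
theorem darts_le [Fintype V] : 2 * m ≤ G.maxDegree * Fintype.card V := by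
  classical
  have h := Finset.card_le_mul_card_image_of_maps_to (s := (Finset.univ : Finset (Fin m × Bool)))
    (t := Finset.univ) (f := G.vert) (fun _ _ => Finset.mem_univ _) G.maxDegree (fun v _ => by
      refine le_trans (le_of_eq ?_) (G.degree_le_maxDegree v)
      rw [degree, ← Set.ncard_coe_finset]
      congr 1
      ext d
      simp)
  simpa [mul_comm] using h

/-- In an uncrossed trail flow, different ends of demands use different darts. -/
theorem Passages.ncard_ends_le {K : Type*} {dem : K → V × V} (Q : Passages G dem) (v : V) :
    {p : K × Bool | endOf (dem p.1) p.2 = v}.ncard ≤ G.degree v :=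
  Set.ncard_le_ncard_of_injOn (fun p => Q.tm p.1 p.2) (fun p hp => (Q.vert_tm p.1 p.2).trans hp)
    (fun _ _ _ _ he => Prod.ext (Q.tm_inj he).1 (Q.tm_inj he).2) (Set.toFinite _)

end EmbeddedGraph

end Degree

/-- An instance on at least two vertices without edges and with one demand. -/
def noInstance (n : ℕ) (hn : 2 ≤ n) : PlanarInstance where
  n := n
  m := 0
  k := 1
  G := { vert := fun d => d.1.elim0, rot := 1, sameCycle_iff := fun d => d.1.elim0 }
  planar := by
    have h : ∀ S : Subgroup (Equiv.Perm (Fin 0 × Bool)), numOrbits S = 0 := fun S => by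
      have : IsEmpty (MulAction.orbitRel.Quotient S (Fin 0 × Bool)) :=
        ⟨fun x => Quotient.inductionOn x fun d => d.1.elim0⟩
      exact Nat.card_of_isEmpty
    rw [Planar, h, h, h]
    simp
  H _ := (⟨0, by omega⟩, ⟨1, by omega⟩)
  H_ne _ h := by simp at h

theorem noInstance_not_hasNodeDisjointPaths (n : ℕ) (hn : 2 ≤ n) :
    ¬ (noInstance n hn).G.HasNodeDisjointPaths (noInstance n hn).H := by
  rintro ⟨P, hP, -⟩
  have h0 : P (0 : Fin 1) = [] := List.eq_nil_iff_forall_not_mem.2 fun d _ => d.1.elim0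
  have h := (hP (0 : Fin 1)).1
  rw [h0] at h
  exact (noInstance n hn).H_ne _ h

/-! ### The complete reduction. -/

namespace RAM

open RAM.Expr

/-- The part of the program that writes the expansion. -/
def hatProgram : Program :=
  .seq terminalProgram <| .seq vertProgram <| .seq rotProgram <|
  .seq (.assign 0 (.add (.reg 7) (.reg 4))) (.assign 1 (.add (.reg 1) (.add (.reg 7) (.reg 7))))

/-- The part of the program that writes an instance without solution. -/
def noProgram : Program :=
  .seq (.assign 1 (.const 0)) <| .seq (.assign 2 (.const 1)) <|
  .seq (.store 2 (.const 0) (.const 0)) (.store 3 (.const 0) (.const 1))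

/-- The program that computes the reduction. -/
def reductionProgram : Program :=
  .seq paramProgram <| .seq slotProgram <| .ite (get0 16) noProgram hatProgram

theorem noProgram_spec {s : State} {n : ℕ} (hn : 2 ≤ n) (h0 : s.reg 0 = n) :
    ∃ s', RunsIn noProgram s s' 4 ∧ s'.Holds (noInstance n hn) := by
  obtain ⟨s1, R1, g1, b1⟩ := assign_spec (x := 1) (e := .const 0) (s := s) 0 rfl
  obtain ⟨s2, R2, g2, b2⟩ := assign_spec (x := 2) (e := .const 1) (s := s1) 1 rfl
  obtain ⟨s3, R3, g3, b3⟩ := store_spec (a := 2) (i := .const 0) (e := .const 0) (s := s2) 0 0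
    rfl rfl
  obtain ⟨s4, R4, g4, b4⟩ := store_spec (a := 3) (i := .const 0) (e := .const 1) (s := s3) 0 1
    rfl rfl
  refine ⟨s4, R1.seq (R2.seq (R3.seq R4)), ?_, ?_, ?_, fun d => (d.1 : Fin 0).elim0,
    fun d => (d.1 : Fin 0).elim0, ?_, ?_⟩
  · simp [g1, g2, g3, g4, h0, noInstance]
  · simp [g1, g2, g3, g4, noInstance]
  · simp [g2, g3, g4, noInstance]
  · intro h
    obtain ⟨h, hh⟩ := h
    obtain rfl : h = 0 := Nat.lt_one_iff.1 hh
    simp [b3, b4, noInstance]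
  · intro h
    obtain ⟨h, hh⟩ := h
    obtain rfl : h = 0 := Nat.lt_one_iff.1 hh
    simp [b4, noInstance]

theorem hatProgram_spec (I : PlanarInstance) {s₀ s₁ s : State} (hs : s₀.IsInitial I)
    {B q T : ℕ} (hq : q = max 1 I.G.maxDegree) (hT : T + 1 = q * q + 2 * q)
    (hp : Params I q s₀ s₁) (hl : Slots I q s₁ s) (hB₁ : I.k ≤ B)
    (hB₂ : (q * q + 2 * q) * (2 * I.m) ≤ B)
    (hgood : ∀ (h : Fin I.k) b,
      s.arr 6 (endOf (I.H h) b : Fin I.n) ≠ 0 ∧ s.arr (cond b 14 12) h < q) :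
    ∃ s' J, RunsIn hatProgram s s' (16 * (4 * B + 2) + 2) ∧ s'.Holds J ∧
      J.n = (T + 2) * (I.m * 2) ∧
      (I.G.HasUncrossedTrailFlow I.H ↔ J.G.HasNodeDisjointPaths J.H) := by
  have hTC : (q * q + 2 * q) * (2 * I.m) = T * (2 * I.m) + 2 * I.m := by rw [← hT]; ring
  have r1 : s.reg 1 = I.m := (hl.reg 1 (by omega)).trans hp.r1
  have r2 : s.reg 2 = I.k := (hl.reg 2 (by omega)).trans hp.r2
  have r4 : s.reg 4 = 2 * I.m := (hl.reg 4 (by omega)).trans hp.r4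
  have r7 : s.reg 7 = T * (2 * I.m) + 2 * I.m := by rw [hl.reg 7 (by omega), hp.r7, hTC]
  have r8 : s.reg 8 = T * (2 * I.m) := by
    rw [hl.reg 8 (by omega), hp.r8, hTC, Nat.add_sub_cancel]
  have r9 : s.reg 9 = q * (2 * I.m) := (hl.reg 9 (by omega)).trans hp.r9
  rw [hTC] at hB₂
  obtain ⟨s1, R1, g1, S1, Z1, d2, d3⟩ := terminal_spec (B := B) r2 r4 r8 hB₁ (by omega)
  obtain ⟨s2, R2, g2, b2, f0, f1, f2, f3, f4⟩ := vert_spec (s := s1) (B := B) (s1.arr 4)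
    ((g1 4 (by omega)).trans r4) ((g1 7 (by omega)).trans r7) rfl hB₂
  obtain ⟨s3, R3, g3, b3, e0, e1, e2, e3, e4, e5, e6⟩ := rot_spec (s := s2) (B := B) (s1.arr 4)
    (s1.arr 5) ((g2 4 (by omega)).trans ((g1 4 (by omega)).trans r4))
    ((g2 7 (by omega)).trans ((g1 7 (by omega)).trans r7))
    ((g2 8 (by omega)).trans ((g1 8 (by omega)).trans r8)) (b2 4 (by omega)) (b2 5 (by omega)) hB₂
  have G3 : ∀ x, x ≠ 3 → s3.reg x = s.reg x := fun x hx =>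
    (g3 x hx).trans ((g2 x hx).trans (g1 x hx))
  obtain ⟨s4, R4, g4, b4⟩ := assign_spec (x := 0) (e := .add (.reg 7) (.reg 4)) (s := s3)
    (T * (2 * I.m) + 2 * I.m + 2 * I.m)
    (by simp only [Expr.eval, G3 7 (by omega), G3 4 (by omega), r7, r4])
  obtain ⟨s5, R5, g5, b5⟩ := assign_spec (x := 1) (e := .add (.reg 1) (.add (.reg 7) (.reg 7)))
    (s := s4) (I.m + 2 * (T * (2 * I.m) + 2 * I.m))
    (by simp [Expr.eval, g4, G3, r7, r1, two_mul])
  obtain ⟨t, ht, run⟩ := R1.seq (R2.seq (R3.seq (R4.seq R5)))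
  -- the darts at which the terminals are placed
  have hbase : ∀ (h : Fin I.k) b, ∃ d, I.G.vert d = endOf (I.H h) b ∧
      s.arr 6 (endOf (I.H h) b : Fin I.n) = RAM.dartIndex d + 1 := by
    intro h b
    rcases hp.a6 (endOf (I.H h) b) with ⟨h1, -⟩ | h1
    · rw [← hl.arr 6 (by omega)] at h1
      exact absurd h1 (hgood h b).1
    · rwa [← hl.arr 6 (by omega)] at h1
  choose base hbase₁ hbase₂ using hbase
  have hlay : ∀ (h : Fin I.k) b, q * s.arr (cond b 14 12) h + (q - 1) < T + 2 := by
    intro h b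
    have h1 := (hgood h b).2
    have h2 : q * s.arr (cond b 14 12) h + q ≤ q * q := by
      have := Nat.mul_le_mul_left q h1
      rwa [Nat.mul_succ] at this
    omega
  let node : Fin I.k → Bool → HatNode (Fin I.m) T := fun h b =>
    (⟨q * s.arr (cond b 14 12) h + (q - 1), hlay h b⟩, base h b)
  let dem : Fin I.k → HatNode (Fin I.m) T × HatNode (Fin I.m) T := fun h =>
    (node h false, node h true)
  have hne : ∀ h, (dem h).1 ≠ (dem h).2 := by
    -- Equal terminals would have the same base dart, but the base darts lie at the two different
    -- ends of the demand.
    intro h he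
    have h1 : base h false = base h true := congrArg Prod.snd he
    have h2 := hbase₁ h false
    rw [h1, hbase₁ h true] at h2
    exact I.H_ne h h2.symm
  have hnum : ∀ (h : Fin I.k) b, (nodeNum I.m T (node h b) : ℕ) =
      s.arr 15 (s.arr (cond b 14 12) h) + (s.reg 9 - 2 * I.m) +
        (s.arr 6 (endOf (I.H h) b : Fin I.n) - 1) := by
    intro h b
    rw [nodeNum_val, hbase₂, hl.a15 _ (hgood h b).2.le, r9, Nat.add_sub_cancel]
    simp only [node]
    have hq1 : q * (2 * I.m) - 2 * I.m = (q - 1) * (2 * I.m) := by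
      rw [Nat.sub_mul, one_mul]
    rw [hq1]
    ring
  have hfill : Filled (2 * I.m) (T * (2 * I.m)) (s5.arr 0) (s5.arr 1) (s1.arr 4) (s1.arr 5) := by
    have h0 : s5.arr 0 = s2.arr 0 := by rw [b5, b4, b3 0 (by omega)]
    have h1 : s5.arr 1 = s3.arr 1 := by rw [b5, b4]
    rw [h0, h1]
    exact ⟨f0, f1, f2, f3, f4, e0, e1, e2, e3, e4, e5, e6⟩
  have hS : ∀ (l : Fin (T + 1)) d, s1.arr 4 (l * (2 * I.m) + dartIndex d) =
      l * (2 * I.m) + dartIndex (I.G.rot d) := by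
    intro l d
    rw [S1]
    exact table_layers I.G.rot (fun d => by rw [hl.arr 4 (by omega), hp.a4]) l
      (Nat.lt_succ_iff.1 l.isLt) d
  have hZ : ∀ (l : Fin (T + 1)) d, s1.arr 5 (l * (2 * I.m) + dartIndex d) =
      l * (2 * I.m) + dartIndex (I.G.rot.symm d) := by
    intro l d
    rw [Z1]
    exact table_layers I.G.rot.symm (fun d => by rw [hl.arr 5 (by omega), hp.a5]) l
      (Nat.lt_succ_iff.1 l.isLt) d
  have i2 : ∀ h : Fin I.k, s.arr 2 h = (endOf (I.H h) false : Fin I.n) := fun h => by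
    rw [hl.arr 2 (by omega), hp.frame 2 (by omega)]
    exact hs.1.2.2.2.2.2.1 h
  have i3 : ∀ h : Fin I.k, s.arr 3 h = (endOf (I.H h) true : Fin I.n) := fun h => by
    rw [hl.arr 3 (by omega), hp.frame 3 (by omega)]
    exact hs.1.2.2.2.2.2.2 h
  refine ⟨s5, hatInstance I T dem hne, ⟨t, by omega, run⟩, ?_, rfl, ?_⟩
  · refine holds_hatInstance I T dem hne s5 (by simp [g5, g4]) (by simp [g5])
      (by simp [g5, g4, G3, r2]) (hfill.vert hS) (hfill.next hS hZ) (fun h => ?_) (fun h => ?_)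
    · rw [b5, b4, b3 2 (by omega), b2 2 (by omega), d2 h h.isLt, i2]
      exact (hnum h false).symm
    · rw [b5, b4, b3 3 (by omega), b2 3 (by omega), d3 h h.isLt, i3]
      exact (hnum h true).symm
  · refine (hat_hasNodeDisjointPaths_iff I.G I.H_ne (q := q) (T := T) (base := base)
      (slot := fun h b => s.arr (cond b 14 12) h) (dem' := dem) (fun a => ?_) hT.ge hbase₁
      (fun h b => (hgood h b).2) hl.inj ?_ ?_).trans
      (relabel_hasNodeDisjointPaths (I.G.hat T) (nodeNum I.m T) (edgeNum I.m T) dem).symm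
    · have h1 := I.G.minimalPeriod_le_degree a
      have h2 := I.G.degree_le_maxDegree (I.G.vert a)
      omega
    · rintro h (_ | _) <;> rfl
    · rintro h (_ | _) <;> rfl

/-- If the program finds an obstacle, there is no flow. -/
theorem no_flow (I : PlanarInstance) {s₀ s₁ s : State} {q : ℕ} (hq : q = max 1 I.G.maxDegree)
    (hp : Params I q s₀ s₁) (hl : Slots I q s₁ s) (hbad : s.arr 16 0 ≠ 0) :
    ¬ I.G.HasUncrossedTrailFlow I.H := by
  intro hflow
  obtain ⟨Q⟩ := exists_passages I.H_ne hflow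
  refine hbad (hl.a16.2 fun h b => ⟨fun h0 => ?_, ?_⟩)
  · rw [hl.arr 6 (by omega)] at h0
    rcases hp.a6 (endOf (I.H h) b) with ⟨-, h1⟩ | ⟨d, -, h1⟩
    · exact h1 _ (Q.vert_tm h b)
    · omega
  · have h1 := hl.lt h b
    have h2 := Passages.ncard_ends_le I.G Q (endOf (I.H h) b)
    have h3 := I.G.degree_le_maxDegree (endOf (I.H h) b)
    omega

/-- With X = 2 · size + 1, every loop makes at most 3X³ passes, the worst count being (q² + 2q) ·
2m. The programs cost at most 35 such loop bounds and a few more steps, within 700X³. -/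
theorem reductionProgram_spec (I : PlanarInstance) {s : State} (hs : s.IsInitial I) :
    ∃ s' J, RunsIn reductionProgram s s' (700 * (2 * I.size + 1) ^ 3) ∧ s'.Holds J ∧
      (I.G.HasUncrossedTrailFlow I.H ↔ J.G.HasNodeDisjointPaths J.H) ∧
      J.n ≤ 4 * max 1 I.G.maxDegree ^ 3 * I.n := by
  obtain ⟨q, hq⟩ : ∃ q, q = max 1 I.G.maxDegree := ⟨_, rfl⟩
  obtain ⟨X, hX⟩ : ∃ X, X = 2 * I.size + 1 := ⟨_, rfl⟩
  have hsize : I.size = I.n + I.m + I.k := rfl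
  have hX1 : 1 ≤ X := by omega
  have hΔ : I.G.maxDegree ≤ 2 * I.m := Finset.sup_le fun v _ => I.G.degree_le_darts v
  have hqX : q ≤ X := by omega
  have hq1 : 1 ≤ q := by omega
  have hX2 : X ≤ X ^ 2 := by nlinarith
  have hX3 : X ^ 2 ≤ X ^ 3 := Nat.pow_le_pow_right hX1 (by omega)
  have hqq : q * q + 2 * q ≤ 3 * X ^ 2 := by nlinarith
  have hTC : (q * q + 2 * q) * (2 * I.m) ≤ 3 * X ^ 3 :=
    (Nat.mul_le_mul hqq (show 2 * I.m ≤ X by omega)).trans (le_of_eq (by ring))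
  obtain ⟨s₁, R1, hp⟩ := params_spec I hs (B := 3 * X ^ 3) hq (by omega) (by omega) (by omega)
  obtain ⟨s₂, R2, hl⟩ := slots_spec I hs (B := 3 * X ^ 3) hp (by omega) (by omega)
  rw [← hX, ← hq]
  by_cases hbad : s₂.arr 16 0 = 0
  · obtain ⟨T, hT⟩ : ∃ T, T + 1 = q * q + 2 * q := ⟨q * q + 2 * q - 1, by omega⟩
    obtain ⟨s₃, J, ⟨t, ht, R3⟩, hJ, hn, hiff⟩ := hatProgram_spec I hs (B := 3 * X ^ 3) hq hT hp hl
      (by omega) hTC (hl.a16.1 hbad)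
    have R4 : RunsIn (.ite (get0 16) noProgram hatProgram) s₂ s₃ (t + 1) :=
      ⟨_, le_rfl, .ite_false (by simpa [Expr.eval] using hbad) R3⟩
    obtain ⟨u, hu, R⟩ := R1.seq (R2.seq R4)
    refine ⟨s₃, J, ⟨u, by omega, R⟩, hJ, hiff, ?_⟩
    have h1 := I.G.darts_le
    rw [Fintype.card_fin] at h1
    have h2 : I.m * 2 ≤ q * I.n :=
      (le_of_eq (mul_comm _ _)).trans (h1.trans (Nat.mul_le_mul_right _ (by omega)))
    -- T + 2 = (q + 1)² ≤ (2q)², since q ≥ 1. Here the constant 4 arises.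
    have h3 : T + 2 ≤ 4 * q ^ 2 := by nlinarith
    rw [hn]
    exact (Nat.mul_le_mul h3 h2).trans (le_of_eq (by ring))
  · have hno := no_flow I hq hp hl hbad
    -- An obstacle requires a demand, and its two distinct ends provide the two vertices that the
    -- unsolvable instance needs.
    have hk : ∃ h : Fin I.k, True := by
      by_contra hk
      exact hbad (hl.a16.2 fun h => absurd ⟨h, trivial⟩ hk)
    obtain ⟨h, -⟩ := hk
    have hn : 2 ≤ I.n := by
      have h1 := I.H_ne h
      have h2 := (I.H h).1.isLt
      have h3 := (I.H h).2.isLt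
      have h4 : ((I.H h).1 : ℕ) ≠ (I.H h).2 := fun e => h1 (Fin.ext e)
      omega
    obtain ⟨s₃, ⟨t, ht, R3⟩, hJ⟩ := noProgram_spec (s := s₂) hn
      ((hl.reg 0 (by omega)).trans hp.r0)
    have R4 : RunsIn (.ite (get0 16) noProgram hatProgram) s₂ s₃ (t + 1) :=
      ⟨_, le_rfl, .ite_true (by simpa [Expr.eval] using hbad) R3⟩
    obtain ⟨u, hu, R⟩ := R1.seq (R2.seq R4)
    refine ⟨s₃, noInstance I.n hn, ⟨u, by omega, R⟩, hJ,
      ⟨fun h => absurd h hno, fun h => absurd h (noInstance_not_hasNodeDisjointPaths _ hn)⟩, ?_⟩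
    have h5 : 1 ≤ 4 * q ^ 3 := by
      have := Nat.pow_le_pow_left hq1 3
      omega
    exact Nat.le_mul_of_pos_left I.n h5

/-- The initial state is determined by the input. -/
theorem State.IsInitial.eq {I : PlanarInstance} {s s' : State} (h : s.IsInitial I)
    (h' : s'.IsInitial I) : s = s' := by
  obtain ⟨⟨a0, a1, a2, a3, a4, a5, a6⟩, ar, aa⟩ := h
  obtain ⟨⟨b0, b1, b2, b3, b4, b5, b6⟩, br, ba⟩ := h'
  have hreg : s.reg = s'.reg := by
    funext x
    by_cases hx : 3 ≤ x
    · rw [ar x hx, br x hx]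
    · have : x = 0 ∨ x = 1 ∨ x = 2 := by omega
      rcases this with rfl | rfl | rfl
      · rw [a0, b0]
      · rw [a1, b1]
      · rw [a2, b2]
  have harr : s.arr = s'.arr := by
    funext a i
    by_cases hz : (a < 2 → 2 * I.m ≤ i) ∧ (a = 2 ∨ a = 3 → I.k ≤ i)
    · rw [aa a i hz.1 hz.2, ba a i hz.1 hz.2]
    · have : (a = 0 ∧ i < 2 * I.m) ∨ (a = 1 ∧ i < 2 * I.m) ∨ (a = 2 ∧ i < I.k) ∨
          (a = 3 ∧ i < I.k) := by omega
      rcases this with ⟨rfl, hi⟩ | ⟨rfl, hi⟩ | ⟨rfl, hi⟩ | ⟨rfl, hi⟩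
      · obtain ⟨d, rfl⟩ := exists_dartIndex hi
        rw [a3, b3]
      · obtain ⟨d, rfl⟩ := exists_dartIndex hi
        rw [a4, b4]
      · exact (a5 ⟨i, hi⟩).trans (b5 ⟨i, hi⟩).symm
      · exact (a6 ⟨i, hi⟩).trans (b6 ⟨i, hi⟩).symm
  cases s
  cases s'
  exact congr (congrArg State.mk hreg) harr

end RAM

theorem mainTheorem6 :
    ∃ (c : ℕ) (f : PlanarInstance → PlanarInstance),
      RAM.PolyTimeComputable f ∧
      ∀ I : PlanarInstance,
        (I.G.HasUncrossedTrailFlow I.H ↔ (f I).G.HasNodeDisjointPaths (f I).H) ∧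
        (f I).n ≤ c * max 1 I.G.maxDegree ^ 3 * I.n := by
  -- The output must depend on the instance alone. Since the initial state is unique, the output
  -- obtained for one initial state serves for all.
  have key : ∀ I : PlanarInstance, ∃ J : PlanarInstance,
      (∀ s : RAM.State, s.IsInitial I → ∃ s', RAM.RunsIn RAM.reductionProgram s s'
        (700 * (2 * I.size + 1) ^ 3) ∧ s'.Holds J) ∧
      (I.G.HasUncrossedTrailFlow I.H ↔ J.G.HasNodeDisjointPaths J.H) ∧
      J.n ≤ 4 * max 1 I.G.maxDegree ^ 3 * I.n := by
    intro I
    obtain ⟨s₀, hs₀⟩ := RAM.exists_isInitial I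
    obtain ⟨s', J, hrun, hJ, hiff, hn⟩ := RAM.reductionProgram_spec I hs₀
    exact ⟨J, fun s hs => hs.eq hs₀ ▸ ⟨s', hrun, hJ⟩, hiff, hn⟩
  choose f hf using key
  refine ⟨4, f, ⟨RAM.reductionProgram, 700 * (2 * Polynomial.X + 1) ^ 3, fun I s hs => ?_⟩,
    fun I => (hf I).2⟩
  obtain ⟨s', ⟨t, ht, hrun⟩, hJ⟩ := (hf I).1 s hs
  refine ⟨s', t, hrun, ?_, hJ⟩
  simpa using ht
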